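/- Let $n\ge 1$ and let $g:[0,\infty)\to[0,\infty)$ be measurable such that $z\mapsto g(\|z\|^2)$ is a probability density on $\mathbb R^{n+1}$ with finite second moments. Let $(U_0,U_1)\in\mathbb R\times\mathbb R^n$ be a random vector with this density and let $R=\|U_1\|$ be the generating variate of $U_1$. For $\mu,\alpha\in\mathbb R^n$, a positive definite $n\times n$ matrix $\Omega$ and a density generator $h$ in dimension $n+1$, let $SE_n(\mu,\Omega,\alpha,h)$ be the skew-elliptical law on $\mathbb R^n$ with density $$2|\Omega|^{-1/2}\,h^{(n)}(q)\,F_{q}\big(\alpha'(x-\mu)\big),\qquad q=(x-\mu)'\Omega^{-1}(x-\mu),$$ where $h^{(n)}(q)=\int_{\mathbb R}h(q+v^2)\,dv$ and $F_q(s)=\int_{-\infty}^s h(q+v^2)\,dv\,/\,h^{(n)}(q)$. Its skewness vector is $\delta=\Omega\alpha/\sqrt{1+\alpha'\Omega\alpha}$; conversely $\alpha=\Omega^{-1}\delta/\sqrt{1-\delta'\Omega^{-1}\delta}$. Let $X\sim SE_n(\mu^x,\Omega^x,\alpha^x,g)$ and $Y\sim SE_n(\mu^y,\Omega^y,\alpha^y,g)$,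 with skewness vectors $\delta^x,\delta^y$. For $\lambda\in[0,1]$ put $\mu_\lambda=\lambda\mu^y+(1-\lambda)\mu^x$, $\delta_\lambda=\lambda\delta^y+(1-\lambda)\delta^x$, $\Omega_\lambda=\lambda\Omega^y+(1-\lambda)\Omega^x$, and $\alpha_\lambda=\Omega_\lambda^{-1}\delta_\lambda/\sqrt{1-\delta_\lambda'\Omega_\lambda^{-1}\delta_\lambda}$. Let * $\phi_\lambda$ be the density of $SE_n(\mu_\lambda,\Omega_\lambda,\alpha_\lambda,g)$; * $\phi_{1,\lambda}(x)=|\Sigma_\lambda|^{-1/2}g_1\big((x-\mu_\lambda)'\Sigma_\lambda^{-1}(x-\mu_\lambda)\big)$, the elliptical density with scale matrix $\Sigma_\lambda=\Omega_\lambda-\delta_\lambda\delta_\lambda'$ and generator $g_1(u)=\frac{1}{E|U_0|}\int_u^\infty g(s)\,ds$; * $\phi_{2,\lambda}$ be the density of $SE_n(\mu_\lambda,\Omega_\lambda,\alpha_\lambda,g_2)$ with $g_2(u)=\frac{n}{2E(R^2)}\int_u^\infty g(s)\,ds$. Let $f:\mathbb R^n\to\mathbb R$ be twice continuously differentiable with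 $f(x)=O(\|x\|)$ and $\nabla f(x)=O(\|x\|)$ as $\|x\|\to\infty$, with Hessian matrix $H_f$, and suppose that the integral of the Hessian term below exists, i.e. that $(\lambda,x)\mapsto \mathrm{tr}\{(\Omega^y-\Omega^x)H_f(x)\}\phi_{2,\lambda}(x)$ is Lebesgue integrable on $[0,1]\times\mathbb R^n$. Then, for every $\lambda\in[0,1]$, the functions $\phi_\lambda,\phi_{1,\lambda},\phi_{2,\lambda}$ are probability densities, the other expectations and integrals below exist as well, and $$\begin{aligned}E[f(Y)]-E[f(X)]={}&\int_0^1\!\!\int_{\mathbb R^n}(\mu^y-\mu^x)'\nabla f(x)\,\phi_\lambda(x)\,dx\,d\lambda\\&+E(|U_0|)\int_0^1\!\!\int_{\mathbb R^n}(\delta^y-\delta^x)'\nabla f(x)\,\phi_{1,\lambda}(x)\,dx\,d\lambda\\&+\frac{E(R^2)}{2n}\int_0^1\!\!\int_{\mathbb R^n}\mathrm{tr}\{(\Omega^y-\Omega^x)H_f(x)\}\,\phi_{2,\lambda}(x)\,dx\,d\lambda.\end{aligned}$$ -/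

import Mathlib

open MeasureTheory ProbabilityTheory Set
open scoped Matrix

/-- The quadratic form `v ↦ v' A v`. -/
noncomputable def quadForm {n : ℕ} (A : Matrix (Fin n) (Fin n) ℝ)
    (v : EuclideanSpace ℝ (Fin n)) : ℝ :=
  v.ofLp ⬝ᵥ (A *ᵥ v.ofLp)

/-- The product `A v` of a matrix and a Euclidean vector. -/
noncomputable def matVec {n : ℕ} (A : Matrix (Fin n) (Fin n) ℝ)
    (v : EuclideanSpace ℝ (Fin n)) : EuclideanSpace ℝ (Fin n) :=
  WithLp.toLp 2 (A *ᵥ v.ofLp)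

/-- `g` is a density generator in dimension `m`: `z ↦ g (‖z‖²)` is a probability density on `ℝᵐ`.
Only the values of `g` on `[0, ∞)` matter. -/
structure IsDensityGenerator (m : ℕ) (g : ℝ → ℝ) : Prop where
  measurable : Measurable g
  nonneg : ∀ u, 0 ≤ u → 0 ≤ g u
  integral_eq_one : ∫ z : EuclideanSpace ℝ (Fin m), g (‖z‖ ^ 2) = 1

/-- The standard spherical law on `ℝᵐ` with density generator `g`. -/
noncomputable def sphericalLaw (m : ℕ) (g : ℝ → ℝ) : Measure (EuclideanSpace ℝ (Fin m)) :=
  volume.withDensity fun z => ENNReal.ofReal (g (‖z‖ ^ 2))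

/-- `E|U₀|`, where `(U₀, U₁)` has the standard spherical law on `ℝ × ℝⁿ = ℝⁿ⁺¹` with
generator `g`. -/
noncomputable def meanAbsU (n : ℕ) (g : ℝ → ℝ) : ℝ :=
  ∫ z, |z 0| ∂(sphericalLaw (n + 1) g)

/-- `E(R²)`, where `R = ‖U₁‖` is the generating variate (radial part) of the `n`-dimensional
spherical vector `U₁`, and `(U₀, U₁)` has the standard spherical law on `ℝⁿ⁺¹` with
generator `g`. -/
noncomputable def meanSqR (n : ℕ) (g : ℝ → ℝ) : ℝ :=
  ∫ z, ∑ i : Fin n, (z i.succ) ^ 2 ∂(sphericalLaw (n + 1) g)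

/-- The density at `x` of the `n`-variate elliptical law `E_n(μ, Ω, h)`:
`|Ω|^{-1/2} h((x - μ)' Ω⁻¹ (x - μ))`. -/
noncomputable def ellipticalPDF {n : ℕ} (μ : EuclideanSpace ℝ (Fin n))
    (Ω : Matrix (Fin n) (Fin n) ℝ) (h : ℝ → ℝ) (x : EuclideanSpace ℝ (Fin n)) : ℝ :=
  (Real.sqrt Ω.det)⁻¹ * h (quadForm Ω⁻¹ (x - μ))

/-- The generator `g⁽ⁿ⁾` of the `n`-dimensional marginals, from the generator `g = g⁽ⁿ⁺¹⁾` in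
dimension `n + 1`. -/
noncomputable def marginalGen (g : ℝ → ℝ) (u : ℝ) : ℝ :=
  ∫ v : ℝ, g (u + v ^ 2)

/-- The univariate elliptical (conditional) distribution function
`F_q(s) = ∫_{-∞}^s g⁽ⁿ⁺¹⁾(q + v²) dv / g⁽ⁿ⁾(q)`. -/
noncomputable def skewingCDF (g : ℝ → ℝ) (q s : ℝ) : ℝ :=
  (∫ v in Iic s, g (q + v ^ 2)) / marginalGen g q

/-- The density of the skew-elliptical law `SE_n(μ, Ω, α, g⁽ⁿ⁺¹⁾)`:
`2 |Ω|^{-1/2} g⁽ⁿ⁾(q) F_q(α'(x - μ))` with `q = (x - μ)' Ω⁻¹ (x - μ)`. -/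
noncomputable def skewEllipticalPDF {n : ℕ} (μ : EuclideanSpace ℝ (Fin n))
    (Ω : Matrix (Fin n) (Fin n) ℝ) (α : EuclideanSpace ℝ (Fin n)) (g : ℝ → ℝ)
    (x : EuclideanSpace ℝ (Fin n)) : ℝ :=
  2 * ellipticalPDF μ Ω (marginalGen g) x *
    skewingCDF g (quadForm Ω⁻¹ (x - μ)) (inner ℝ α (x - μ))

/-- The skew-elliptical law `SE_n(μ, Ω, α, g⁽ⁿ⁺¹⁾)`. -/
noncomputable def skewEllipticalLaw {n : ℕ} (μ : EuclideanSpace ℝ (Fin n))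
    (Ω : Matrix (Fin n) (Fin n) ℝ) (α : EuclideanSpace ℝ (Fin n)) (g : ℝ → ℝ) :
    Measure (EuclideanSpace ℝ (Fin n)) :=
  volume.withDensity fun x => ENNReal.ofReal (skewEllipticalPDF μ Ω α g x)

/-- The skewness vector `δ_w = Ω α / √(1 + α'Ωα)` belonging to the slant vector `α`. -/
noncomputable def skewness {n : ℕ} (Ω : Matrix (Fin n) (Fin n) ℝ)
    (α : EuclideanSpace ℝ (Fin n)) : EuclideanSpace ℝ (Fin n) :=
  (Real.sqrt (1 + quadForm Ω α))⁻¹ • matVec Ω α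

/-- The slant vector `α = Ω⁻¹ δ / √(1 - δ'Ω⁻¹δ)` belonging to the skewness vector `δ`
(the inverse of `skewness`). -/
noncomputable def slant {n : ℕ} (Ω : Matrix (Fin n) (Fin n) ℝ)
    (δ : EuclideanSpace ℝ (Fin n)) : EuclideanSpace ℝ (Fin n) :=
  (Real.sqrt (1 - quadForm Ω⁻¹ δ))⁻¹ • matVec Ω⁻¹ δ

/-- The linear interpolation `l • b + (1 - l) • a`. -/
noncomputable def interp {V : Type*} [AddCommGroup V] [Module ℝ V] (a b : V) (l : ℝ) : V :=
  l • b + (1 - l) • a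

/-- `∫_u^∞ g(s) ds`. -/
noncomputable def tailIntegral (g : ℝ → ℝ) (u : ℝ) : ℝ :=
  ∫ s in Ioi u, g s

/-- The density `φ_λ` of `SE_n` with the interpolated parameters `(μ_λ, Ω_λ, δ_λ)` and
generator `g`. Here `μx, Ωx, δx` and `μy, Ωy, δy` are location, scale matrix and skewness vector
at `λ = 0` and `λ = 1`. -/
noncomputable def phi {n : ℕ} (g : ℝ → ℝ) (μx μy δx δy : EuclideanSpace ℝ (Fin n))
    (Ωx Ωy : Matrix (Fin n) (Fin n) ℝ) (l : ℝ) : EuclideanSpace ℝ (Fin n) → ℝ :=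
  skewEllipticalPDF (interp μx μy l) (interp Ωx Ωy l)
    (slant (interp Ωx Ωy l) (interp δx δy l)) g

/-- The density `φ_{1,λ}`: elliptical, with location `μ_λ`, scale matrix `Ω_λ - δ_λ δ_λ'` and
`n`-dimensional generator `u ↦ ∫_u^∞ g(s) ds / E|U₀|`. -/
noncomputable def phi₁ {n : ℕ} (g : ℝ → ℝ) (μx μy δx δy : EuclideanSpace ℝ (Fin n))
    (Ωx Ωy : Matrix (Fin n) (Fin n) ℝ) (l : ℝ) : EuclideanSpace ℝ (Fin n) → ℝ :=
  ellipticalPDF (interp μx μy l)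
    (interp Ωx Ωy l - Matrix.vecMulVec (interp δx δy l).ofLp (interp δx δy l).ofLp)
    (fun u => tailIntegral g u / meanAbsU n g)

/-- The density `φ_{2,λ}`: skew-elliptical with the interpolated parameters `(μ_λ, Ω_λ, δ_λ)` and
`(n+1)`-dimensional generator `u ↦ n / (2 E(R²)) ∫_u^∞ g(s) ds`. -/
noncomputable def phi₂ {n : ℕ} (g : ℝ → ℝ) (μx μy δx δy : EuclideanSpace ℝ (Fin n))
    (Ωx Ωy : Matrix (Fin n) (Fin n) ℝ) (l : ℝ) : EuclideanSpace ℝ (Fin n) → ℝ :=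
  skewEllipticalPDF (interp μx μy l) (interp Ωx Ωy l)
    (slant (interp Ωx Ωy l) (interp δx δy l))
    (fun u => n / (2 * meanSqR n g) * tailIntegral g u)

/-- `p` is a probability density with respect to Lebesgue measure on `ℝⁿ`. -/
structure IsProbDensity {n : ℕ} (p : EuclideanSpace ℝ (Fin n) → ℝ) : Prop where
  measurable : Measurable p
  nonneg : ∀ x, 0 ≤ p x
  integral_eq_one : ∫ x, p x = 1

/-- The Hessian matrix of `f` at `x`: its `(i, j)` entry is `∂²f/∂x_i∂x_j (x)`. -/
noncomputable def hessianMatrix {n : ℕ} (f : EuclideanSpace ℝ (Fin n) → ℝ)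
    (x : EuclideanSpace ℝ (Fin n)) : Matrix (Fin n) (Fin n) ℝ :=
  Matrix.of fun i j =>
    fderiv ℝ (fun y => fderiv ℝ f y (EuclideanSpace.single j 1)) x (EuclideanSpace.single i 1)

/-! The argument is a smart path with a stochastic representation. Factor `Ω - δδ' = A Aᵀ`. If `(U,
V)` is spherical on `ℝ × ℝⁿ` with generator `g`, conditioned on `U > 0`, then `μ + U δ + A V` has
the law `SE_n(μ, Ω, α, g)` (`lintegral_skewEllipticalPDF`, `withDensity_skewEllipticalPDF`):
completing the square along the lines `(y - u e, u)`, where `δ = A e`, reproduces the skewed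
density. The matrices `Ω_λ - δ_λ δ_λ'` stay positive definite along the path, so the expectation of
`f` under `φ_λ` is an integral of `f(μ_λ + U δ_λ + A_λ V)` against a measure not depending on `λ`.

Differentiating in `λ` gives the expectation of `∇f · (μ' + U δ' + A' V)`. The part with `μ'` is the
first term of the formula. The others are integrated by parts: with `G(z) = ∫_{‖z‖²}^∞ g` one has
`∂_i G = -2 z_i g(‖z‖²)`, so a factor `z_i` against `g` becomes a derivative against `G`
(`stein_Ioi`, `HasSecondMoment.stein_half`, `HasSecondMoment.stein_coord`). In the direction `U` the
half space has the boundary `U = 0`, whose contribution is an integral against the elliptical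
density `φ_{1,λ}`. The interior terms combine, because `A' Aᵀ` is half the derivative of `Ω_λ - δ_λ
δ_λ'` and the contribution of `δ'` restores the missing rank-one part, to half the trace of `(Ω^y -
Ω^x) H_f` against `G`, that is, against `φ_{2,λ}` (`integral_fderiv_skewMap`). A factor `A_λ` that
is differentiable at a given `λ` comes from a local square root near the identity
(`exists_hasDerivAt_factor`).

The fundamental theorem of calculus then settles bounded `f` with bounded derivatives. For linear
growth, `f` is multiplied by dilated cutoffs. Their first two derivatives are `O(1/(1 + ‖x‖))`
uniformly, so the extra terms in the Hessian are bounded and dominated convergence applies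
(`exists_cutoff`, `integral_phi_sub`). -/

/-! ### Rank-one updates, positive definiteness along the path, skewness and slant. -/

section LinearAlgebra

variable {n : ℕ}

/-- Sherman–Morrison for `A Aᵀ + (A e)(A e)ᵀ`, as a bilinear form. -/
theorem dotProduct_inv_mulVec_of_rank_one {A Ω : Matrix (Fin n) (Fin n) ℝ} {e : Fin n → ℝ}
    (hA : A.det ≠ 0) (hΩ : Ω = A * Aᵀ + Matrix.vecMulVec (A *ᵥ e) (A *ᵥ e)) (x y : Fin n → ℝ) :
    (A *ᵥ x) ⬝ᵥ (Ω⁻¹ *ᵥ (A *ᵥ y)) = x ⬝ᵥ y - (e ⬝ᵥ x) * (e ⬝ᵥ y) / (1 + e ⬝ᵥ e) := by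
  have hpos : (0 : ℝ) < 1 + e ⬝ᵥ e := by
    have : 0 ≤ e ⬝ᵥ e := Finset.sum_nonneg fun i _ => mul_self_nonneg (e i)
    linarith
  have hA' : IsUnit A.det := isUnit_iff_ne_zero.2 hA
  have hAT : IsUnit Aᵀ.det := by rwa [Matrix.det_transpose]
  have hfac : Ω = A * (1 + Matrix.vecMulVec e e) * Aᵀ := by
    rw [hΩ, Matrix.mul_add, Matrix.add_mul, Matrix.mul_one, Matrix.mul_vecMulVec,
      Matrix.vecMulVec_mul, Matrix.vecMul_transpose]
  have hdet : Ω.det ≠ 0 := by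
    rw [hfac, Matrix.det_mul, Matrix.det_mul, Matrix.det_transpose, Matrix.vecMulVec_eq Unit,
      Matrix.det_one_add_replicateCol_mul_replicateRow]
    exact mul_ne_zero (mul_ne_zero hA hpos.ne') hA
  have hΩ' : IsUnit Ω.det := isUnit_iff_ne_zero.2 hdet
  set t : Fin n → ℝ := y - ((e ⬝ᵥ y) / (1 + e ⬝ᵥ e)) • e with ht
  have hsol : Ω *ᵥ (Aᵀ⁻¹ *ᵥ t) = A *ᵥ y := by
    rw [hfac, ← Matrix.mulVec_mulVec, Matrix.mulVec_mulVec t, Matrix.mul_nonsing_inv _ hAT,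
      Matrix.one_mulVec, ← Matrix.mulVec_mulVec]
    congr 1
    rw [Matrix.add_mulVec, Matrix.one_mulVec, Matrix.vecMulVec_mulVec, ht]
    ext i
    simp only [Pi.add_apply, Pi.sub_apply, Pi.smul_apply, smul_eq_mul, dotProduct_sub,
      dotProduct_smul, MulOpposite.smul_eq_mul_unop, MulOpposite.unop_op]
    field_simp
    ring
  have hinv : Ω⁻¹ *ᵥ (A *ᵥ y) = Aᵀ⁻¹ *ᵥ t := by
    rw [← hsol, Matrix.mulVec_mulVec, Matrix.nonsing_inv_mul _ hΩ', Matrix.one_mulVec]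
  have hx : (A *ᵥ x) ⬝ᵥ (Aᵀ⁻¹ *ᵥ t) = x ⬝ᵥ t := by
    rw [Matrix.dotProduct_mulVec, ← Matrix.vecMul_transpose, Matrix.vecMul_vecMul,
      Matrix.mul_nonsing_inv _ hAT, Matrix.vecMul_one]
  rw [hinv, hx, ht, dotProduct_sub, dotProduct_smul, smul_eq_mul, dotProduct_comm x e]
  ring

theorem det_mul_transpose_add_rank_one (A : Matrix (Fin n) (Fin n) ℝ) (e : Fin n → ℝ) :
    (A * Aᵀ + Matrix.vecMulVec (A *ᵥ e) (A *ᵥ e)).det = A.det ^ 2 * (1 + e ⬝ᵥ e) := by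
  have hfac : A * Aᵀ + Matrix.vecMulVec (A *ᵥ e) (A *ᵥ e)
      = A * (1 + Matrix.vecMulVec e e) * Aᵀ := by
    rw [Matrix.mul_add, Matrix.add_mul, Matrix.mul_one, Matrix.mul_vecMulVec,
      Matrix.vecMulVec_mul, Matrix.vecMul_transpose]
  rw [hfac, Matrix.det_mul, Matrix.det_mul, Matrix.det_transpose, Matrix.vecMulVec_eq Unit,
    Matrix.det_one_add_replicateCol_mul_replicateRow]
  ring

theorem quadForm_inv_mul_transpose {A S : Matrix (Fin n) (Fin n) ℝ} (hA : A.det ≠ 0)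
    (hS : S = A * Aᵀ) (y : Fin n → ℝ) :
    quadForm S⁻¹ (WithLp.toLp 2 (A *ᵥ y)) = ∑ i, y i ^ 2 := by
  have := dotProduct_inv_mulVec_of_rank_one (Ω := S) (e := 0) hA (by simp [hS]) y y
  simp only [quadForm, this]
  simp [dotProduct, sq]

theorem posDef_iff_quadForm {M : Matrix (Fin n) (Fin n) ℝ} :
    M.PosDef ↔ Mᵀ = M ∧ ∀ x : EuclideanSpace ℝ (Fin n), x ≠ 0 → 0 < quadForm M x := by
  rw [Matrix.posDef_iff_dotProduct_mulVec]
  simp only [Matrix.IsHermitian, Matrix.conjTranspose_eq_transpose_of_trivial, star_trivial]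
  refine and_congr_right fun _ => ⟨fun h x hx => h (x := x.ofLp) ?_, fun h x hx => ?_⟩
  · simpa using hx
  · exact h (WithLp.toLp 2 x) (by simpa using hx)

theorem exists_factor_of_posDef {S : Matrix (Fin n) (Fin n) ℝ} (hS : S.PosDef) :
    ∃ A : Matrix (Fin n) (Fin n) ℝ, A.det ≠ 0 ∧ A * Aᵀ = S := by
  obtain ⟨B, hB⟩ : ∃ B : Matrix (Fin n) (Fin n) ℝ, S = Bᴴ * B := by
    open scoped MatrixOrder in
    exact CStarAlgebra.nonneg_iff_eq_star_mul_self.1 hS.posSemidef.nonneg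
  rw [Matrix.conjTranspose_eq_transpose_of_trivial] at hB
  refine ⟨Bᵀ, fun h => ?_, by rw [Matrix.transpose_transpose, hB]⟩
  have := hS.det_pos
  rw [hB, Matrix.det_mul, h, zero_mul] at this
  exact this.false

theorem quadForm_eq_sum (M : Matrix (Fin n) (Fin n) ℝ) (x : EuclideanSpace ℝ (Fin n)) :
    quadForm M x = ∑ i, ∑ j, x i * M i j * x j := by
  simp only [quadForm, dotProduct, Matrix.mulVec, Finset.mul_sum, mul_assoc]

theorem quadForm_sub (M N : Matrix (Fin n) (Fin n) ℝ) (x : EuclideanSpace ℝ (Fin n)) :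
    quadForm (M - N) x = quadForm M x - quadForm N x := by
  simp [quadForm, Matrix.sub_mulVec, dotProduct_sub]

theorem quadForm_interp (M N : Matrix (Fin n) (Fin n) ℝ) (l : ℝ)
    (x : EuclideanSpace ℝ (Fin n)) :
    quadForm (interp M N l) x = interp (quadForm M x) (quadForm N x) l := by
  simp [quadForm, interp, Matrix.add_mulVec, Matrix.smul_mulVec, dotProduct_add, dotProduct_smul]

theorem quadForm_vecMulVec (d : Fin n → ℝ) (x : EuclideanSpace ℝ (Fin n)) :
    quadForm (Matrix.vecMulVec d d) x = (d ⬝ᵥ x.ofLp) ^ 2 := by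
  simp [quadForm, Matrix.vecMulVec_mulVec, dotProduct_smul, dotProduct_comm x.ofLp d, sq]

/-- Cauchy–Schwarz for a positive definite form. -/
theorem sq_dotProduct_mulVec_le {M : Matrix (Fin n) (Fin n) ℝ} (hM : M.PosDef)
    (x a : EuclideanSpace ℝ (Fin n)) :
    (x.ofLp ⬝ᵥ (M *ᵥ a.ofLp)) ^ 2 ≤ quadForm M x * quadForm M a := by
  obtain ⟨A, -, rfl⟩ := exists_factor_of_posDef hM
  have key : ∀ u v : Fin n → ℝ, u ⬝ᵥ ((A * Aᵀ) *ᵥ v) = (Aᵀ *ᵥ u) ⬝ᵥ (Aᵀ *ᵥ v) := fun u v => by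
    rw [← Matrix.mulVec_mulVec, Matrix.dotProduct_mulVec, ← Matrix.mulVec_transpose]
  simp only [quadForm, key]
  simp only [dotProduct, ← sq]
  exact Finset.sum_mul_sq_le_sq_mul_sq _ _ _

theorem quadForm_nonneg {M : Matrix (Fin n) (Fin n) ℝ} (hM : M.PosDef)
    (x : EuclideanSpace ℝ (Fin n)) : 0 ≤ quadForm M x := by
  rcases eq_or_ne x 0 with rfl | hx
  · simp [quadForm]
  · exact ((posDef_iff_quadForm.1 hM).2 x hx).le

/-- By Cauchy–Schwarz, `(x'Ωα)² ≤ (x'Ωx)(α'Ωα)`, and `α'Ωα / (1 + α'Ωα) < 1` makes the inequality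
for `δ` strict. -/
theorem posDef_sub_skewness {Ω : Matrix (Fin n) (Fin n) ℝ} (hΩ : Ω.PosDef)
    (α : EuclideanSpace ℝ (Fin n)) :
    (Ω - Matrix.vecMulVec (skewness Ω α).ofLp (skewness Ω α).ofLp).PosDef := by
  rw [posDef_iff_quadForm]
  refine ⟨by rw [Matrix.transpose_sub, (posDef_iff_quadForm.1 hΩ).1, Matrix.transpose_vecMulVec],
    fun x hx => ?_⟩
  have h0 := (posDef_iff_quadForm.1 hΩ).2 x hx
  have ha := quadForm_nonneg hΩ α
  have hcs := sq_dotProduct_mulVec_le hΩ x α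
  have hs : √(1 + quadForm Ω α) ^ 2 = 1 + quadForm Ω α := Real.sq_sqrt (by linarith)
  rw [quadForm_sub, quadForm_vecMulVec, skewness, matVec, WithLp.ofLp_smul, smul_dotProduct,
    dotProduct_comm, smul_eq_mul, mul_pow, inv_pow, hs, sub_pos, inv_mul_lt_iff₀ (by linarith)]
  nlinarith

/-- The condition `(δ'x)² < x'Ωx` is convex in `(δ, Ω)`, since its left side is convex in `δ` and
its right side is linear in `Ω`. Hence it passes from the end points to the whole path. -/
theorem posDef_interp_sub {Ω₀ Ω₁ : Matrix (Fin n) (Fin n) ℝ} {δ₀ δ₁ : EuclideanSpace ℝ (Fin n)}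
    (h₀ : (Ω₀ - Matrix.vecMulVec δ₀.ofLp δ₀.ofLp).PosDef)
    (h₁ : (Ω₁ - Matrix.vecMulVec δ₁.ofLp δ₁.ofLp).PosDef) {l : ℝ} (hl : l ∈ Icc (0 : ℝ) 1) :
    (interp Ω₀ Ω₁ l - Matrix.vecMulVec (interp δ₀ δ₁ l).ofLp (interp δ₀ δ₁ l).ofLp).PosDef := by
  rw [posDef_iff_quadForm] at *
  have hT : ∀ {M : Matrix (Fin n) (Fin n) ℝ} {d : Fin n → ℝ},
      (M - Matrix.vecMulVec d d)ᵀ = M - Matrix.vecMulVec d d ↔ Mᵀ = M := fun {M d} => by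
    rw [Matrix.transpose_sub, Matrix.transpose_vecMulVec, sub_left_inj]
  refine ⟨?_, fun x hx => ?_⟩
  · rw [hT] at *
    rw [interp, Matrix.transpose_add, Matrix.transpose_smul, Matrix.transpose_smul, h₀.1, h₁.1]
  · have h0 := h₀.2 x hx
    have h1 := h₁.2 x hx
    rw [quadForm_sub, quadForm_vecMulVec] at *
    rw [quadForm_interp]
    simp only [interp, WithLp.ofLp_add, WithLp.ofLp_smul, add_dotProduct, smul_dotProduct,
      smul_eq_mul]
    obtain ⟨hl0, hl1⟩ := hl
    have hconv : (l * (δ₁.ofLp ⬝ᵥ x.ofLp) + (1 - l) * (δ₀.ofLp ⬝ᵥ x.ofLp)) ^ 2 ≤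
        l * (δ₁.ofLp ⬝ᵥ x.ofLp) ^ 2 + (1 - l) * (δ₀.ofLp ⬝ᵥ x.ofLp) ^ 2 := by
      nlinarith [mul_nonneg (mul_nonneg hl0 (sub_nonneg.2 hl1))
        (sq_nonneg (δ₁.ofLp ⬝ᵥ x.ofLp - δ₀.ofLp ⬝ᵥ x.ofLp))]
    -- Strictness is taken from the term of weight `l`, so `l = 0` is treated apart.
    rcases hl0.eq_or_lt with rfl | hl0'
    · linarith
    · have := mul_lt_mul_of_pos_left (sub_pos.1 h1) hl0'
      have := mul_le_mul_of_nonneg_left (sub_pos.1 h0).le (sub_nonneg.2 hl1)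
      linarith

theorem slant_skewness {Ω : Matrix (Fin n) (Fin n) ℝ} (hΩ : Ω.PosDef)
    (α : EuclideanSpace ℝ (Fin n)) : slant Ω (skewness Ω α) = α := by
  have hdet : IsUnit Ω.det := isUnit_iff_ne_zero.2 hΩ.det_pos.ne'
  have ha := quadForm_nonneg hΩ α
  have hs : √(1 + quadForm Ω α) ^ 2 = 1 + quadForm Ω α := Real.sq_sqrt (by linarith)
  have hp : 0 < √(1 + quadForm Ω α) := Real.sqrt_pos.2 (by linarith)
  have h1 : matVec Ω⁻¹ (skewness Ω α) = (√(1 + quadForm Ω α))⁻¹ • α := by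
    simp only [matVec, skewness, WithLp.ofLp_smul, Matrix.mulVec_smul, Matrix.mulVec_mulVec,
      Matrix.nonsing_inv_mul _ hdet, Matrix.one_mulVec, WithLp.toLp_smul, WithLp.toLp_ofLp]
  have h2 : quadForm Ω⁻¹ (skewness Ω α) = quadForm Ω α / (1 + quadForm Ω α) := by
    have : quadForm Ω⁻¹ (skewness Ω α)
        = (skewness Ω α).ofLp ⬝ᵥ (matVec Ω⁻¹ (skewness Ω α)).ofLp := rfl
    rw [this, h1]
    simp only [skewness, WithLp.ofLp_smul, smul_dotProduct, dotProduct_smul, smul_eq_mul, matVec]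
    rw [dotProduct_comm, ← quadForm, ← mul_assoc, ← sq, inv_pow, hs]
    ring
  have h3 : 1 - quadForm Ω⁻¹ (skewness Ω α) = (1 + quadForm Ω α)⁻¹ := by
    rw [h2]; field_simp; ring
  rw [slant, h3, h1, Real.sqrt_inv, inv_inv, smul_smul, mul_inv_cancel₀ hp.ne', one_smul]

end LinearAlgebra

/-! ### Affine change of variables. -/

section ChangeOfVariables

variable {n : ℕ}

/-- The affine bijection `y ↦ μ + C y`. -/
noncomputable def affineEquiv (μ : EuclideanSpace ℝ (Fin n)) (C : Matrix (Fin n) (Fin n) ℝ)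
    (hC : C.det ≠ 0) : (Fin n → ℝ) ≃ᵐ EuclideanSpace ℝ (Fin n) where
  toFun y := μ + WithLp.toLp 2 (C *ᵥ y)
  invFun x := C⁻¹ *ᵥ (x - μ).ofLp
  left_inv y := by simp [Matrix.mulVec_mulVec, Matrix.nonsing_inv_mul _ (isUnit_iff_ne_zero.2 hC)]
  right_inv x := by
    simp [Matrix.mulVec_sub, Matrix.mulVec_mulVec,
      Matrix.mul_nonsing_inv _ (isUnit_iff_ne_zero.2 hC)]
  measurable_toFun := by
    have : Measurable (Matrix.toLin' C) := by fun_prop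
    simp only [Equiv.coe_fn_mk, ← Matrix.toLin'_apply]
    fun_prop
  measurable_invFun := by
    have : Measurable (Matrix.toLin' C⁻¹) := by fun_prop
    simp only [Equiv.coe_fn_symm_mk, ← Matrix.toLin'_apply]
    fun_prop

theorem map_affineEquiv (μ : EuclideanSpace ℝ (Fin n)) (C : Matrix (Fin n) (Fin n) ℝ)
    (hC : C.det ≠ 0) :
    Measure.map (affineEquiv μ C hC) volume = ENNReal.ofReal |C.det|⁻¹ • volume := by
  have h : (affineEquiv μ C hC : (Fin n → ℝ) → EuclideanSpace ℝ (Fin n))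
      = (fun x => μ + x) ∘ WithLp.toLp 2 ∘ Matrix.toLin' C := rfl
  rw [h, ← Measure.map_map (by fun_prop) (by fun_prop), ← Measure.map_map (by fun_prop)
    (by fun_prop), Real.map_matrix_volume_pi_eq_smul_volume_pi hC, Measure.map_smul,
    Measure.map_smul, (PiLp.volume_preserving_toLp (Fin n)).map_eq,
    (measurePreserving_add_left volume μ).map_eq, abs_inv]

theorem lintegral_affine (μ : EuclideanSpace ℝ (Fin n)) {C : Matrix (Fin n) (Fin n) ℝ}
    (hC : C.det ≠ 0) (F : EuclideanSpace ℝ (Fin n) → ENNReal) :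
    ∫⁻ y, F (μ + WithLp.toLp 2 (C *ᵥ y)) = ENNReal.ofReal |C.det|⁻¹ * ∫⁻ x, F x := by
  have := lintegral_map_equiv (μ := volume) F (affineEquiv μ C hC)
  rw [map_affineEquiv, lintegral_smul_measure] at this
  exact this.symm

theorem integral_affine (μ : EuclideanSpace ℝ (Fin n)) {C : Matrix (Fin n) (Fin n) ℝ}
    (hC : C.det ≠ 0) (F : EuclideanSpace ℝ (Fin n) → ℝ) :
    ∫ y, F (μ + WithLp.toLp 2 (C *ᵥ y)) = |C.det|⁻¹ * ∫ x, F x := by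
  have := integral_map_equiv (μ := volume) (affineEquiv μ C hC) F
  rw [map_affineEquiv, integral_smul_measure, ENNReal.toReal_ofReal (by positivity)] at this
  exact this.symm

theorem integrable_affine_iff (μ : EuclideanSpace ℝ (Fin n)) {C : Matrix (Fin n) (Fin n) ℝ}
    (hC : C.det ≠ 0) (F : EuclideanSpace ℝ (Fin n) → ℝ) :
    Integrable (fun y => F (μ + WithLp.toLp 2 (C *ᵥ y))) ↔ Integrable F := by
  have := integrable_map_equiv (μ := volume) (affineEquiv μ C hC) F
  rw [map_affineEquiv, integrable_smul_measure (by simpa using hC) (by simp)] at this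
  exact this.symm

end ChangeOfVariables

/-! ### Fubini with one coordinate singled out, on the whole space and on a half space. -/

section Coordinates

variable {n : ℕ}

theorem sum_sq_insertNth (i : Fin (n + 1)) (t : ℝ) (y : Fin n → ℝ) :
    ∑ j, (i.insertNth t y : Fin (n + 1) → ℝ) j ^ 2 = ∑ j, y j ^ 2 + t ^ 2 := by
  rw [Fin.sum_univ_succAbove _ i, add_comm]
  simp

theorem measurePreserving_insertNth (i : Fin (n + 1)) :
    MeasurePreserving (fun p : (Fin n → ℝ) × ℝ => (i.insertNth p.2 p.1 : Fin (n + 1) → ℝ)) :=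
  ((volume_preserving_piFinSuccAbove (fun _ : Fin (n + 1) => ℝ) i).symm _).comp
    Measure.measurePreserving_swap

theorem measurableEmbedding_insertNth (i : Fin (n + 1)) :
    MeasurableEmbedding (fun p : (Fin n → ℝ) × ℝ => (i.insertNth p.2 p.1 : Fin (n + 1) → ℝ)) :=
  (MeasurableEquiv.prodComm.trans
    (MeasurableEquiv.piFinSuccAbove (fun _ : Fin (n + 1) => ℝ) i).symm).measurableEmbedding

theorem measurable_insertNth (i : Fin (n + 1)) :
    Measurable (fun p : (Fin n → ℝ) × ℝ => (i.insertNth p.2 p.1 : Fin (n + 1) → ℝ)) :=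
  (measurableEmbedding_insertNth i).measurable

theorem integrable_insertNth {i : Fin (n + 1)} {F : (Fin (n + 1) → ℝ) → ℝ} :
    Integrable (fun p : (Fin n → ℝ) × ℝ => F (i.insertNth p.2 p.1)) ↔ Integrable F :=
  (measurePreserving_insertNth i).integrable_comp_emb (measurableEmbedding_insertNth i)

theorem integral_insertNth (i : Fin (n + 1)) {F : (Fin (n + 1) → ℝ) → ℝ} (hF : Integrable F) :
    ∫ z, F z = ∫ y : Fin n → ℝ, ∫ t : ℝ, F (i.insertNth t y) := by
  rw [← (measurePreserving_insertNth i).integral_comp (measurableEmbedding_insertNth i)]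
  exact integral_prod _ (integrable_insertNth.2 hF)

theorem measurableSet_coord_pos (i : Fin (n + 1)) :
    MeasurableSet {z : Fin (n + 1) → ℝ | 0 < z i} :=
  measurableSet_lt measurable_const (measurable_pi_apply i)

theorem setIntegral_insertNth (i : Fin (n + 1)) {F : (Fin (n + 1) → ℝ) → ℝ}
    (hF : IntegrableOn F {z | 0 < z i}) :
    ∫ z in {z | 0 < z i}, F z = ∫ y : Fin n → ℝ, ∫ t in Ioi (0 : ℝ), F (i.insertNth t y) := by
  rw [← integral_indicator (measurableSet_coord_pos i), integral_insertNth i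
    ((integrable_indicator_iff (measurableSet_coord_pos i)).2 hF)]
  refine integral_congr_ae (.of_forall fun y => ?_)
  dsimp only
  rw [← integral_indicator measurableSet_Ioi]
  refine integral_congr_ae (.of_forall fun t => ?_)
  simp [indicator]

theorem lintegral_insertNth (i : Fin (n + 1)) {F : (Fin (n + 1) → ℝ) → ENNReal}
    (hF : Measurable F) :
    ∫⁻ z, F z = ∫⁻ t : ℝ, ∫⁻ y : Fin n → ℝ, F (i.insertNth t y) := by
  rw [← (measurePreserving_insertNth i).lintegral_comp hF]
  exact lintegral_prod_symm' _ (hF.comp (measurable_insertNth i))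

theorem setLIntegral_insertNth (i : Fin (n + 1)) {F : (Fin (n + 1) → ℝ) → ENNReal}
    (hF : Measurable F) :
    ∫⁻ z in {z | 0 < z i}, F z = ∫⁻ t in Ioi (0 : ℝ), ∫⁻ y : Fin n → ℝ, F (i.insertNth t y) := by
  rw [← lintegral_indicator (measurableSet_coord_pos i), lintegral_insertNth i
    (hF.indicator (measurableSet_coord_pos i)), ← lintegral_indicator measurableSet_Ioi]
  refine lintegral_congr fun t => ?_
  by_cases ht : 0 < t <;> simp [indicator, ht]

/-- Integration of a function even in the `i`-th coordinate. -/
theorem integral_eq_two_mul_of_abs (i : Fin (n + 1)) {F : (Fin (n + 1) → ℝ) → ℝ}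
    (hF : Integrable F)
    (h : ∀ y t, F (i.insertNth |t| y) = F (i.insertNth t y)) :
    ∫ z, F z = 2 * ∫ z in {z | 0 < z i}, F z := by
  rw [integral_insertNth i hF, setIntegral_insertNth i hF.integrableOn, ← integral_const_mul]
  refine integral_congr_ae (.of_forall fun y => ?_)
  dsimp only
  rw [← integral_comp_abs (f := fun t => F (i.insertNth t y))]
  simp only [h]

end Coordinates

/-! ### Density generators and the conditioned spherical law. -/

section Generator

variable {m n : ℕ} {h : ℝ → ℝ}

theorem integral_norm_sq_eq (F : (Fin m → ℝ) → ℝ) :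
    ∫ z : EuclideanSpace ℝ (Fin m), F z.ofLp = ∫ z : Fin m → ℝ, F z :=
  (PiLp.volume_preserving_ofLp (Fin m)).integral_comp
    (MeasurableEquiv.toLp 2 (Fin m → ℝ)).symm.measurableEmbedding F

theorem integrable_ofLp_iff (F : (Fin m → ℝ) → ℝ) :
    Integrable (fun z : EuclideanSpace ℝ (Fin m) => F z.ofLp) ↔ Integrable F :=
  (PiLp.volume_preserving_ofLp (Fin m)).integrable_comp_emb
    (MeasurableEquiv.toLp 2 (Fin m → ℝ)).symm.measurableEmbedding

theorem EuclideanSpace.norm_sq_eq_sum (z : EuclideanSpace ℝ (Fin m)) :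
    ‖z‖ ^ 2 = ∑ i, z.ofLp i ^ 2 := EuclideanSpace.real_norm_sq_eq z

theorem isDensityGenerator_iff : IsDensityGenerator m h ↔
    Measurable h ∧ (∀ u, 0 ≤ u → 0 ≤ h u) ∧ ∫ z : Fin m → ℝ, h (∑ i, z i ^ 2) = 1 := by
  rw [← integral_norm_sq_eq (m := m) (fun z => h (∑ i, z i ^ 2))]
  simp only [← EuclideanSpace.norm_sq_eq_sum]
  exact ⟨fun H => ⟨H.1, H.2, H.3⟩, fun H => ⟨H.1, H.2.1, H.2.2⟩⟩

theorem IsDensityGenerator.integral_pi (H : IsDensityGenerator m h) :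
    ∫ z : Fin m → ℝ, h (∑ i, z i ^ 2) = 1 := (isDensityGenerator_iff.1 H).2.2

/-- A non-integrable function would have integral `0` by convention, not `1`. -/
theorem IsDensityGenerator.integrable_pi (H : IsDensityGenerator m h) :
    Integrable (fun z : Fin m → ℝ => h (∑ i, z i ^ 2)) := by
  by_contra hc
  have := H.integral_pi
  rw [integral_undef hc] at this
  exact zero_ne_one this

theorem sum_sq_nonneg (z : Fin m → ℝ) : 0 ≤ ∑ i, z i ^ 2 :=
  Finset.sum_nonneg fun i _ => sq_nonneg (z i)

theorem measurable_sum_sq : Measurable fun z : Fin m → ℝ => ∑ i, z i ^ 2 := by fun_prop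

/-- The law of a spherical vector on `ℝⁿ⁺¹` conditioned on a positive first coordinate. -/
noncomputable def halfLaw (n : ℕ) (h : ℝ → ℝ) : Measure (Fin (n + 1) → ℝ) :=
  (volume.restrict {z | 0 < z 0}).withDensity fun z => ENNReal.ofReal (2 * h (∑ i, z i ^ 2))

theorem measurable_halfLaw_density (hm : Measurable h) :
    Measurable fun z : Fin (n + 1) → ℝ => ENNReal.ofReal (2 * h (∑ i, z i ^ 2)) :=
  ((hm.comp measurable_sum_sq).const_mul 2).ennreal_ofReal

theorem integral_halfLaw (H : IsDensityGenerator (n + 1) h) (F : (Fin (n + 1) → ℝ) → ℝ) :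
    ∫ z, F z ∂(halfLaw n h) = 2 * ∫ z in {z | 0 < z 0}, F z * h (∑ i, z i ^ 2) := by
  rw [halfLaw, integral_withDensity_eq_integral_toReal_smul
    (measurable_halfLaw_density H.measurable) (.of_forall fun _ => ENNReal.ofReal_lt_top),
    ← integral_const_mul]
  refine integral_congr_ae (.of_forall fun z => ?_)
  have : 0 ≤ 2 * h (∑ i, z i ^ 2) := mul_nonneg zero_le_two (H.nonneg _ (sum_sq_nonneg z))
  dsimp only
  rw [ENNReal.toReal_ofReal this, smul_eq_mul]
  ring

theorem integrable_halfLaw_iff (H : IsDensityGenerator (n + 1) h) (F : (Fin (n + 1) → ℝ) → ℝ) :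
    Integrable F (halfLaw n h) ↔
      IntegrableOn (fun z => F z * h (∑ i, z i ^ 2)) {z | 0 < z 0} := by
  rw [halfLaw, integrable_withDensity_iff (measurable_halfLaw_density H.measurable)
      (.of_forall fun _ => ENNReal.ofReal_lt_top),
    IntegrableOn, ← integrable_const_mul_iff (c := (2 : ℝ)) (by simp)
      (fun z => F z * h (∑ i, z i ^ 2))]
  refine integrable_congr (.of_forall fun z => ?_)
  have : 0 ≤ 2 * h (∑ i, z i ^ 2) := mul_nonneg zero_le_two (H.nonneg _ (sum_sq_nonneg z))
  dsimp only
  rw [ENNReal.toReal_ofReal this]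
  ring

theorem isProbabilityMeasure_halfLaw (H : IsDensityGenerator (n + 1) h) :
    IsProbabilityMeasure (halfLaw n h) := by
  have hint := H.integrable_pi
  have h2 := integral_eq_two_mul_of_abs 0 hint fun y t => by simp only [sum_sq_insertNth, sq_abs]
  rw [H.integral_pi, ← integral_const_mul] at h2
  constructor
  rw [halfLaw, withDensity_apply _ .univ, Measure.restrict_univ,
    ← ofReal_integral_eq_lintegral_ofReal (hint.integrableOn.const_mul 2)
      (.of_forall fun z => mul_nonneg zero_le_two (H.nonneg _ (sum_sq_nonneg z))), ← h2,
    ENNReal.ofReal_one]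

end Generator

/-! ### Joint measurability of the densities in their parameters and the point. -/

section Measurability

variable {n : ℕ} {Λ : Type*} [MeasurableSpace Λ] {h : ℝ → ℝ}

theorem Measurable.marginalGen (hm : Measurable h) : Measurable (marginalGen h) := by
  have : StronglyMeasurable fun p : ℝ × ℝ => h (p.1 + p.2 ^ 2) :=
    (hm.comp (by fun_prop)).stronglyMeasurable
  exact this.integral_prod_right.measurable

theorem Measurable.skewingCDF (hm : Measurable h) :
    Measurable fun p : ℝ × ℝ => skewingCDF h p.1 p.2 := by
  have hs : MeasurableSet {p : (ℝ × ℝ) × ℝ | p.2 ≤ p.1.2} :=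
    measurableSet_le (by fun_prop) (by fun_prop)
  have : StronglyMeasurable ({p : (ℝ × ℝ) × ℝ | p.2 ≤ p.1.2}.indicator
      fun p : (ℝ × ℝ) × ℝ => h (p.1.1 + p.2 ^ 2)) :=
    ((hm.comp (by fun_prop)).indicator hs).stronglyMeasurable
  have h2 := (this.integral_prod_right' (ν := (volume : Measure ℝ))).measurable
  refine Measurable.div ?_ (hm.marginalGen.comp measurable_fst)
  simp only [← integral_indicator measurableSet_Iic]
  exact h2

theorem Measurable.tailIntegral (hm : Measurable h) : Measurable (tailIntegral h) := by
  have hs : MeasurableSet {p : ℝ × ℝ | p.1 < p.2} := measurableSet_lt (by fun_prop) (by fun_prop)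
  have : StronglyMeasurable ({p : ℝ × ℝ | p.1 < p.2}.indicator fun p : ℝ × ℝ => h p.2) :=
    ((hm.comp (by fun_prop)).indicator hs).stronglyMeasurable
  have h2 := (this.integral_prod_right' (ν := (volume : Measure ℝ))).measurable
  have h3 : _root_.tailIntegral h = fun u => ∫ s, (Ioi u).indicator h s :=
    funext fun u => (integral_indicator measurableSet_Ioi).symm
  rw [h3]
  exact h2

theorem measurable_det {M : Λ → Matrix (Fin n) (Fin n) ℝ} (hM : ∀ i j, Measurable fun l => M l i j) :
    Measurable fun l => (M l).det := by
  simp only [Matrix.det_apply']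
  fun_prop

theorem measurable_inv_apply {M : Λ → Matrix (Fin n) (Fin n) ℝ}
    (hM : ∀ i j, Measurable fun l => M l i j) (i j : Fin n) :
    Measurable fun l => (M l)⁻¹ i j := by
  simp only [Matrix.inv_def, Ring.inverse_eq_inv', Matrix.smul_apply, smul_eq_mul,
    Matrix.adjugate_apply]
  refine (measurable_det hM).inv.mul (measurable_det fun a b => ?_)
  simp only [Matrix.updateRow_apply]
  split_ifs <;> fun_prop

theorem measurable_quadForm {M : Λ → Matrix (Fin n) (Fin n) ℝ}
    {x : Λ → EuclideanSpace ℝ (Fin n)}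
    (hM : ∀ i j, Measurable fun l => M l i j) (hx : Measurable x) :
    Measurable fun l => quadForm (M l) (x l) := by
  simp only [quadForm_eq_sum]
  fun_prop

theorem measurable_ellipticalPDF {μ x : Λ → EuclideanSpace ℝ (Fin n)}
    {Ω : Λ → Matrix (Fin n) (Fin n) ℝ} (hμ : Measurable μ)
    (hΩ : ∀ i j, Measurable fun l => Ω l i j) (hx : Measurable x) (hm : Measurable h) :
    Measurable fun l => ellipticalPDF (μ l) (Ω l) h (x l) :=
  (measurable_det hΩ).sqrt.inv.mul
    (hm.comp (measurable_quadForm (measurable_inv_apply hΩ) (hx.sub hμ)))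

theorem measurable_skewEllipticalPDF {μ α x : Λ → EuclideanSpace ℝ (Fin n)}
    {Ω : Λ → Matrix (Fin n) (Fin n) ℝ} (hμ : Measurable μ)
    (hΩ : ∀ i j, Measurable fun l => Ω l i j) (hα : Measurable α) (hx : Measurable x)
    (hm : Measurable h) :
    Measurable fun l => skewEllipticalPDF (μ l) (Ω l) (α l) h (x l) :=
  ((measurable_ellipticalPDF hμ hΩ hx hm.marginalGen).const_mul 2).mul
    (hm.skewingCDF.comp ((measurable_quadForm (measurable_inv_apply hΩ) (hx.sub hμ)).prodMk
      (hα.inner (hx.sub hμ))))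

theorem measurable_slant {Ω : Λ → Matrix (Fin n) (Fin n) ℝ} {δ : Λ → EuclideanSpace ℝ (Fin n)}
    (hΩ : ∀ i j, Measurable fun l => Ω l i j) (hδ : Measurable δ) :
    Measurable fun l => slant (Ω l) (δ l) := by
  have hI : ∀ i j, Measurable fun l => (Ω l)⁻¹ i j := measurable_inv_apply hΩ
  have hv : Measurable fun l => matVec (Ω l)⁻¹ (δ l) := by
    have hc : ∀ i, Measurable fun l => ((Ω l)⁻¹ *ᵥ (δ l).ofLp) i := fun i => by
      have hd : ∀ j, Measurable fun l => (δ l).ofLp j := fun j => by fun_prop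
      have hs : Measurable fun l => ∑ j, (Ω l)⁻¹ i j * (δ l).ofLp j :=
        Finset.measurable_fun_sum _ fun j _ => Measurable.mul (hI i j) (hd j)
      exact hs
    exact (MeasurableEquiv.toLp 2 (Fin n → ℝ)).measurable.comp (measurable_pi_lambda _ hc)
  have hq₀ : Measurable fun l => quadForm (Ω l)⁻¹ (δ l) := measurable_quadForm hI hδ
  have hq : Measurable fun l => (√(1 - quadForm (Ω l)⁻¹ (δ l)))⁻¹ :=
    (hq₀.const_sub 1).sqrt.inv
  exact hq.smul hv

end Measurability

/-! ### Stochastic representation of the skew-elliptical law. -/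

section Representation

variable {n : ℕ} {h : ℝ → ℝ}

/-- The stochastic representation `(u, y) ↦ μ + u δ + A y` of a skew-elliptical vector. -/
noncomputable def skewMap (μ δ : EuclideanSpace ℝ (Fin n)) (A : Matrix (Fin n) (Fin n) ℝ)
    (z : Fin (n + 1) → ℝ) : EuclideanSpace ℝ (Fin n) :=
  μ + z 0 • δ + WithLp.toLp 2 (A *ᵥ Fin.tail z)

theorem skewMap_insertNth_zero (μ δ : EuclideanSpace ℝ (Fin n)) (A : Matrix (Fin n) (Fin n) ℝ)
    (u : ℝ) (y : Fin n → ℝ) :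
    skewMap μ δ A ((0 : Fin (n + 1)).insertNth u y) = μ + u • δ + WithLp.toLp 2 (A *ᵥ y) := by
  simp [skewMap, Fin.insertNth_zero']

theorem continuous_skewMap (μ δ : EuclideanSpace ℝ (Fin n)) (A : Matrix (Fin n) (Fin n) ℝ) :
    Continuous (skewMap μ δ A) := by
  have h1 : Continuous fun z : Fin (n + 1) → ℝ => A *ᵥ Fin.tail z :=
    Continuous.matrix_mulVec continuous_const
      (continuous_pi fun i => continuous_apply (Fin.succ i))
  have h2 : Continuous fun z : Fin (n + 1) → ℝ => WithLp.toLp 2 (A *ᵥ Fin.tail z) :=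
    (PiLp.continuous_toLp 2 _).comp h1
  unfold skewMap
  fun_prop

theorem one_add_dotProduct_self_pos (e : Fin n → ℝ) : (0 : ℝ) < 1 + e ⬝ᵥ e := by
  have : 0 ≤ e ⬝ᵥ e := Finset.sum_nonneg fun i _ => mul_self_nonneg (e i)
  linarith

/-- The skew-elliptical density in the coordinates `x = μ + A y`, where `δ = A e`. -/
theorem skewEllipticalPDF_affine {Ω A : Matrix (Fin n) (Fin n) ℝ}
    {μ δ : EuclideanSpace ℝ (Fin n)} {e : Fin n → ℝ} (hA : A.det ≠ 0)
    (hΩ : Ω - Matrix.vecMulVec δ.ofLp δ.ofLp = A * Aᵀ) (he : A *ᵥ e = δ.ofLp) (y : Fin n → ℝ) :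
    skewEllipticalPDF μ Ω (slant Ω δ) h (μ + WithLp.toLp 2 (A *ᵥ y)) =
      2 * ((|A.det| * √(1 + e ⬝ᵥ e))⁻¹ *
        marginalGen h (y ⬝ᵥ y - (e ⬝ᵥ y) ^ 2 / (1 + e ⬝ᵥ e))) *
        skewingCDF h (y ⬝ᵥ y - (e ⬝ᵥ y) ^ 2 / (1 + e ⬝ᵥ e)) ((e ⬝ᵥ y) / √(1 + e ⬝ᵥ e)) := by
  have hpos := one_add_dotProduct_self_pos e
  have hr := Real.sq_sqrt hpos.le
  have hrp := Real.sqrt_pos.2 hpos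
  have hΩ' : Ω = A * Aᵀ + Matrix.vecMulVec (A *ᵥ e) (A *ᵥ e) := by rw [← hΩ, he]; abel
  have hbil := dotProduct_inv_mulVec_of_rank_one hA hΩ'
  have hdet : √Ω.det = |A.det| * √(1 + e ⬝ᵥ e) := by
    rw [hΩ', det_mul_transpose_add_rank_one, Real.sqrt_mul (sq_nonneg _), Real.sqrt_sq_eq_abs]
  have hq : quadForm Ω⁻¹ (WithLp.toLp 2 (A *ᵥ y))
      = y ⬝ᵥ y - (e ⬝ᵥ y) ^ 2 / (1 + e ⬝ᵥ e) := by
    rw [quadForm, hbil, sq]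
  -- For `δ = A e` one gets `δ'Ω⁻¹δ = e·e / (1 + e·e) < 1`, so the square root in `slant` does not
  -- degenerate.
  have hd : 1 - quadForm Ω⁻¹ δ = (1 + e ⬝ᵥ e)⁻¹ := by
    rw [quadForm, ← he, hbil]; field_simp; ring
  have hs : inner ℝ (slant Ω δ) (WithLp.toLp 2 (A *ᵥ y)) = (e ⬝ᵥ y) / √(1 + e ⬝ᵥ e) := by
    rw [slant, hd, Real.sqrt_inv, inv_inv, real_inner_smul_left, EuclideanSpace.inner_eq_star_dotProduct]
    simp only [matVec, star_trivial, ← he, hbil]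
    rw [dotProduct_comm y e]
    field_simp
    rw [hr]; ring
  rw [skewEllipticalPDF, ellipticalPDF, add_sub_cancel_left, hq, hdet, hs]

/-- Cauchy–Schwarz. A generator is controlled only on `[0, ∞)`, so its argument has to be placed
there. -/
theorem sq_dotProduct_div_le (e y : Fin n → ℝ) :
    0 ≤ y ⬝ᵥ y - (e ⬝ᵥ y) ^ 2 / (1 + e ⬝ᵥ e) := by
  have hpos := one_add_dotProduct_self_pos e
  have hcs : (e ⬝ᵥ y) ^ 2 ≤ (e ⬝ᵥ e) * (y ⬝ᵥ y) := by
    simp only [dotProduct, ← sq]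
    exact Finset.sum_mul_sq_le_sq_mul_sq _ _ _
  have hy : 0 ≤ y ⬝ᵥ y := Finset.sum_nonneg fun i _ => mul_self_nonneg (y i)
  rw [sub_nonneg, div_le_iff₀ hpos]
  nlinarith

/-- Completing the square in `u`. Along the line `u ↦ (y - u e, u)` the spherical density becomes `v
↦ h (q + v²)` with `v` affine in `u`, which is the integrand of `marginalGen` and `skewingCDF`. -/
theorem sum_sq_sub_smul (e y : Fin n → ℝ) (u : ℝ) :
    ∑ i, (y - u • e) i ^ 2 + u ^ 2 = y ⬝ᵥ y - (e ⬝ᵥ y) ^ 2 / (1 + e ⬝ᵥ e) +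
      ((e ⬝ᵥ y) / √(1 + e ⬝ᵥ e) - √(1 + e ⬝ᵥ e) * u) ^ 2 := by
  have hpos := one_add_dotProduct_self_pos e
  have hr := Real.sq_sqrt hpos.le
  have hrp := Real.sqrt_pos.2 hpos
  have h1 : ∑ i, (y - u • e) i ^ 2 = y ⬝ᵥ y - 2 * u * (e ⬝ᵥ y) + u ^ 2 * (e ⬝ᵥ e) := by
    simp only [dotProduct, Finset.mul_sum, ← Finset.sum_sub_distrib, ← Finset.sum_add_distrib]
    exact Finset.sum_congr rfl fun i _ => by simp; ring
  rw [h1, sub_sq, div_pow, hr, mul_pow, hr]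
  field_simp
  ring

theorem exists_mulVec_eq {A : Matrix (Fin n) (Fin n) ℝ} (hA : A.det ≠ 0) (v : Fin n → ℝ) :
    ∃ e, A *ᵥ e = v :=
  ⟨A⁻¹ *ᵥ v, by rw [Matrix.mulVec_mulVec, Matrix.mul_nonsing_inv _ (isUnit_iff_ne_zero.2 hA),
    Matrix.one_mulVec]⟩

theorem marginalGen_nonneg (hn : ∀ u, 0 ≤ u → 0 ≤ h u) {q : ℝ} (hq : 0 ≤ q) :
    0 ≤ marginalGen h q :=
  integral_nonneg fun v => hn _ (by positivity)

theorem skewEllipticalPDF_nonneg {Ω A : Matrix (Fin n) (Fin n) ℝ}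
    {δ : EuclideanSpace ℝ (Fin n)} (hn : ∀ u, 0 ≤ u → 0 ≤ h u) (hA : A.det ≠ 0)
    (hΩ : Ω - Matrix.vecMulVec δ.ofLp δ.ofLp = A * Aᵀ) (μ x : EuclideanSpace ℝ (Fin n)) :
    0 ≤ skewEllipticalPDF μ Ω (slant Ω δ) h x := by
  obtain ⟨e, he⟩ := exists_mulVec_eq hA δ.ofLp
  obtain ⟨y, hy⟩ := exists_mulVec_eq hA (x - μ).ofLp
  have hx : x = μ + WithLp.toLp 2 (A *ᵥ y) := by rw [hy, WithLp.toLp_ofLp]; abel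
  rw [hx, skewEllipticalPDF_affine hA hΩ he]
  have h1 := marginalGen_nonneg hn (sq_dotProduct_div_le e y)
  have h2 : 0 ≤ ∫ v in Iic ((e ⬝ᵥ y) / √(1 + e ⬝ᵥ e)),
      h (y ⬝ᵥ y - (e ⬝ᵥ y) ^ 2 / (1 + e ⬝ᵥ e) + v ^ 2) :=
    integral_nonneg fun v => hn _ (add_nonneg (sq_dotProduct_div_le e y) (sq_nonneg v))
  rw [skewingCDF]
  positivity

/-- If `F` is integrable, the factor `∫ F` cancels in a conditional distribution function. -/
theorem marginalGen_mul_skewingCDF (hn : ∀ u, 0 ≤ u → 0 ≤ h u) {q : ℝ} (hq : 0 ≤ q)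
    (hi : Integrable fun v => h (q + v ^ 2)) (s : ℝ) :
    marginalGen h q * skewingCDF h q s = ∫ v in Iic s, h (q + v ^ 2) := by
  rw [skewingCDF]
  -- When `marginalGen h q = 0` the quotient is `0` by convention; the identity survives because the
  -- integral over `Iic s` is then squeezed to `0` as well.
  refine mul_div_cancel_of_imp' fun h0 => ?_
  have hpos : 0 ≤ᵐ[volume] fun v : ℝ => h (q + v ^ 2) :=
    .of_forall fun v => hn _ (by positivity)
  refine le_antisymm ?_ (integral_nonneg fun v => hn _ (by positivity))
  calc ∫ v in Iic s, h (q + v ^ 2) ≤ ∫ v, h (q + v ^ 2) := setIntegral_le_integral hi hpos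
    _ = 0 := h0

/-- The shear `(y, u) ↦ (y - u e, u)` preserves Lebesgue measure. The finite total mass shows that
almost every line integral is finite. -/
theorem lintegral_shear (H : IsDensityGenerator (n + 1) h) (e : Fin n → ℝ) :
    ∫⁻ y : Fin n → ℝ, ∫⁻ u : ℝ, ENNReal.ofReal (h (∑ i, (y - u • e) i ^ 2 + u ^ 2)) = 1 := by
  have hm := H.measurable
  have hmeas : Measurable fun p : (Fin n → ℝ) × ℝ =>
      ENNReal.ofReal (h (∑ i, (p.1 - p.2 • e) i ^ 2 + p.2 ^ 2)) := by
    refine (hm.comp ?_).ennreal_ofReal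
    simp only [Pi.sub_apply, Pi.smul_apply, smul_eq_mul]
    fun_prop
  rw [lintegral_lintegral_swap hmeas.aemeasurable]
  have h1 : ∀ u : ℝ, ∫⁻ y : Fin n → ℝ, ENNReal.ofReal (h (∑ i, (y - u • e) i ^ 2 + u ^ 2)) =
      ∫⁻ y : Fin n → ℝ, ENNReal.ofReal (h (∑ i, y i ^ 2 + u ^ 2)) := fun u =>
    lintegral_sub_right_eq_self (fun y : Fin n → ℝ => ENNReal.ofReal (h (∑ i, y i ^ 2 + u ^ 2))) _
  simp only [h1]
  have h2 := lintegral_insertNth (0 : Fin (n + 1))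
    (F := fun z => ENNReal.ofReal (h (∑ i, z i ^ 2))) (hm.comp measurable_sum_sq).ennreal_ofReal
  simp only [sum_sq_insertNth] at h2
  rw [← h2, ← ofReal_integral_eq_lintegral_ofReal H.integrable_pi
    (.of_forall fun z => H.nonneg _ (sum_sq_nonneg z)), H.integral_pi, ENNReal.ofReal_one]

/-- The substitution `v = s - r u` carries `u > 0` to `v < s`, so the cut at `s` in `skewingCDF` is
the conditioning on a positive first coordinate. The identity is only almost everywhere: where the
line integral diverges, `marginalGen` takes the default value `0`. -/
theorem ae_skewEllipticalPDF_affine (H : IsDensityGenerator (n + 1) h)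
    {Ω A : Matrix (Fin n) (Fin n) ℝ} {μ δ : EuclideanSpace ℝ (Fin n)} {e : Fin n → ℝ}
    (hA : A.det ≠ 0) (hΩ : Ω - Matrix.vecMulVec δ.ofLp δ.ofLp = A * Aᵀ)
    (he : A *ᵥ e = δ.ofLp) :
    ∀ᵐ y : Fin n → ℝ, ENNReal.ofReal |A.det| *
      ENNReal.ofReal (skewEllipticalPDF μ Ω (slant Ω δ) h (μ + WithLp.toLp 2 (A *ᵥ y))) =
      ∫⁻ u in Ioi (0 : ℝ), ENNReal.ofReal (2 * h (∑ i, (y - u • e) i ^ 2 + u ^ 2)) := by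
  have hm := H.measurable
  have hmeas : Measurable fun y : Fin n → ℝ =>
      ∫⁻ u : ℝ, ENNReal.ofReal (h (∑ i, (y - u • e) i ^ 2 + u ^ 2)) := by
    refine Measurable.lintegral_prod_right' (f := fun p : (Fin n → ℝ) × ℝ =>
      ENNReal.ofReal (h (∑ i, (p.1 - p.2 • e) i ^ 2 + p.2 ^ 2))) ?_
    refine (hm.comp ?_).ennreal_ofReal
    simp only [Pi.sub_apply, Pi.smul_apply, smul_eq_mul]
    fun_prop
  filter_upwards [ae_lt_top hmeas (by rw [lintegral_shear H e]; simp)] with y hy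
  have hpos := one_add_dotProduct_self_pos e
  set r := √(1 + e ⬝ᵥ e) with hr
  have hrp : 0 < r := Real.sqrt_pos.2 hpos
  simp only [sum_sq_sub_smul] at hy ⊢
  rw [skewEllipticalPDF_affine hA hΩ he]
  have hq := sq_dotProduct_div_le e y
  rw [← hr] at hy ⊢
  set q := y ⬝ᵥ y - (e ⬝ᵥ y) ^ 2 / (1 + e ⬝ᵥ e)
  set s := (e ⬝ᵥ y) / r
  have hnn : ∀ v : ℝ, 0 ≤ h (q + v ^ 2) := fun v => H.nonneg _ (by positivity)
  have hmv : Measurable fun v : ℝ => h (q + v ^ 2) := hm.comp (by fun_prop)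
  -- Finiteness is known in the variable `u`; scaling by `r` and reflecting about `s` transfer it to
  -- `v`.
  have hi : Integrable fun v : ℝ => h (q + v ^ 2) := by
    have h1 : Integrable fun u : ℝ => h (q + (s - r * u) ^ 2) :=
      ⟨(hm.comp (by fun_prop)).aestronglyMeasurable,
        (hasFiniteIntegral_iff_ofReal (.of_forall fun u => hnn _)).2 hy⟩
    have h2 : Integrable fun u : ℝ => h (q + (s - u) ^ 2) :=
      (integrable_comp_mul_left_iff (fun u : ℝ => h (q + (s - u) ^ 2)) hrp.ne').1 h1
    simpa using h2.comp_sub_left s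
  have himg : (fun u : ℝ => s - r * u) '' Ioi 0 = Iio s := by
    ext v
    simp only [mem_image, mem_Ioi, mem_Iio]
    refine ⟨?_, fun hv => ⟨(s - v) / r, div_pos (sub_pos.2 hv) hrp, by field_simp; ring⟩⟩
    rintro ⟨u, hu, rfl⟩
    have := mul_pos hrp hu
    linarith
  have hcv := lintegral_image_eq_lintegral_abs_deriv_mul (s := Ioi (0 : ℝ))
    (f := fun u => s - r * u) (f' := fun _ => -r) measurableSet_Ioi
    (fun u _ => by
      simpa using ((hasDerivAt_id u).const_mul r).const_sub s |>.hasDerivWithinAt)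
    (fun a _ b _ hab => by simpa [hrp.ne'] using hab)
    (fun v => ENNReal.ofReal (h (q + v ^ 2)))
  rw [himg, abs_neg, abs_of_pos hrp, lintegral_const_mul _ (by fun_prop)] at hcv
  have hIic : ENNReal.ofReal (∫ v in Iic s, h (q + v ^ 2)) =
      ENNReal.ofReal r * ∫⁻ u in Ioi 0, ENNReal.ofReal (h (q + (s - r * u) ^ 2)) := by
    rw [← hcv, integral_Iic_eq_integral_Iio,
      ofReal_integral_eq_lintegral_ofReal hi.integrableOn (.of_forall hnn)]
  have hAp : 0 < |A.det| := abs_pos.2 hA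
  have hre : |A.det| * (2 * ((|A.det| * r)⁻¹ * marginalGen h q) * skewingCDF h q s) =
      2 * r⁻¹ * ∫ v in Iic s, h (q + v ^ 2) := by
    rw [← marginalGen_mul_skewingCDF H.nonneg hq hi]
    field_simp
  rw [← ENNReal.ofReal_mul hAp.le, hre, ENNReal.ofReal_mul (by positivity), hIic,
    ENNReal.ofReal_mul zero_le_two, mul_assoc, ← mul_assoc (ENNReal.ofReal r⁻¹),
    ← ENNReal.ofReal_mul (by positivity), inv_mul_cancel₀ hrp.ne', ENNReal.ofReal_one, one_mul]
  simp_rw [ENNReal.ofReal_mul (zero_le_two (α := ℝ))]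
  have hmu : Measurable fun u : ℝ => h (q + (s - r * u) ^ 2) := hm.comp (by fun_prop)
  rw [lintegral_const_mul _ hmu.ennreal_ofReal]

theorem measurable_skewEllipticalPDF_right (hm : Measurable h) (μ : EuclideanSpace ℝ (Fin n))
    (Ω : Matrix (Fin n) (Fin n) ℝ) (α : EuclideanSpace ℝ (Fin n)) :
    Measurable (skewEllipticalPDF μ Ω α h) :=
  measurable_skewEllipticalPDF measurable_const (fun _ _ => measurable_const)
    measurable_const measurable_id hm

/-- Translating `y` by `u • e` turns `μ + u δ + A y` into `μ + A y`, which no longer involves `u`.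
Tonelli then lets the integral over `u` act on the density alone, and `ae_skewEllipticalPDF_affine`
evaluates it. Lower integrals keep all integrability questions away. -/
theorem lintegral_skewEllipticalPDF (H : IsDensityGenerator (n + 1) h)
    {Ω A : Matrix (Fin n) (Fin n) ℝ} {μ δ : EuclideanSpace ℝ (Fin n)} (hA : A.det ≠ 0)
    (hΩ : Ω - Matrix.vecMulVec δ.ofLp δ.ofLp = A * Aᵀ)
    {F : EuclideanSpace ℝ (Fin n) → ENNReal} (hF : Measurable F) :
    ∫⁻ x, ENNReal.ofReal (skewEllipticalPDF μ Ω (slant Ω δ) h x) * F x =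
      ∫⁻ z, F (skewMap μ δ A z) ∂(halfLaw n h) := by
  obtain ⟨e, he⟩ := exists_mulVec_eq hA δ.ofLp
  have hm := H.measurable
  have hAp : 0 < |A.det| := abs_pos.2 hA
  have hFs : Measurable fun z => F (skewMap μ δ A z) :=
    hF.comp (continuous_skewMap μ δ A).measurable
  rw [halfLaw, lintegral_withDensity_eq_lintegral_mul _ (measurable_halfLaw_density hm) hFs,
    setLIntegral_insertNth 0 ((measurable_halfLaw_density hm).mul hFs)]
  simp only [Pi.mul_apply, sum_sq_insertNth, skewMap_insertNth_zero]
  have hshift : ∀ u : ℝ, ∫⁻ y : Fin n → ℝ, ENNReal.ofReal (2 * h (∑ j, y j ^ 2 + u ^ 2)) *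
      F (μ + u • δ + WithLp.toLp 2 (A *ᵥ y)) =
      ∫⁻ y : Fin n → ℝ, ENNReal.ofReal (2 * h (∑ j, (y - u • e) j ^ 2 + u ^ 2)) *
        F (μ + WithLp.toLp 2 (A *ᵥ y)) := fun u => by
    rw [← lintegral_sub_right_eq_self _ (u • e)]
    refine lintegral_congr fun y => ?_
    have : μ + u • δ + WithLp.toLp 2 (A *ᵥ (y - u • e)) = μ + WithLp.toLp 2 (A *ᵥ y) := by
      rw [Matrix.mulVec_sub, Matrix.mulVec_smul, he, WithLp.toLp_sub, WithLp.toLp_smul,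
        WithLp.toLp_ofLp]
      abel
    rw [this]
  simp only [hshift]
  have hFa : Measurable fun y : Fin n → ℝ => F (μ + WithLp.toLp 2 (A *ᵥ y)) :=
    hF.comp (affineEquiv μ A hA).measurable
  have hms : Measurable fun p : ℝ × (Fin n → ℝ) =>
      ENNReal.ofReal (2 * h (∑ j, (p.2 - p.1 • e) j ^ 2 + p.1 ^ 2)) := by
    refine ((hm.comp ?_).const_mul 2).ennreal_ofReal
    simp only [Pi.sub_apply, Pi.smul_apply, smul_eq_mul]
    fun_prop
  have hmp : Measurable fun x => ENNReal.ofReal (skewEllipticalPDF μ Ω (slant Ω δ) h x) :=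
    (measurable_skewEllipticalPDF_right hm μ Ω _).ennreal_ofReal
  have hmm : Measurable fun p : ℝ × (Fin n → ℝ) =>
      ENNReal.ofReal (2 * h (∑ j, (p.2 - p.1 • e) j ^ 2 + p.1 ^ 2)) *
        F (μ + WithLp.toLp 2 (A *ᵥ p.2)) := hms.mul (hFa.comp measurable_snd)
  rw [lintegral_lintegral_swap hmm.aemeasurable]
  have hcv := lintegral_affine μ hA fun x =>
    ENNReal.ofReal (skewEllipticalPDF μ Ω (slant Ω δ) h x) * F x
  have hmpa : Measurable fun y : Fin n → ℝ => ENNReal.ofReal (skewEllipticalPDF μ Ω (slant Ω δ) h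
      (μ + WithLp.toLp 2 (A *ᵥ y))) := hmp.comp (affineEquiv μ A hA).measurable
  calc ∫⁻ x, ENNReal.ofReal (skewEllipticalPDF μ Ω (slant Ω δ) h x) * F x
      = ENNReal.ofReal |A.det| * ∫⁻ y : Fin n → ℝ, ENNReal.ofReal (skewEllipticalPDF μ Ω
          (slant Ω δ) h (μ + WithLp.toLp 2 (A *ᵥ y))) * F (μ + WithLp.toLp 2 (A *ᵥ y)) := by
        rw [hcv, ← mul_assoc, ← ENNReal.ofReal_mul hAp.le, mul_inv_cancel₀ hAp.ne',
          ENNReal.ofReal_one, one_mul]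
    _ = ∫⁻ y : Fin n → ℝ, ENNReal.ofReal |A.det| * (ENNReal.ofReal (skewEllipticalPDF μ Ω
          (slant Ω δ) h (μ + WithLp.toLp 2 (A *ᵥ y))) * F (μ + WithLp.toLp 2 (A *ᵥ y))) :=
        (lintegral_const_mul _ (hmpa.mul hFa)).symm
    _ = _ := by
        refine lintegral_congr_ae ?_
        filter_upwards [ae_skewEllipticalPDF_affine (μ := μ) H hA hΩ he] with y hy
        rw [← mul_assoc (ENNReal.ofReal |A.det|), hy]
        have hmu : Measurable fun u : ℝ =>
            ENNReal.ofReal (2 * h (∑ j, (y - u • e) j ^ 2 + u ^ 2)) := by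
          refine ((hm.comp ?_).const_mul 2).ennreal_ofReal
          simp only [Pi.sub_apply, Pi.smul_apply, smul_eq_mul]
          fun_prop
        rw [lintegral_mul_const _ hmu]

theorem withDensity_skewEllipticalPDF (H : IsDensityGenerator (n + 1) h)
    {Ω A : Matrix (Fin n) (Fin n) ℝ} {μ δ : EuclideanSpace ℝ (Fin n)} (hA : A.det ≠ 0)
    (hΩ : Ω - Matrix.vecMulVec δ.ofLp δ.ofLp = A * Aᵀ) :
    skewEllipticalLaw μ Ω (slant Ω δ) h = (halfLaw n h).map (skewMap μ δ A) := by
  have hT : Measurable (skewMap μ δ A) := (continuous_skewMap μ δ A).measurable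
  ext s hs
  have := lintegral_skewEllipticalPDF H (μ := μ) hA hΩ 
    (F := s.indicator fun _ => 1) (measurable_const.indicator hs)
  rw [skewEllipticalLaw, withDensity_apply _ hs, Measure.map_apply hT hs,
    ← lintegral_indicator hs]
  have h2 : ∫⁻ z, s.indicator (fun _ => (1 : ENNReal)) (skewMap μ δ A z) ∂(halfLaw n h) =
      halfLaw n h (skewMap μ δ A ⁻¹' s) := by
    rw [← lintegral_indicator_one (hT hs)]; rfl
  rw [← h2, ← this]
  exact lintegral_congr fun x => by by_cases hx : x ∈ s <;> simp [hx]

theorem isProbDensity_skewEllipticalPDF (H : IsDensityGenerator (n + 1) h)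
    {Ω A : Matrix (Fin n) (Fin n) ℝ} {μ δ : EuclideanSpace ℝ (Fin n)} (hA : A.det ≠ 0)
    (hΩ : Ω - Matrix.vecMulVec δ.ofLp δ.ofLp = A * Aᵀ) :
    IsProbDensity (skewEllipticalPDF μ Ω (slant Ω δ) h) := by
  have hmp : Measurable (skewEllipticalPDF μ Ω (slant Ω δ) h) :=
    measurable_skewEllipticalPDF_right H.measurable μ Ω _
  refine ⟨hmp, skewEllipticalPDF_nonneg H.nonneg hA hΩ μ, ?_⟩
  have := isProbabilityMeasure_halfLaw H
  rw [integral_eq_lintegral_of_nonneg_ae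
    (.of_forall (skewEllipticalPDF_nonneg H.nonneg hA hΩ μ)) hmp.aestronglyMeasurable]
  have h1 := lintegral_skewEllipticalPDF H (μ := μ) hA hΩ (F := fun _ => 1) measurable_const
  simp only [mul_one, lintegral_one, measure_univ] at h1
  rw [h1, ENNReal.toReal_one]

theorem integral_mul_skewEllipticalPDF (H : IsDensityGenerator (n + 1) h)
    {Ω A : Matrix (Fin n) (Fin n) ℝ} {μ δ : EuclideanSpace ℝ (Fin n)} (hA : A.det ≠ 0)
    (hΩ : Ω - Matrix.vecMulVec δ.ofLp δ.ofLp = A * Aᵀ)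
    {F : EuclideanSpace ℝ (Fin n) → ℝ} (hF : Measurable F) :
    ∫ x, F x * skewEllipticalPDF μ Ω (slant Ω δ) h x =
      ∫ z, F (skewMap μ δ A z) ∂(halfLaw n h) := by
  have hp := isProbDensity_skewEllipticalPDF H (μ := μ) hA hΩ
  rw [← integral_map (continuous_skewMap μ δ A).measurable.aemeasurable hF.aestronglyMeasurable,
    ← withDensity_skewEllipticalPDF H hA hΩ, skewEllipticalLaw,
    integral_withDensity_eq_integral_toReal_smul hp.measurable.ennreal_ofReal
      (.of_forall fun _ => ENNReal.ofReal_lt_top)]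
  exact integral_congr_ae (.of_forall fun x => by
    dsimp only; rw [ENNReal.toReal_ofReal (hp.nonneg x), smul_eq_mul, mul_comm])

end Representation

/-! ### Stein's identity in one variable. -/

section SteinLine

variable {g k k' : ℝ → ℝ} {a C : ℝ}

theorem tailIntegral_add_sq (g : ℝ → ℝ) (a : ℝ) {t : ℝ} (ht : 0 ≤ t) :
    tailIntegral g (a + t ^ 2) = ∫ s in Ioi t, 2 * s * g (a + s ^ 2) := by
  have himg : (fun s : ℝ => a + s ^ 2) '' Ioi t = Ioi (a + t ^ 2) := by
    ext v
    simp only [mem_image, mem_Ioi]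
    constructor
    · rintro ⟨s, hs, rfl⟩
      have := pow_lt_pow_left₀ hs ht two_ne_zero
      linarith
    · intro hv
      refine ⟨√(v - a), Real.lt_sqrt_of_sq_lt (by linarith), ?_⟩
      rw [Real.sq_sqrt (by nlinarith)]
      ring
  have := integral_image_eq_integral_abs_deriv_smul (s := Ioi t) (f := fun s => a + s ^ 2)
    (f' := fun s => 2 * s) measurableSet_Ioi
    (fun s _ => by simpa using ((hasDerivAt_pow 2 s).const_add a).hasDerivWithinAt)
    (fun x hx y hy hxy => by
      have hx0 : 0 ≤ x := ht.trans (le_of_lt hx)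
      have hy0 : 0 ≤ y := ht.trans (le_of_lt hy)
      exact (pow_left_inj₀ hx0 hy0 two_ne_zero).1 (add_left_cancel hxy)) g
  rw [himg] at this
  rw [tailIntegral, this]
  refine setIntegral_congr_fun measurableSet_Ioi fun s hs => ?_
  have hs0 : 0 < s := ht.trans_lt hs
  simp only [smul_eq_mul, abs_of_pos (mul_pos two_pos hs0)]

theorem tailIntegral_nonneg (hn : ∀ u, 0 ≤ u → 0 ≤ g u) {u : ℝ} (hu : 0 ≤ u) :
    0 ≤ tailIntegral g u :=
  setIntegral_nonneg measurableSet_Ioi fun s hs => hn s (hu.trans (le_of_lt hs))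

/-- A bounded derivative gives `|k t - k 0| ≤ C |t|`, so the second moment on the half line is
enough. Subtracting `k 0` avoids any need for the first moment. -/
theorem integrableOn_increment (hm : Measurable g) (hd : ∀ t, HasDerivAt k (k' t) t)
    (hC : ∀ t, |k' t| ≤ C) (h2 : IntegrableOn (fun t => t ^ 2 * g (a + t ^ 2)) (Ioi 0)) :
    IntegrableOn (fun t => 2 * t * g (a + t ^ 2) * (k t - k 0)) (Ioi 0) := by
  have hkc : Continuous k := continuous_iff_continuousAt.2 fun t => (hd t).continuousAt
  refine (h2.norm.const_mul (2 * C)).mono' ?_ ?_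
  · have : Measurable fun t => 2 * t * g (a + t ^ 2) * (k t - k 0) :=
      ((measurable_id.const_mul 2).mul (hm.comp (by fun_prop))).mul
        (hkc.measurable.sub measurable_const)
    exact this.aestronglyMeasurable
  · refine .of_forall fun t => ?_
    have hlip : |k t - k 0| ≤ C * |t| := by
      have := Convex.norm_image_sub_le_of_norm_hasDerivWithin_le (f := k) (f' := k') (s := univ)
        (x := 0) (y := t) (fun x _ => (hd x).hasDerivWithinAt) (fun x _ => hC x) convex_univ
        trivial trivial
      simpa using this
    simp only [Real.norm_eq_abs, abs_mul, abs_pow, abs_two]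
    calc 2 * |t| * |g (a + t ^ 2)| * |k t - k 0|
        ≤ 2 * |t| * |g (a + t ^ 2)| * (C * |t|) := by gcongr
      _ = 2 * C * (|t| ^ 2 * |g (a + t ^ 2)|) := by ring

/-- Stein's identity on the half line. -/
theorem stein_Ioi (hm : Measurable g) (hd : ∀ t, HasDerivAt k (k' t) t) (hk' : Continuous k')
    (hC : ∀ t, |k' t| ≤ C) (h2 : IntegrableOn (fun t => t ^ 2 * g (a + t ^ 2)) (Ioi 0)) :
    IntegrableOn (fun t => k' t * tailIntegral g (a + t ^ 2)) (Ioi 0) ∧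
    ∫ t in Ioi 0, k' t * tailIntegral g (a + t ^ 2) =
      ∫ t in Ioi 0, 2 * t * g (a + t ^ 2) * (k t - k 0) := by
  set ν : Measure ℝ := volume.restrict (Ioi 0)
  -- Both sides are iterated integrals of this function over the triangle `0 < t < s`: integrating
  -- first in `s` yields the tail, first in `t` the increment of `k`.
  let H : ℝ × ℝ → ℝ := {p : ℝ × ℝ | p.1 < p.2}.indicator
    fun p => k' p.1 * (2 * p.2 * g (a + p.2 ^ 2))
  have hms : MeasurableSet {p : ℝ × ℝ | p.1 < p.2} :=
    measurableSet_lt measurable_fst measurable_snd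
  have hmg : Measurable fun s : ℝ => 2 * s * g (a + s ^ 2) :=
    (measurable_id.const_mul 2).mul (hm.comp (by fun_prop))
  have hHm : Measurable H :=
    ((hk'.measurable.comp measurable_fst).mul (hmg.comp measurable_snd)).indicator hms
  have hC0 : 0 ≤ C := (abs_nonneg _).trans (hC 0)
  have hHs : ∀ s, (fun t => H (t, s)) =
      (Iio s).indicator fun t => k' t * (2 * s * g (a + s ^ 2)) := fun s => rfl
  have hHt : ∀ t, (fun s => H (t, s)) =
      (Ioi t).indicator fun s => k' t * (2 * s * g (a + s ^ 2)) := fun t => rfl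
  have hνs : ∀ s, ν.restrict (Iio s) = volume.restrict (Ioo 0 s) := fun s => by
    rw [Measure.restrict_restrict measurableSet_Iio, inter_comm, Ioi_inter_Iio]
  have hHint : Integrable H (ν.prod ν) := by
    rw [integrable_prod_iff' hHm.aestronglyMeasurable]
    constructor
    · refine .of_forall fun s => ?_
      rw [hHs, integrable_indicator_iff measurableSet_Iio, IntegrableOn, hνs]
      exact (((hk'.mul continuous_const).integrableOn_Icc (a := 0) (b := s)).mono_set
        Ioo_subset_Icc_self)
    · refine (h2.norm.const_mul (2 * C)).mono'
        (hHm.norm.aestronglyMeasurable.prod_swap.integral_prod_right') ?_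
      filter_upwards [self_mem_ae_restrict measurableSet_Ioi] with s hs
      have hs0 : (0 : ℝ) < s := hs
      rw [Real.norm_of_nonneg (integral_nonneg fun _ => norm_nonneg _)]
      have h1 : ∀ t, ‖H (t, s)‖ =
          (Iio s).indicator (fun t => |k' t| * |2 * s * g (a + s ^ 2)|) t := fun t => by
        have := congrFun (hHs s) t
        rw [this, norm_indicator_eq_indicator_norm]
        simp only [norm_mul, Real.norm_eq_abs, abs_mul]
      simp only [h1]
      rw [integral_indicator measurableSet_Iio, hνs, integral_mul_const]
      -- The inner integration gains a factor `s`, which turns the weight `s` into the integrable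
      -- weight `s²`.
      have h3 : ∫ t in Ioo 0 s, |k' t| ≤ C * s := by
        calc ∫ t in Ioo 0 s, |k' t| ≤ ∫ t in Ioo 0 s, C :=
              setIntegral_mono ((hk'.abs.integrableOn_Icc (a := 0) (b := s)).mono_set
                Ioo_subset_Icc_self) (by simp) hC
          _ = C * s := by simp [hs0.le, mul_comm]
      calc (∫ t in Ioo 0 s, |k' t|) * |2 * s * g (a + s ^ 2)|
          ≤ C * s * |2 * s * g (a + s ^ 2)| := by gcongr
        _ = 2 * C * ‖s ^ 2 * g (a + s ^ 2)‖ := by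
            simp only [Real.norm_eq_abs, abs_mul, abs_pow, abs_two, abs_of_pos hs0]; ring
  have hL : ∀ᵐ t ∂ν, ∫ s, H (t, s) ∂ν = k' t * tailIntegral g (a + t ^ 2) := by
    filter_upwards [self_mem_ae_restrict measurableSet_Ioi] with t ht
    rw [hHt, integral_indicator measurableSet_Ioi, integral_const_mul,
      tailIntegral_add_sq g a (le_of_lt ht), Measure.restrict_restrict measurableSet_Ioi,
      inter_eq_left.2 (Ioi_subset_Ioi (le_of_lt ht))]
  have hR : ∀ᵐ s ∂ν, ∫ t, H (t, s) ∂ν = 2 * s * g (a + s ^ 2) * (k s - k 0) := by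
    filter_upwards [self_mem_ae_restrict measurableSet_Ioi] with s hs
    have hs0 : (0 : ℝ) < s := hs
    rw [hHs, integral_indicator measurableSet_Iio, integral_mul_const, hνs,
      ← integral_Ioc_eq_integral_Ioo, ← intervalIntegral.integral_of_le hs0.le,
      intervalIntegral.integral_eq_sub_of_hasDerivAt (fun x _ => hd x)
        (hk'.intervalIntegrable 0 s), mul_comm]
  refine ⟨hHint.integral_prod_left.congr hL, ?_⟩
  rw [← integral_congr_ae hL, ← integral_congr_ae hR]
  exact integral_integral_swap hHint

theorem integral_eq_integral_Ioi_add_neg {f : ℝ → ℝ} (hf : Integrable f) :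
    ∫ t, f t = (∫ t in Ioi 0, f t) + ∫ t in Ioi 0, f (-t) := by
  rw [integral_comp_neg_Ioi, neg_zero, add_comm, ← setIntegral_union (Iic_disjoint_Ioi le_rfl)
    measurableSet_Ioi hf.integrableOn hf.integrableOn, Iic_union_Ioi, setIntegral_univ]

theorem integrable_of_integrableOn_Ioi_neg {f : ℝ → ℝ} (h1 : IntegrableOn f (Ioi 0))
    (h2 : IntegrableOn (fun t => f (-t)) (Ioi 0)) : Integrable f := by
  have h3 : IntegrableOn f (Iio 0) := by
    have := ((Measure.measurePreserving_neg (volume : Measure ℝ)).integrableOn_comp_preimage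
      (MeasurableEquiv.neg ℝ).measurableEmbedding (f := f) (s := Iio 0)).1
    refine this (h2.congr_set_ae (.of_eq ?_))
    ext t; simp
  rw [← integrableOn_univ, ← Iio_union_Ici (a := (0 : ℝ))]
  exact h3.union ((integrableOn_Ici_iff_integrableOn_Ioi).2 h1)

/-- Stein's identity on the line. -/
theorem stein_line (hm : Measurable g) (hd : ∀ t, HasDerivAt k (k' t) t) (hk' : Continuous k')
    (hC : ∀ t, |k' t| ≤ C) (h1 : Integrable (fun t => t * g (a + t ^ 2)))
    (h2 : Integrable (fun t => t ^ 2 * g (a + t ^ 2))) :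
    Integrable (fun t => k' t * tailIntegral g (a + t ^ 2)) ∧
    ∫ t, k' t * tailIntegral g (a + t ^ 2) = ∫ t, 2 * t * g (a + t ^ 2) * k t := by
  -- The negative half line is the half-line identity for the reflected function `t ↦ k (-t)`.
  have hdn : ∀ t, HasDerivAt (fun t => k (-t)) (-k' (-t)) t := fun t => by
    have := (hd (-t)).scomp t (hasDerivAt_neg t)
    rwa [neg_one_smul] at this
  have hkn' : Continuous fun t => -k' (-t) := by fun_prop
  have hCn : ∀ t, |-k' (-t)| ≤ C := fun t => by rw [abs_neg]; exact hC _
  obtain ⟨hp, hpe⟩ := stein_Ioi hm hd hk' hC h2.integrableOn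
  obtain ⟨hq, hqe⟩ := stein_Ioi hm hdn hkn' hCn h2.integrableOn
  have hI : Integrable fun t => k' t * tailIntegral g (a + t ^ 2) := by
    refine integrable_of_integrableOn_Ioi_neg hp ?_
    simpa using hq.neg
  have hi1 := integrableOn_increment hm hd hC h2.integrableOn
  have hi2 := integrableOn_increment hm hdn hCn h2.integrableOn
  -- The first moment allows the constant `k 0` to be split off; its contributions from the two half
  -- lines cancel.
  have hc : IntegrableOn (fun t => 2 * t * g (a + t ^ 2) * k 0) (Ioi 0) := by
    have := (h1.const_mul 2).mul_const (k 0)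
    simpa only [mul_assoc] using this.integrableOn
  have hkI : IntegrableOn (fun t => 2 * t * g (a + t ^ 2) * k t) (Ioi 0) := by
    refine (hi1.add hc).congr_fun (fun t _ => ?_) measurableSet_Ioi
    simp only [Pi.add_apply]; ring
  have hkI' : IntegrableOn (fun t => 2 * t * g (a + t ^ 2) * k (-t)) (Ioi 0) := by
    refine (hi2.add hc).congr_fun (fun t _ => ?_) measurableSet_Ioi
    simp only [Pi.add_apply, neg_zero]; ring
  have hRI : Integrable fun t => 2 * t * g (a + t ^ 2) * k t := by
    refine integrable_of_integrableOn_Ioi_neg hkI ?_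
    simpa using hkI'.neg
  refine ⟨hI, ?_⟩
  rw [integral_eq_integral_Ioi_add_neg hI, integral_eq_integral_Ioi_add_neg hRI]
  have e1 : ∫ t in Ioi 0, 2 * t * g (a + t ^ 2) * (k t - k 0) =
      (∫ t in Ioi 0, 2 * t * g (a + t ^ 2) * k t) - ∫ t in Ioi 0, 2 * t * g (a + t ^ 2) * k 0 := by
    rw [← integral_sub hkI hc]; simp only [mul_sub]
  have e2 : ∫ t in Ioi 0, 2 * t * g (a + t ^ 2) * (k (-t) - k (-0)) =
      (∫ t in Ioi 0, 2 * t * g (a + t ^ 2) * k (-t)) -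
        ∫ t in Ioi 0, 2 * t * g (a + t ^ 2) * k 0 := by
    rw [← integral_sub hkI' hc]; simp only [mul_sub, neg_zero]
  have e3 : ∫ t in Ioi 0, k' (-t) * tailIntegral g (a + (-t) ^ 2) =
      -∫ t in Ioi 0, -k' (-t) * tailIntegral g (a + t ^ 2) := by
    rw [← integral_neg]; simp
  have e4 : ∫ t in Ioi 0, 2 * -t * g (a + (-t) ^ 2) * k (-t) =
      -∫ t in Ioi 0, 2 * t * g (a + t ^ 2) * k (-t) := by
    rw [← integral_neg]; simp
  rw [e3, e4, hpe, hqe, e1, e2]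
  ring

end SteinLine

/-! ### Stein's identity coordinatewise on `ℝⁿ⁺¹` and on the half space. -/

section SteinSpace

variable {n : ℕ} {g : ℝ → ℝ}

/-- A density generator on `ℝⁿ⁺¹` with finite second moments. -/
structure HasSecondMoment (n : ℕ) (g : ℝ → ℝ) : Prop where
  gen : IsDensityGenerator (n + 1) g
  integrable_sq : ∀ i, Integrable fun z : Fin (n + 1) → ℝ => z i ^ 2 * g (∑ j, z j ^ 2)

namespace HasSecondMoment

variable (H : HasSecondMoment n g)
include H

theorem integrable_of_le {F : (Fin (n + 1) → ℝ) → ℝ} (hF : Measurable F) {C : ℝ}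
    (hC : ∀ z, |F z| ≤ C * (1 + ∑ j, z j ^ 2)) :
    Integrable fun z => F z * g (∑ j, z j ^ 2) := by
  have h1 : Integrable fun z : Fin (n + 1) → ℝ => C * ((1 + ∑ j, z j ^ 2) * g (∑ j, z j ^ 2)) := by
    refine Integrable.const_mul ?_ C
    simp only [add_mul, one_mul, Finset.sum_mul]
    exact H.gen.integrable_pi.add (integrable_finsetSum _ fun i _ => H.integrable_sq i)
  refine h1.mono' (hF.mul (H.gen.measurable.comp measurable_sum_sq)).aestronglyMeasurable
    (.of_forall fun z => ?_)
  have hg := H.gen.nonneg _ (sum_sq_nonneg z)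
  rw [norm_mul, Real.norm_eq_abs, Real.norm_of_nonneg hg, ← mul_assoc]
  exact mul_le_mul_of_nonneg_right (hC z) hg

omit H in
theorem abs_coord_le (z : Fin (n + 1) → ℝ) (i : Fin (n + 1)) : |z i| ≤ 1 + ∑ j, z j ^ 2 := by
  have h1 : z i ^ 2 ≤ ∑ j, z j ^ 2 :=
    Finset.single_le_sum (f := fun j => z j ^ 2) (fun j _ => sq_nonneg _) (Finset.mem_univ i)
  nlinarith [sq_abs (z i), sq_nonneg (|z i| - 1)]

theorem integrable_coord (i : Fin (n + 1)) :
    Integrable fun z : Fin (n + 1) → ℝ => z i * g (∑ j, z j ^ 2) :=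
  H.integrable_of_le (C := 1) (measurable_pi_apply i) fun z => by
    rw [one_mul]; exact abs_coord_le z i

/-- By Fubini, the moment hypotheses of the one-dimensional identities hold on almost every line
parallel to a coordinate axis. -/
theorem ae_integrable_line (i : Fin (n + 1)) : ∀ᵐ y : Fin n → ℝ,
    Integrable (fun t => t * g (∑ j, y j ^ 2 + t ^ 2)) ∧
    Integrable (fun t => t ^ 2 * g (∑ j, y j ^ 2 + t ^ 2)) := by
  have h1 := ((integrable_insertNth (i := i)).2 (H.integrable_coord i)).prod_right_ae
  have h2 := ((integrable_insertNth (i := i)).2 (H.integrable_sq i)).prod_right_ae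
  simp only [sum_sq_insertNth, Fin.insertNth_apply_same] at h1 h2
  exact h1.and h2

omit H in
theorem _root_.measurable_tailIntegral_sum_sq {m : ℕ} (hm : Measurable g) :
    Measurable fun z : Fin m → ℝ => tailIntegral g (∑ j, z j ^ 2) :=
  hm.tailIntegral.comp measurable_sum_sq

/-- Stein's identity on almost every line with `k t = t`. The left side does not depend on `i`, so
all coordinates have the same second moment and it fixes the normalisation of `φ_{2,λ}`. -/
theorem tail_aux (i : Fin (n + 1)) :
    Integrable (fun z : Fin (n + 1) → ℝ => tailIntegral g (∑ j, z j ^ 2)) ∧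
    ∫ z : Fin (n + 1) → ℝ, tailIntegral g (∑ j, z j ^ 2) =
      2 * ∫ z : Fin (n + 1) → ℝ, z i ^ 2 * g (∑ j, z j ^ 2) := by
  have hae : ∀ᵐ y : Fin n → ℝ,
      Integrable (fun t => tailIntegral g (∑ j, y j ^ 2 + t ^ 2)) ∧
      ∫ t, tailIntegral g (∑ j, y j ^ 2 + t ^ 2) =
        2 * ∫ t, t ^ 2 * g (∑ j, y j ^ 2 + t ^ 2) := by
    filter_upwards [H.ae_integrable_line i] with y hy
    have := stein_line (k := id) (k' := fun _ => 1) (C := 1) H.gen.measurable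
      (fun t => hasDerivAt_id t) continuous_const (by simp) hy.1 hy.2
    simp only [one_mul, id] at this
    refine ⟨this.1, this.2.trans ?_⟩
    rw [← integral_const_mul]
    exact integral_congr_ae (.of_forall fun t => by ring)
  have hsq := (integrable_insertNth (i := i)).2 (H.integrable_sq i)
  simp only [sum_sq_insertNth, Fin.insertNth_apply_same] at hsq
  have hint : Integrable (fun z : Fin (n + 1) → ℝ => tailIntegral g (∑ j, z j ^ 2)) := by
    have hmt : Measurable fun p : (Fin n → ℝ) × ℝ =>
        tailIntegral g (∑ j, (i.insertNth p.2 p.1 : Fin (n + 1) → ℝ) j ^ 2) :=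
      (measurable_tailIntegral_sum_sq H.gen.measurable).comp (measurable_insertNth i)
    rw [← integrable_insertNth (i := i), Measure.volume_eq_prod,
      integrable_prod_iff hmt.aestronglyMeasurable]
    simp only [sum_sq_insertNth]
    refine ⟨hae.mono fun y hy => hy.1, ?_⟩
    -- The tail is nonnegative, so the integral of its norm along a line is again twice a second
    -- moment, which is integrable in `y`.
    refine (hsq.integral_prod_left.const_mul 2).congr ?_
    filter_upwards [hae] with y hy
    rw [← hy.2]
    refine integral_congr_ae (.of_forall fun t => ?_)
    exact (Real.norm_of_nonneg (tailIntegral_nonneg H.gen.nonneg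
      (add_nonneg (sum_sq_nonneg y) (sq_nonneg t)))).symm
  refine ⟨hint, ?_⟩
  rw [integral_insertNth i hint, integral_insertNth i (H.integrable_sq i), ← integral_const_mul]
  simp only [sum_sq_insertNth, Fin.insertNth_apply_same]
  exact integral_congr_ae (hae.mono fun y hy => hy.2)

theorem integrable_tail :
    Integrable (fun z : Fin (n + 1) → ℝ => tailIntegral g (∑ j, z j ^ 2)) := (H.tail_aux 0).1

theorem integrable_mul_tail {F : (Fin (n + 1) → ℝ) → ℝ} (hF : Measurable F) {C : ℝ}
    (hC : ∀ z, |F z| ≤ C) : Integrable fun z => F z * tailIntegral g (∑ j, z j ^ 2) :=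
  H.integrable_tail.bdd_mul hF.aestronglyMeasurable (.of_forall hC)

theorem integrable_coord_mul {F : (Fin (n + 1) → ℝ) → ℝ} (hF : Measurable F) {C : ℝ}
    (hC : ∀ z, |F z| ≤ C) (i : Fin (n + 1)) :
    Integrable fun z => z i * F z * g (∑ j, z j ^ 2) := by
  refine H.integrable_of_le (C := C) ((measurable_pi_apply i).mul hF) fun z => ?_
  rw [abs_mul, mul_comm]
  exact mul_le_mul (hC z) (abs_coord_le z i) (abs_nonneg _) ((abs_nonneg _).trans (hC z))

/-- Stein's identity in the `i`-th coordinate. -/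
theorem stein_coord (i : Fin (n + 1)) {k k' : (Fin (n + 1) → ℝ) → ℝ} {C : ℝ}
    (hk : Measurable k) (hk' : Measurable k') (hkC : ∀ z, |k z| ≤ C) (hkC' : ∀ z, |k' z| ≤ C)
    (hd : ∀ y t, HasDerivAt (fun t => k (i.insertNth t y)) (k' (i.insertNth t y)) t)
    (hc : ∀ y, Continuous fun t => k' (i.insertNth t y)) :
    ∫ z, k' z * tailIntegral g (∑ j, z j ^ 2) = 2 * ∫ z, z i * k z * g (∑ j, z j ^ 2) := by
  rw [integral_insertNth i (H.integrable_mul_tail hk' hkC'),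
    integral_insertNth i (H.integrable_coord_mul hk hkC i), ← integral_const_mul]
  simp only [sum_sq_insertNth, Fin.insertNth_apply_same]
  refine integral_congr_ae ?_
  filter_upwards [H.ae_integrable_line i] with y hy
  rw [(stein_line H.gen.measurable (hd y) (hc y) (fun t => hkC' _) hy.1 hy.2).2,
    ← integral_const_mul]
  exact integral_congr_ae (.of_forall fun t => by ring)

omit H in
-- The tail at `‖y‖²` equals `2 ∫_0^∞ t g(‖y‖² + t²) dt`. Integrals against the tail on `ℝⁿ`, where
-- `φ_{1,λ}` lives, thereby become half-space integrals on `ℝⁿ⁺¹` with an extra factor `z 0`.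
theorem _root_.integral_mul_tail {w : (Fin n → ℝ) → ℝ}
    (hw : Integrable (fun z : Fin (n + 1) → ℝ => z 0 * w (Fin.tail z) * g (∑ j, z j ^ 2))) :
    Integrable (fun y => w y * tailIntegral g (∑ j, y j ^ 2)) ∧
    ∫ y, w y * tailIntegral g (∑ j, y j ^ 2) =
      2 * ∫ z in {z | 0 < z 0}, z 0 * w (Fin.tail z) * g (∑ j, z j ^ 2) := by
  have he : ∀ y : Fin n → ℝ, w y * tailIntegral g (∑ j, y j ^ 2) =
      2 * ∫ t in Ioi 0, t * w y * g (∑ j, y j ^ 2 + t ^ 2) := fun y => by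
    have := tailIntegral_add_sq g (∑ j, y j ^ 2) le_rfl
    rw [zero_pow two_ne_zero, add_zero] at this
    rw [this, ← integral_const_mul, ← integral_const_mul]
    exact integral_congr_ae (.of_forall fun t => by ring)
  have hs : ∀ (y : Fin n → ℝ) (t : ℝ), ∑ j, (Fin.cons t y : Fin (n + 1) → ℝ) j ^ 2 =
      ∑ j, y j ^ 2 + t ^ 2 := fun y t => by
    simpa only [Fin.insertNth_zero'] using sum_sq_insertNth 0 t y
  rw [setIntegral_insertNth 0 hw.integrableOn, ← integral_const_mul]
  simp only [Fin.insertNth_zero', hs, Fin.cons_zero, Fin.tail_cons, he, and_true]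
  have h1 := (integrable_indicator_iff (measurableSet_coord_pos 0)).2 hw.integrableOn
  rw [← integrable_insertNth (i := 0)] at h1
  refine (h1.integral_prod_left.const_mul 2).congr (.of_forall fun y => ?_)
  dsimp only
  rw [← integral_indicator measurableSet_Ioi]
  congr 1
  refine integral_congr_ae (.of_forall fun t => ?_)
  simp [indicator, hs]

/-- Stein's identity in the first coordinate on the half space. -/
theorem stein_half {k k' : (Fin (n + 1) → ℝ) → ℝ} {C : ℝ}
    (hk : Measurable k) (hk' : Measurable k') (hkC : ∀ z, |k z| ≤ C) (hkC' : ∀ z, |k' z| ≤ C)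
    (hd : ∀ y t, HasDerivAt (fun t => k ((0 : Fin (n + 1)).insertNth t y))
      (k' ((0 : Fin (n + 1)).insertNth t y)) t)
    (hc : ∀ y, Continuous fun t => k' ((0 : Fin (n + 1)).insertNth t y)) :
    2 * ∫ z in {z | 0 < z 0}, z 0 * k z * g (∑ j, z j ^ 2) =
      (∫ y, k ((0 : Fin (n + 1)).insertNth 0 y) * tailIntegral g (∑ j, y j ^ 2)) +
      ∫ z in {z | 0 < z 0}, k' z * tailIntegral g (∑ j, z j ^ 2) := by
  have hT := H.integrable_mul_tail hk' hkC'
  have hK := H.integrable_coord_mul hk hkC 0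
  have hk0 : Measurable fun y => k ((0 : Fin (n + 1)).insertNth 0 y) :=
    hk.comp ((measurable_insertNth 0).comp measurable_prodMk_right)
  have hk0' : Measurable fun z : Fin (n + 1) → ℝ => k ((0 : Fin (n + 1)).insertNth 0 (Fin.tail z)) :=
    hk0.comp (measurable_pi_lambda _ fun i => measurable_pi_apply _)
  have hB := H.integrable_coord_mul hk0' (fun z => hkC _) 0
  rw [(integral_mul_tail (w := fun y => k ((0 : Fin (n + 1)).insertNth 0 y)) hB).2]
  -- On each line `stein_Ioi` handles `k` minus its value at the boundary point; the subtracted part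
  -- is the boundary integral, rewritten by `integral_mul_tail`.
  have hsub : (2 * ∫ z in {z | 0 < z 0}, z 0 * k z * g (∑ j, z j ^ 2)) -
      2 * ∫ z in {z | 0 < z 0}, z 0 * k ((0 : Fin (n + 1)).insertNth 0 (Fin.tail z)) *
        g (∑ j, z j ^ 2) =
      ∫ z in {z | 0 < z 0}, k' z * tailIntegral g (∑ j, z j ^ 2) := by
    rw [← mul_sub, ← integral_sub hK.integrableOn hB.integrableOn,
      setIntegral_insertNth 0 (F := fun z => z 0 * k z * g (∑ j, z j ^ 2) -
        z 0 * k ((0 : Fin (n + 1)).insertNth 0 (Fin.tail z)) * g (∑ j, z j ^ 2))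
        (hK.sub hB).integrableOn, setIntegral_insertNth 0 hT.integrableOn,
      ← integral_const_mul]
    simp only [sum_sq_insertNth, Fin.insertNth_apply_same]
    refine integral_congr_ae ?_
    filter_upwards [H.ae_integrable_line 0] with y hy
    rw [(stein_Ioi H.gen.measurable (hd y) (hc y) (fun t => hkC' _) hy.2.integrableOn).2,
      ← integral_const_mul]
    refine integral_congr_ae (.of_forall fun t => ?_)
    simp only [Fin.insertNth_zero', Fin.tail_cons]
    ring
  linarith

end HasSecondMoment

end SteinSpace

/-! ### The constants `E|U₀|` and `E(R²)` as normalisations of tail generators. -/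

section Moments

variable {n : ℕ} {g : ℝ → ℝ}

theorem measurable_sphericalLaw_density {m : ℕ} (hm : Measurable g) :
    Measurable fun z : EuclideanSpace ℝ (Fin m) => ENNReal.ofReal (g (‖z‖ ^ 2)) :=
  (hm.comp (measurable_norm.pow_const 2)).ennreal_ofReal

theorem integral_sphericalLaw {m : ℕ} (H : IsDensityGenerator m g) (F : (Fin m → ℝ) → ℝ) :
    ∫ z, F z.ofLp ∂(sphericalLaw m g) = ∫ z : Fin m → ℝ, F z * g (∑ j, z j ^ 2) := by
  rw [sphericalLaw, integral_withDensity_eq_integral_toReal_smul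
    (measurable_sphericalLaw_density H.measurable) (.of_forall fun _ => ENNReal.ofReal_lt_top),
    ← integral_norm_sq_eq (fun z : Fin m → ℝ => F z * g (∑ j, z j ^ 2))]
  refine integral_congr_ae (.of_forall fun z => ?_)
  dsimp only
  rw [ENNReal.toReal_ofReal (H.nonneg _ (sq_nonneg _)), smul_eq_mul, mul_comm,
    EuclideanSpace.norm_sq_eq_sum]

theorem hasSecondMoment_of_sphericalLaw (H : IsDensityGenerator (n + 1) g)
    (h2 : Integrable (fun z : EuclideanSpace ℝ (Fin (n + 1)) => ‖z‖ ^ 2)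
      (sphericalLaw (n + 1) g)) : HasSecondMoment n g := by
  refine ⟨H, fun i => ?_⟩
  rw [sphericalLaw, integrable_withDensity_iff (measurable_sphericalLaw_density H.measurable)
    (.of_forall fun _ => ENNReal.ofReal_lt_top)] at h2
  have h3 : Integrable fun z : Fin (n + 1) → ℝ => (∑ j, z j ^ 2) * g (∑ j, z j ^ 2) := by
    rw [← integrable_ofLp_iff]
    refine h2.congr (.of_forall fun z => ?_)
    dsimp only
    rw [ENNReal.toReal_ofReal (H.nonneg _ (sq_nonneg _)), EuclideanSpace.norm_sq_eq_sum]
  refine h3.mono' (((measurable_pi_apply i).pow_const 2).mul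
    (H.measurable.comp measurable_sum_sq)).aestronglyMeasurable (.of_forall fun z => ?_)
  have hg := H.nonneg _ (sum_sq_nonneg z)
  rw [norm_mul, Real.norm_of_nonneg (sq_nonneg _), Real.norm_of_nonneg hg]
  exact mul_le_mul_of_nonneg_right (Finset.single_le_sum (f := fun j => z j ^ 2)
    (fun j _ => sq_nonneg _) (Finset.mem_univ i)) hg

namespace HasSecondMoment

variable (H : HasSecondMoment n g)
include H

theorem meanAbsU_eq_integral_abs :
    meanAbsU n g = ∫ z : Fin (n + 1) → ℝ, |z 0| * g (∑ j, z j ^ 2) :=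
  integral_sphericalLaw H.gen fun z => |z 0|

theorem meanAbsU_eq :
    meanAbsU n g = ∫ y : Fin n → ℝ, tailIntegral g (∑ j, y j ^ 2) := by
  have hi : Integrable fun z : Fin (n + 1) → ℝ => |z 0| * g (∑ j, z j ^ 2) :=
    H.integrable_of_le (C := 1) (measurable_pi_apply 0).abs fun z => by
      rw [abs_abs, one_mul]; exact abs_coord_le z 0
  have h1 := (integral_mul_tail (g := g) (w := fun _ : Fin n → ℝ => 1)
    (by simpa using H.integrable_coord 0)).2
  simp only [one_mul, mul_one] at h1
  rw [H.meanAbsU_eq_integral_abs, integral_eq_two_mul_of_abs 0 hi fun y t => by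
    simp only [sum_sq_insertNth, sq_abs, Fin.insertNth_apply_same, abs_abs], h1]
  congr 1
  exact setIntegral_congr_fun (measurableSet_coord_pos 0) fun z hz => by
    rw [abs_of_pos hz]

/-- Each of the `n` coordinates of `U₁` contributes half of the tail integral, by `tail_aux`. -/
theorem meanSqR_eq :
    meanSqR n g = n / 2 * ∫ z : Fin (n + 1) → ℝ, tailIntegral g (∑ j, z j ^ 2) := by
  have h1 := integral_sphericalLaw H.gen fun z => ∑ i : Fin n, (z i.succ) ^ 2
  have h2 : ∀ i : Fin n, ∫ z : Fin (n + 1) → ℝ, z i.succ ^ 2 * g (∑ j, z j ^ 2) =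
      (∫ z : Fin (n + 1) → ℝ, tailIntegral g (∑ j, z j ^ 2)) / 2 := fun i => by
    rw [(H.tail_aux i.succ).2]; ring
  refine h1.trans ?_
  simp only [Finset.sum_mul]
  rw [integral_finsetSum _ fun i _ => H.integrable_sq i.succ]
  simp only [h2, Finset.sum_const, Finset.card_univ, Fintype.card_fin, nsmul_eq_mul]
  ring

/-- If the integral vanished, `tail_aux` would make every `z i ^ 2 * g` zero almost everywhere,
hence `g (‖z‖²)` itself off the origin, contradicting total mass `1`. -/
theorem integral_tail_pos :
    0 < ∫ z : Fin (n + 1) → ℝ, tailIntegral g (∑ j, z j ^ 2) := by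
  refine lt_of_le_of_ne (integral_nonneg fun z =>
    tailIntegral_nonneg H.gen.nonneg (sum_sq_nonneg z)) fun h0 => ?_
  have hz : ∀ i, ∀ᵐ z : Fin (n + 1) → ℝ, z i ^ 2 * g (∑ j, z j ^ 2) = 0 := fun i => by
    have h1 := (H.tail_aux i).2
    rw [← h0] at h1
    refine (integral_eq_zero_iff_of_nonneg (fun z => mul_nonneg (sq_nonneg _)
      (H.gen.nonneg _ (sum_sq_nonneg z))) (H.integrable_sq i)).1 ?_
    linarith
  have hg : ∀ᵐ z : Fin (n + 1) → ℝ, g (∑ j, z j ^ 2) = 0 := by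
    filter_upwards [ae_all_iff.2 hz, Measure.ae_ne volume (0 : Fin (n + 1) → ℝ)] with z h1 h2
    obtain ⟨i, hi⟩ := Function.ne_iff.1 h2
    exact (mul_eq_zero.1 (h1 i)).resolve_left (pow_ne_zero 2 hi)
  have := H.gen.integral_pi
  rw [integral_eq_zero_of_ae hg] at this
  exact zero_ne_one this

theorem meanAbsU_pos : 0 < meanAbsU n g := by
  rw [H.meanAbsU_eq_integral_abs]
  have hi : Integrable fun z : Fin (n + 1) → ℝ => |z 0| * g (∑ j, z j ^ 2) :=
    H.integrable_of_le (C := 1) (measurable_pi_apply 0).abs fun z => by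
      rw [abs_abs, one_mul]; exact abs_coord_le z 0
  have hnn : ∀ z : Fin (n + 1) → ℝ, 0 ≤ |z 0| * g (∑ j, z j ^ 2) := fun z =>
    mul_nonneg (abs_nonneg _) (H.gen.nonneg _ (sum_sq_nonneg z))
  refine lt_of_le_of_ne (integral_nonneg hnn) fun h0 => ?_
  have hz := (integral_eq_zero_iff_of_nonneg hnn hi).1 h0.symm
  have h1 := (H.tail_aux 0).2
  rw [integral_eq_zero_of_ae (f := fun z : Fin (n + 1) → ℝ => z 0 ^ 2 * g (∑ j, z j ^ 2))
    (hz.mono fun z hz => ?_)] at h1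
  · exact H.integral_tail_pos.ne' (by rw [h1, mul_zero])
  · simp only [Pi.zero_apply, mul_eq_zero, abs_eq_zero] at hz ⊢
    exact hz.imp_left fun h => by rw [h]; norm_num

/-- This identifies the factor in `φ_{2,λ}` as the one normalising the tail on `ℝⁿ⁺¹`; `1 ≤ n` keeps
it from being `0 / 0`. -/
theorem const_eq (hn : 1 ≤ n) : n / (2 * meanSqR n g) =
    (∫ z : Fin (n + 1) → ℝ, tailIntegral g (∑ j, z j ^ 2))⁻¹ := by
  have hT := H.integral_tail_pos
  have hn' : (n : ℝ) ≠ 0 := by positivity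
  rw [H.meanSqR_eq]
  field_simp

theorem isDensityGenerator_tail (hn : 1 ≤ n) :
    IsDensityGenerator (n + 1) fun u => n / (2 * meanSqR n g) * tailIntegral g u := by
  have hT := H.integral_tail_pos
  rw [isDensityGenerator_iff, H.const_eq hn]
  refine ⟨H.gen.measurable.tailIntegral.const_mul _, fun u hu =>
    mul_nonneg (inv_nonneg.2 hT.le) (tailIntegral_nonneg H.gen.nonneg hu), ?_⟩
  rw [integral_const_mul, inv_mul_cancel₀ hT.ne']

end HasSecondMoment

end Moments

/-! ### Elliptical densities in affine coordinates. -/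

section Elliptical

variable {n : ℕ} {h : ℝ → ℝ} {A S : Matrix (Fin n) (Fin n) ℝ}

theorem sqrt_det_mul_transpose (hS : S = A * Aᵀ) : √S.det = |A.det| := by
  rw [hS, Matrix.det_mul, Matrix.det_transpose, ← sq, Real.sqrt_sq_eq_abs]

theorem ellipticalPDF_affine (hA : A.det ≠ 0) (hS : S = A * Aᵀ) (μ : EuclideanSpace ℝ (Fin n))
    (y : Fin n → ℝ) :
    ellipticalPDF μ S h (μ + WithLp.toLp 2 (A *ᵥ y)) = |A.det|⁻¹ * h (∑ i, y i ^ 2) := by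
  rw [ellipticalPDF, add_sub_cancel_left, quadForm_inv_mul_transpose hA hS,
    sqrt_det_mul_transpose hS]

theorem integral_mul_ellipticalPDF (hA : A.det ≠ 0) (hS : S = A * Aᵀ)
    (μ : EuclideanSpace ℝ (Fin n)) (F : EuclideanSpace ℝ (Fin n) → ℝ) :
    ∫ x, F x * ellipticalPDF μ S h x =
      ∫ y : Fin n → ℝ, F (μ + WithLp.toLp 2 (A *ᵥ y)) * h (∑ i, y i ^ 2) := by
  have hA' : |A.det| ≠ 0 := abs_ne_zero.2 hA
  have h1 := integral_affine μ hA fun x => F x * ellipticalPDF μ S h x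
  simp only [ellipticalPDF_affine hA hS] at h1
  rw [eq_comm, inv_mul_eq_iff_eq_mul₀ hA', ← integral_const_mul] at h1
  rw [h1]
  exact integral_congr_ae (.of_forall fun y => by field_simp)

theorem integrable_mul_ellipticalPDF_iff (hA : A.det ≠ 0) (hS : S = A * Aᵀ)
    (μ : EuclideanSpace ℝ (Fin n)) (F : EuclideanSpace ℝ (Fin n) → ℝ) :
    Integrable (fun x => F x * ellipticalPDF μ S h x) ↔
      Integrable fun y : Fin n → ℝ => F (μ + WithLp.toLp 2 (A *ᵥ y)) * h (∑ i, y i ^ 2) := by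
  have hA' : |A.det|⁻¹ ≠ 0 := inv_ne_zero (abs_ne_zero.2 hA)
  rw [← integrable_affine_iff μ hA, ← integrable_const_mul_iff hA'.isUnit
    (fun y : Fin n → ℝ => F (μ + WithLp.toLp 2 (A *ᵥ y)) * h (∑ i, y i ^ 2))]
  simp only [ellipticalPDF_affine hA hS]
  exact integrable_congr (.of_forall fun y => by ring)

theorem ellipticalPDF_nonneg (hA : A.det ≠ 0) (hS : S = A * Aᵀ) (hn : ∀ u, 0 ≤ u → 0 ≤ h u)
    (μ x : EuclideanSpace ℝ (Fin n)) : 0 ≤ ellipticalPDF μ S h x := by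
  obtain ⟨y, hy⟩ := exists_mulVec_eq hA (x - μ).ofLp
  have hx : x = μ + WithLp.toLp 2 (A *ᵥ y) := by rw [hy, WithLp.toLp_ofLp]; abel
  rw [hx, ellipticalPDF_affine hA hS]
  have := hn _ (sum_sq_nonneg y)
  positivity

theorem isProbDensity_ellipticalPDF_tail {g : ℝ → ℝ} (H : HasSecondMoment n g) (hA : A.det ≠ 0)
    (hS : S = A * Aᵀ) (μ : EuclideanSpace ℝ (Fin n)) :
    IsProbDensity (ellipticalPDF μ S fun u => tailIntegral g u / meanAbsU n g) := by
  have hm := H.meanAbsU_pos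
  refine ⟨measurable_ellipticalPDF measurable_const (fun _ _ => measurable_const) measurable_id
    (H.gen.measurable.tailIntegral.div_const _), ellipticalPDF_nonneg hA hS (fun u hu =>
      div_nonneg (tailIntegral_nonneg H.gen.nonneg hu) hm.le) μ, ?_⟩
  have h1 := integral_mul_ellipticalPDF (h := fun u => tailIntegral g u / meanAbsU n g)
    hA hS μ fun _ => 1
  simp only [one_mul] at h1
  rw [h1, integral_div, ← H.meanAbsU_eq, div_self hm.ne']

end Elliptical

/-! ### Second derivatives and traces against the Hessian. -/

section Hessian

variable {n : ℕ} {f : EuclideanSpace ℝ (Fin n) → ℝ}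

theorem inner_gradient_eq (f : EuclideanSpace ℝ (Fin n) → ℝ) (v x : EuclideanSpace ℝ (Fin n)) :
    inner ℝ v (gradient f x) = fderiv ℝ f x v := by
  rw [real_inner_comm, gradient, InnerProductSpace.toDual_symm_apply]

theorem differentiable_fderiv_of_contDiff_two (hf : ContDiff ℝ 2 f) :
    Differentiable ℝ (fderiv ℝ f) :=
  (hf.fderiv_right (m := 1) (by norm_num)).differentiable (by norm_num)

theorem continuous_fderiv_fderiv (hf : ContDiff ℝ 2 f) : Continuous (fderiv ℝ (fderiv ℝ f)) :=
  (hf.fderiv_right (m := 1) (by norm_num)).continuous_fderiv (by norm_num)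

theorem hessianMatrix_apply (hf : ContDiff ℝ 2 f) (x : EuclideanSpace ℝ (Fin n)) (i j : Fin n) :
    hessianMatrix f x i j = fderiv ℝ (fderiv ℝ f) x (EuclideanSpace.single i 1)
      (EuclideanSpace.single j 1) := by
  have h := ((differentiable_fderiv_of_contDiff_two hf) x).hasFDerivAt.clm_apply
    (hasFDerivAt_const (EuclideanSpace.single j (1 : ℝ)) x)
  simp only [hessianMatrix, Matrix.of_apply]
  rw [h.fderiv]
  simp

theorem euclidean_eq_sum_single (v : EuclideanSpace ℝ (Fin n)) :
    v = ∑ i, v i • EuclideanSpace.single i (1 : ℝ) := by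
  ext j
  simp [Finset.sum_apply, Pi.single_apply]

theorem fderiv_fderiv_eq_sum (hf : ContDiff ℝ 2 f) (x v w : EuclideanSpace ℝ (Fin n)) :
    fderiv ℝ (fderiv ℝ f) x v w = ∑ i, ∑ j, v i * w j * hessianMatrix f x i j := by
  conv_lhs => rw [euclidean_eq_sum_single v, euclidean_eq_sum_single w]
  simp only [map_sum, map_smul, sum_apply, smul_apply,
    smul_eq_mul, hessianMatrix_apply hf, Finset.mul_sum, mul_assoc]
  rw [Finset.sum_comm]
  exact Finset.sum_congr rfl fun i _ => Finset.sum_congr rfl fun j _ => by ring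

theorem trace_vecMulVec_mul_hessian (hf : ContDiff ℝ 2 f) (x v w : EuclideanSpace ℝ (Fin n)) :
    (Matrix.vecMulVec v.ofLp w.ofLp * hessianMatrix f x).trace =
      fderiv ℝ (fderiv ℝ f) x w v := by
  rw [fderiv_fderiv_eq_sum hf, Finset.sum_comm]
  simp only [Matrix.trace, Matrix.diag, Matrix.mul_apply, Matrix.vecMulVec_apply]
  exact Finset.sum_congr rfl fun i _ => Finset.sum_congr rfl fun j _ => by ring

theorem fderiv_fderiv_comm (hf : ContDiff ℝ 2 f) (x v w : EuclideanSpace ℝ (Fin n)) :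
    fderiv ℝ (fderiv ℝ f) x v w = fderiv ℝ (fderiv ℝ f) x w v :=
  (hf.contDiffAt.isSymmSndFDerivAt (by simp)).eq v w

/-- `B Aᵀ` is the sum over `j` of the outer products of the `j`-th columns of `B` and `A`. -/
theorem sum_fderiv_fderiv_mulVec (hf : ContDiff ℝ 2 f) (A B : Matrix (Fin n) (Fin n) ℝ)
    (x : EuclideanSpace ℝ (Fin n)) :
    ∑ j, fderiv ℝ (fderiv ℝ f) x (WithLp.toLp 2 (A *ᵥ Pi.single j 1))
      (WithLp.toLp 2 (B *ᵥ Pi.single j 1)) = (B * Aᵀ * hessianMatrix f x).trace := by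
  have hM : B * Aᵀ = ∑ j, Matrix.vecMulVec (B *ᵥ Pi.single j 1) (A *ᵥ Pi.single j 1) := by
    ext a b
    simp [Matrix.mul_apply, Matrix.sum_apply, Matrix.vecMulVec_apply]
  rw [hM, Finset.sum_mul, Matrix.trace_sum]
  exact Finset.sum_congr rfl fun j _ =>
    (trace_vecMulVec_mul_hessian hf x (WithLp.toLp 2 _) (WithLp.toLp 2 _)).symm

theorem continuous_trace_mul_hessian (hf : ContDiff ℝ 2 f) (M : Matrix (Fin n) (Fin n) ℝ) :
    Continuous fun x => (M * hessianMatrix f x).trace := by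
  have := continuous_fderiv_fderiv hf
  simp only [Matrix.trace, Matrix.diag, Matrix.mul_apply, hessianMatrix_apply hf]
  fun_prop

end Hessian

/-! ### Stein's identity transported through the stochastic representation. -/

section SkewStein

variable {n : ℕ} {g : ℝ → ℝ} {f : EuclideanSpace ℝ (Fin n) → ℝ} {C : ℝ}
  (μ δ : EuclideanSpace ℝ (Fin n)) (A : Matrix (Fin n) (Fin n) ℝ)

theorem skewMap_add_smul (z w : Fin (n + 1) → ℝ) (t : ℝ) :
    skewMap μ δ A (z + t • w) = skewMap μ δ A z + t • skewMap 0 δ A w := by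
  have : Fin.tail (z + t • w) = Fin.tail z + t • Fin.tail w := rfl
  simp only [skewMap, this, Matrix.mulVec_add, Matrix.mulVec_smul, WithLp.toLp_add,
    WithLp.toLp_smul, Pi.add_apply, Pi.smul_apply, smul_eq_mul]
  module

theorem insertNth_eq_add_smul (i : Fin (n + 1)) (t : ℝ) (y : Fin n → ℝ) :
    (i.insertNth t y : Fin (n + 1) → ℝ) = i.insertNth 0 y + t • Pi.single i 1 := by
  ext j
  refine Fin.succAboveCases i ?_ (fun j => ?_) j
  · simp
  · simp

theorem skewMap_single_zero : skewMap 0 δ A (Pi.single 0 1) = δ := by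
  have : Fin.tail (Pi.single 0 1 : Fin (n + 1) → ℝ) = 0 := by
    ext j; simp [Fin.tail]
  simp [skewMap, this]

theorem skewMap_single_succ (j : Fin n) :
    skewMap 0 δ A (Pi.single j.succ 1) = WithLp.toLp 2 (A *ᵥ Pi.single j 1) := by
  have : Fin.tail (Pi.single j.succ 1 : Fin (n + 1) → ℝ) = Pi.single j 1 := by
    ext k; simp [Fin.tail, Pi.single_apply]
  rw [skewMap, this, Pi.single_eq_of_ne (Fin.succ_ne_zero j).symm]
  simp

theorem hasDerivAt_fderiv_skewMap (hf : ContDiff ℝ 2 f) (i : Fin (n + 1)) (y : Fin n → ℝ)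
    (w : EuclideanSpace ℝ (Fin n)) (t : ℝ) :
    HasDerivAt (fun t => fderiv ℝ f (skewMap μ δ A (i.insertNth t y)) w)
      (fderiv ℝ (fderiv ℝ f) (skewMap μ δ A (i.insertNth t y))
        (skewMap 0 δ A (Pi.single i 1)) w) t := by
  have hl : HasDerivAt (fun t => skewMap μ δ A (i.insertNth t y))
      (skewMap 0 δ A (Pi.single i 1)) t := by
    have h : (fun t => skewMap μ δ A (i.insertNth t y)) = fun t : ℝ =>
        skewMap μ δ A (i.insertNth 0 y) + t • skewMap 0 δ A (Pi.single i 1) :=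
      funext fun t => by rw [insertNth_eq_add_smul, skewMap_add_smul]
    rw [h]
    simpa using ((hasDerivAt_id t).smul_const (skewMap 0 δ A (Pi.single i 1))).const_add
      (skewMap μ δ A (i.insertNth 0 y))
  have h1 := ((differentiable_fderiv_of_contDiff_two hf) _).hasFDerivAt.comp_hasDerivAt t hl
  have h2 := h1.clm_apply (hasDerivAt_const t w)
  rwa [map_zero, add_zero] at h2

theorem continuous_insertNth (i : Fin (n + 1)) (y : Fin n → ℝ) :
    Continuous fun t : ℝ => (i.insertNth t y : Fin (n + 1) → ℝ) := by
  have h : (fun t : ℝ => (i.insertNth t y : Fin (n + 1) → ℝ)) =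
      fun t => i.insertNth 0 y + t • Pi.single i 1 := funext fun t => insertNth_eq_add_smul i t y
  rw [h]
  fun_prop

variable (hf : ContDiff ℝ 2 f) (h1 : ∀ x, ‖fderiv ℝ f x‖ ≤ C)
  (h2 : ∀ x, ‖fderiv ℝ (fderiv ℝ f) x‖ ≤ C) (w : EuclideanSpace ℝ (Fin n))

include hf in
theorem continuous_fderiv_skewMap : Continuous fun z => fderiv ℝ f (skewMap μ δ A z) w :=
  ((hf.continuous_fderiv (by norm_num)).comp (continuous_skewMap μ δ A)).clm_apply
    continuous_const

include hf in
theorem continuous_fderiv_fderiv_skewMap (v : EuclideanSpace ℝ (Fin n)) :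
    Continuous fun z => fderiv ℝ (fderiv ℝ f) (skewMap μ δ A z) v w :=
  (((continuous_fderiv_fderiv hf).comp (continuous_skewMap μ δ A)).clm_apply
    continuous_const).clm_apply continuous_const

include h1 in
theorem abs_fderiv_le (x : EuclideanSpace ℝ (Fin n)) : |fderiv ℝ f x w| ≤ C * ‖w‖ :=
  ((fderiv ℝ f x).le_opNorm w).trans (by gcongr; exact h1 x)

include h2 in
theorem abs_fderiv_fderiv_le (x v : EuclideanSpace ℝ (Fin n)) :
    |fderiv ℝ (fderiv ℝ f) x v w| ≤ C * ‖v‖ * ‖w‖ :=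
  ((fderiv ℝ (fderiv ℝ f) x).le_opNorm₂ v w).trans (by gcongr; exact h2 x)

include hf h1 h2

/-- Moving the first coordinate moves the image in the direction `δ`, and the boundary `z 0 = 0` is
mapped to the points `μ + A y`. This is why the boundary term is elliptical with scale matrix `A
Aᵀ`. -/
theorem stein_skewMap_zero (H : HasSecondMoment n g) :
    2 * ∫ z in {z | 0 < z 0}, z 0 * fderiv ℝ f (skewMap μ δ A z) w * g (∑ j, z j ^ 2) =
      (∫ y, fderiv ℝ f (μ + WithLp.toLp 2 (A *ᵥ y)) w * tailIntegral g (∑ j, y j ^ 2)) +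
      ∫ z in {z | 0 < z 0}, fderiv ℝ (fderiv ℝ f) (skewMap μ δ A z) δ w *
        tailIntegral g (∑ j, z j ^ 2) := by
  have hd := hasDerivAt_fderiv_skewMap μ δ A hf (0 : Fin (n + 1))
  rw [skewMap_single_zero] at hd
  have hc1 := continuous_fderiv_skewMap μ δ A hf w
  have hc2 := continuous_fderiv_fderiv_skewMap μ δ A hf w δ
  have := H.stein_half (C := max (C * ‖w‖) (C * ‖δ‖ * ‖w‖)) hc1.measurable hc2.measurable
    (fun z => (abs_fderiv_le h1 w _).trans (le_max_left _ _))
    (fun z => (abs_fderiv_fderiv_le h2 w _ δ).trans (le_max_right _ _))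
    (fun y t => hd y w t) (fun y => hc2.comp (continuous_insertNth 0 y))
  simpa only [skewMap_insertNth_zero, zero_smul, add_zero] using this

/-- The indicator of the half space is constant along lines in the other coordinate directions, so
the whole-space identity applies to the truncated function and no boundary term appears. -/
theorem stein_skewMap_succ (H : HasSecondMoment n g) (i : Fin n) :
    2 * ∫ z in {z | 0 < z 0}, z i.succ * fderiv ℝ f (skewMap μ δ A z) w * g (∑ j, z j ^ 2) =
      ∫ z in {z | 0 < z 0}, fderiv ℝ (fderiv ℝ f) (skewMap μ δ A z)
        (WithLp.toLp 2 (A *ᵥ Pi.single i 1)) w * tailIntegral g (∑ j, z j ^ 2) := by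
  have hd := hasDerivAt_fderiv_skewMap μ δ A hf i.succ
  rw [skewMap_single_succ] at hd
  generalize (WithLp.toLp 2 (A *ᵥ Pi.single i 1) : EuclideanSpace ℝ (Fin n)) = v at hd ⊢
  have hc1 := continuous_fderiv_skewMap μ δ A hf w
  have hc2 := continuous_fderiv_fderiv_skewMap μ δ A hf w v
  have hS : MeasurableSet {z : Fin (n + 1) → ℝ | 0 < z 0} := measurableSet_coord_pos 0
  have hins : ∀ (y : Fin n → ℝ) (t s : ℝ), (i.succ.insertNth t y : Fin (n + 1) → ℝ) 0 =
      (i.succ.insertNth s y : Fin (n + 1) → ℝ) 0 := fun y t s => by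
    rw [insertNth_eq_add_smul, insertNth_eq_add_smul _ s]
    simp
  have hind : ∀ {F : (Fin (n + 1) → ℝ) → ℝ} {B : ℝ}, (∀ z, |F z| ≤ B) →
      ∀ z, |{z : Fin (n + 1) → ℝ | 0 < z 0}.indicator F z| ≤ B := fun {F B} hF z => by
    by_cases hz : 0 < z 0
    · simpa [indicator, hz] using hF z
    · simpa [indicator, hz] using (abs_nonneg _).trans (hF z)
  have := H.stein_coord i.succ (C := max (C * ‖w‖) (C * ‖v‖ * ‖w‖))
    (hc1.measurable.indicator hS) (hc2.measurable.indicator hS)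
    (hind fun z => (abs_fderiv_le h1 w _).trans (le_max_left _ _))
    (hind fun z => (abs_fderiv_fderiv_le h2 w _ v).trans (le_max_right _ _))
    (fun y t => by
      by_cases h0 : 0 < (i.succ.insertNth 0 y : Fin (n + 1) → ℝ) 0
      · simpa [indicator, hins y _ 0, h0] using hd y w t
      · simpa [indicator, hins y _ 0, h0] using hasDerivAt_const t (0 : ℝ))
    (fun y => by
      by_cases h0 : 0 < (i.succ.insertNth 0 y : Fin (n + 1) → ℝ) 0
      · simpa [indicator, hins y _ 0, h0] using!
          hc2.comp (continuous_insertNth i.succ y)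
      · simpa [indicator, hins y _ 0, h0] using continuous_const)
  rw [← integral_indicator hS, ← integral_indicator hS]
  convert! this.symm using 2
  · refine congrArg _ (funext fun z => ?_)
    by_cases hz : 0 < z 0 <;> simp [indicator, hz]
  · funext z
    by_cases hz : 0 < z 0 <;> simp [indicator, hz]

/-- The expected directional derivative of `f` along a variation of `skewMap`. -/
theorem integral_fderiv_skewMap (H : HasSecondMoment n g)
    {M : Matrix (Fin n) (Fin n) ℝ} (m d : EuclideanSpace ℝ (Fin n))
    (A' : Matrix (Fin n) (Fin n) ℝ)
    (hA' : A' * Aᵀ = (1 / 2 : ℝ) • (M - Matrix.vecMulVec d.ofLp δ.ofLp -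
      Matrix.vecMulVec δ.ofLp d.ofLp)) :
    ∫ z, fderiv ℝ f (skewMap μ δ A z) (skewMap m d A' z) ∂(halfLaw n g) =
      (∫ z, fderiv ℝ f (skewMap μ δ A z) m ∂(halfLaw n g)) +
      (∫ y, fderiv ℝ f (μ + WithLp.toLp 2 (A *ᵥ y)) d * tailIntegral g (∑ j, y j ^ 2)) +
      (1 / 2) * ∫ z in {z | 0 < z 0}, (M * hessianMatrix f (skewMap μ δ A z)).trace *
        tailIntegral g (∑ j, z j ^ 2) := by
  have hdec : ∀ z : Fin (n + 1) → ℝ, skewMap m d A' z =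
      m + z 0 • d + ∑ i : Fin n, z i.succ • WithLp.toLp 2 (A' *ᵥ Pi.single i 1) := fun z => by
    rw [skewMap]
    congr 1
    ext a
    simp [Matrix.mulVec, dotProduct, Fin.tail, mul_comm]
  have hexp : ∀ z : Fin (n + 1) → ℝ,
      fderiv ℝ f (skewMap μ δ A z) (skewMap m d A' z) * g (∑ j, z j ^ 2) =
      fderiv ℝ f (skewMap μ δ A z) m * g (∑ j, z j ^ 2) +
      z 0 * fderiv ℝ f (skewMap μ δ A z) d * g (∑ j, z j ^ 2) +
      ∑ i : Fin n, z i.succ * fderiv ℝ f (skewMap μ δ A z)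
        (WithLp.toLp 2 (A' *ᵥ Pi.single i 1)) * g (∑ j, z j ^ 2) := fun z => by
    rw [hdec]
    simp only [map_add, map_smul, map_sum, smul_eq_mul, add_mul, Finset.sum_mul]
  have hI : ∀ (i : Fin (n + 1)) (w : EuclideanSpace ℝ (Fin n)), IntegrableOn (fun z =>
      z i * fderiv ℝ f (skewMap μ δ A z) w * g (∑ j, z j ^ 2)) {z | 0 < z 0} := fun i w =>
    (H.integrable_coord_mul (continuous_fderiv_skewMap μ δ A hf w).measurable
      (fun z => abs_fderiv_le h1 w _) i).integrableOn
  have hIs : ∀ i ∈ (Finset.univ : Finset (Fin n)), Integrable (fun z => z i.succ *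
      fderiv ℝ f (skewMap μ δ A z) (WithLp.toLp 2 (A' *ᵥ Pi.single i 1)) * g (∑ j, z j ^ 2))
      (volume.restrict {z | 0 < z 0}) := fun i _ => hI i.succ _
  have hI0 : IntegrableOn (fun z => fderiv ℝ f (skewMap μ δ A z) m * g (∑ j, z j ^ 2))
      {z | 0 < z 0} :=
    (H.gen.integrable_pi.bdd_mul (continuous_fderiv_skewMap μ δ A hf m).aestronglyMeasurable
      (.of_forall fun z => abs_fderiv_le h1 m _)).integrableOn
  have hD : ∀ v w : EuclideanSpace ℝ (Fin n), IntegrableOn (fun z =>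
      fderiv ℝ (fderiv ℝ f) (skewMap μ δ A z) v w * tailIntegral g (∑ j, z j ^ 2))
      {z | 0 < z 0} := fun v w =>
    (H.integrable_mul_tail (continuous_fderiv_fderiv_skewMap μ δ A hf w v).measurable
      (fun z => abs_fderiv_fderiv_le h2 w _ v)).integrableOn
  have hDs : ∀ i ∈ (Finset.univ : Finset (Fin n)), Integrable (fun z =>
      fderiv ℝ (fderiv ℝ f) (skewMap μ δ A z) (WithLp.toLp 2 (A *ᵥ Pi.single i 1))
        (WithLp.toLp 2 (A' *ᵥ Pi.single i 1)) * tailIntegral g (∑ j, z j ^ 2))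
      (volume.restrict {z | 0 < z 0}) := fun i _ => hD _ _
  rw [integral_halfLaw H.gen, integral_halfLaw H.gen]
  simp only [hexp]
  have hI1 : Integrable (fun z => fderiv ℝ f (skewMap μ δ A z) m * g (∑ j, z j ^ 2) +
      z 0 * fderiv ℝ f (skewMap μ δ A z) d * g (∑ j, z j ^ 2)) (volume.restrict {z | 0 < z 0}) :=
    hI0.add (hI 0 d)
  rw [integral_add hI1 (integrable_finsetSum _ hIs),
    integral_add hI0 (hI 0 d), integral_finsetSum _ hIs, mul_add, mul_add,
    stein_skewMap_zero μ δ A hf h1 h2 d H, Finset.mul_sum]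
  simp only [stein_skewMap_succ μ δ A hf h1 h2 _ H]
  rw [← integral_finsetSum _ hDs]
  -- The term with `A'` equals half the trace of `M H_f` minus the second derivative in the
  -- directions `δ` and `d`, counted once because the second derivative is symmetric. The interior
  -- term from the first coordinate restores exactly this quantity.
  have hfin : ∀ z : Fin (n + 1) → ℝ,
      (1 / 2) * ((M * hessianMatrix f (skewMap μ δ A z)).trace * tailIntegral g (∑ j, z j ^ 2)) =
      fderiv ℝ (fderiv ℝ f) (skewMap μ δ A z) δ d * tailIntegral g (∑ j, z j ^ 2) +
      ∑ i, fderiv ℝ (fderiv ℝ f) (skewMap μ δ A z) (WithLp.toLp 2 (A *ᵥ Pi.single i 1))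
        (WithLp.toLp 2 (A' *ᵥ Pi.single i 1)) * tailIntegral g (∑ j, z j ^ 2) := fun z => by
    rw [← Finset.sum_mul, sum_fderiv_fderiv_mulVec hf, hA', Matrix.smul_mul, Matrix.trace_smul,
      Matrix.sub_mul, Matrix.sub_mul, Matrix.trace_sub, Matrix.trace_sub,
      trace_vecMulVec_mul_hessian hf, trace_vecMulVec_mul_hessian hf,
      fderiv_fderiv_comm hf _ d δ, smul_eq_mul]
    ring
  rw [← integral_const_mul (1 / 2 : ℝ)]
  simp only [hfin]
  rw [integral_add (hD δ d) (integrable_finsetSum _ hDs)]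
  ring

end SkewStein

/-! ### A differentiable local factorisation `S = A Aᵀ`. -/

section Factor

open Filter Topology

/-- Inverse function theorem for `x ↦ x²` at `1`, where the derivative is twice the identity even in
a noncommutative algebra. The left-inverse property expresses uniqueness of the root near `1`. -/
theorem exists_local_sqrt (R : Type*) [NormedRing R] [NormedAlgebra ℝ R] [CompleteSpace R] :
    ∃ φ : R → R, φ 1 = 1 ∧ HasFDerivAt φ ((1 / 2 : ℝ) • ContinuousLinearMap.id ℝ R) 1 ∧
      (∀ᶠ x in 𝓝 (1 : R), φ x * φ x = x) ∧ ∀ᶠ x in 𝓝 (1 : R), φ (x * x) = x := by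
  let e : R ≃L[ℝ] R := ContinuousLinearEquiv.smulLeft (Units.mk0 (2 : ℝ) two_ne_zero)
  have hs : HasStrictFDerivAt (fun x : R => x * x) (e : R →L[ℝ] R) 1 := by
    have h := (hasStrictFDerivAt_id (𝕜 := ℝ) (1 : R)).mul' (hasStrictFDerivAt_id (1 : R))
    refine h.congr_fderiv ?_
    ext x
    simp [e, Units.smul_def, two_smul]
  have he : (e.symm : R →L[ℝ] R) = (1 / 2 : ℝ) • ContinuousLinearMap.id ℝ R := by
    ext x
    have : e ((1 / 2 : ℝ) • x) = x := by simp [e, Units.smul_def, smul_smul]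
    simpa using (e.symm_apply_eq.2 this.symm)
  have h1 := hs.to_localInverse.hasFDerivAt
  have h2 := hs.localInverse_apply_image
  have h3 := hs.eventually_right_inverse
  simp only [mul_one] at h1 h2 h3
  exact ⟨_, h2, he ▸ h1, h3, hs.eventually_left_inverse⟩

variable {n : ℕ}

/-- Normalise to `E = A₀⁻¹ S A₀⁻ᵀ`, which equals `1` at `l₀`, and put `A = A₀ φ(E)` with the local
square root `φ`. Since `φ` has derivative one half at `1`, this yields the stated formula for `A'
A₀ᵀ`. -/
theorem exists_hasDerivAt_factor {S : ℝ → Matrix (Fin n) (Fin n) ℝ}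
    {S' A₀ : Matrix (Fin n) (Fin n) ℝ} {l₀ : ℝ} (hA₀ : A₀.det ≠ 0) (hS₀ : S l₀ = A₀ * A₀ᵀ)
    (hS : ∀ i j, HasDerivAt (fun l => S l i j) (S' i j) l₀) (hsymm : ∀ l, (S l)ᵀ = S l) :
    ∃ (A : ℝ → Matrix (Fin n) (Fin n) ℝ) (A' : Matrix (Fin n) (Fin n) ℝ), A l₀ = A₀ ∧
      (∀ i j, HasDerivAt (fun l => A l i j) (A' i j) l₀) ∧
      A' * A₀ᵀ = (1 / 2 : ℝ) • S' ∧ ∀ᶠ l in 𝓝 l₀, S l = A l * (A l)ᵀ := by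
  -- Any complete algebra norm serves; the conclusion is entrywise and does not mention it.
  let _ : NormedRing (Matrix (Fin n) (Fin n) ℝ) := Matrix.linftyOpNormedRing
  let _ : NormedAlgebra ℝ (Matrix (Fin n) (Fin n) ℝ) := Matrix.linftyOpNormedAlgebra
  have hu : IsUnit A₀.det := isUnit_iff_ne_zero.2 hA₀
  have huT : IsUnit A₀ᵀ.det := by rwa [Matrix.det_transpose]
  obtain ⟨φ, hφ1, hφ', hφr, hφl⟩ := exists_local_sqrt (Matrix (Fin n) (Fin n) ℝ)
  have hSm : HasDerivAt S S' l₀ := by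
    have hsum : ∀ M : Matrix (Fin n) (Fin n) ℝ, M = ∑ i, ∑ j, M i j • Matrix.single i j (1 : ℝ) :=
      fun M => by simpa using Matrix.matrix_eq_sum_single M
    rw [hsum S', show S = fun l => ∑ i, ∑ j, S l i j • Matrix.single i j (1 : ℝ) from
      funext fun l => hsum (S l)]
    exact HasDerivAt.fun_sum fun i _ => HasDerivAt.fun_sum fun j _ => (hS i j).smul_const _
  set E : ℝ → Matrix (Fin n) (Fin n) ℝ := fun l => A₀⁻¹ * S l * A₀ᵀ⁻¹ with hE
  have hE₀ : E l₀ = 1 := by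
    simp only [hE, hS₀]
    rw [← mul_assoc, Matrix.nonsing_inv_mul _ hu, one_mul, Matrix.mul_nonsing_inv _ huT]
  have hE' : HasDerivAt E (A₀⁻¹ * S' * A₀ᵀ⁻¹) l₀ := (hSm.const_mul A₀⁻¹).mul_const A₀ᵀ⁻¹
  have hEt : ∀ l, (E l)ᵀ = E l := fun l => by
    simp only [hE, Matrix.transpose_mul, hsymm, Matrix.transpose_nonsing_inv,
      Matrix.transpose_transpose, mul_assoc]
  have hφE : HasDerivAt (fun l => φ (E l)) ((1 / 2 : ℝ) • (A₀⁻¹ * S' * A₀ᵀ⁻¹)) l₀ := by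
    have := (hE₀ ▸ hφ' : HasFDerivAt φ _ (E l₀)).comp_hasDerivAt l₀ hE'
    simpa using! this
  have hA' := hφE.const_mul A₀
  have hcE : Tendsto E (𝓝 l₀) (𝓝 1) := hE₀ ▸ hE'.continuousAt.tendsto
  have hcφ : Tendsto (fun l => φ (E l)) (𝓝 l₀) (𝓝 1) := by
    have := hφE.continuousAt.tendsto
    rwa [hE₀, hφ1] at this
  have hcφT : Tendsto (fun l => (φ (E l))ᵀ) (𝓝 l₀) (𝓝 1) := by
    have h : Continuous fun M : Matrix (Fin n) (Fin n) ℝ => Mᵀ := continuous_id.matrix_transpose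
    simpa using! (h.tendsto 1).comp hcφ
  refine ⟨fun l => A₀ * φ (E l), A₀ * (1 / 2 : ℝ) • (A₀⁻¹ * S' * A₀ᵀ⁻¹),
    by simp only [hE₀, hφ1, mul_one], fun i j => ?_, ?_, ?_⟩
  rotate_left
  · rw [mul_smul_comm, smul_mul_assoc, ← mul_assoc, ← mul_assoc, Matrix.mul_nonsing_inv _ hu,
      one_mul, mul_assoc, Matrix.nonsing_inv_mul _ huT, mul_one]
  · filter_upwards [hcE.eventually hφr, hcφ.eventually hφl, hcφT.eventually hφl] with l h1 h2 h3
    -- The transpose is also a square root of the symmetric `E l` near `1`, so by local uniqueness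
    -- it is the same root.
    have h4 : (φ (E l))ᵀ = φ (E l) := by
      rw [← h3, ← Matrix.transpose_mul, h1, hEt]
    rw [Matrix.transpose_mul, h4, mul_assoc, ← mul_assoc (φ (E l)), h1]
    simp only [hE]
    rw [mul_assoc, mul_assoc, Matrix.nonsing_inv_mul _ huT, mul_one, ← mul_assoc,
      Matrix.mul_nonsing_inv _ hu, one_mul]
  · let L : Matrix (Fin n) (Fin n) ℝ →L[ℝ] ℝ :=
      LinearMap.toContinuousLinearMap (Matrix.entryLinearMap ℝ ℝ i j)
    exact L.hasFDerivAt.comp_hasDerivAt l₀ hA'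

end Factor

/-! ### Differentiation under the integral sign along the path. -/

section Derivative

open Filter Topology

variable {n : ℕ} {g : ℝ → ℝ} {f : EuclideanSpace ℝ (Fin n) → ℝ} {C : ℝ}

theorem skewMap_sub (μ μ' δ δ' : EuclideanSpace ℝ (Fin n)) (A A' : Matrix (Fin n) (Fin n) ℝ)
    (z : Fin (n + 1) → ℝ) :
    skewMap μ δ A z - skewMap μ' δ' A' z = skewMap (μ - μ') (δ - δ') (A - A') z := by
  simp only [skewMap, Matrix.sub_mulVec, WithLp.toLp_sub, smul_sub]
  abel

theorem norm_toLp_mulVec_le (A : Matrix (Fin n) (Fin n) ℝ) (y : Fin n → ℝ) :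
    ‖WithLp.toLp 2 (A *ᵥ y)‖ ≤ ∑ i, ∑ j, |A i j| * |y j| := by
  have h1 : WithLp.toLp 2 (A *ᵥ y) = ∑ i, (A *ᵥ y) i • EuclideanSpace.single i (1 : ℝ) :=
    euclidean_eq_sum_single _
  rw [h1]
  refine (norm_sum_le _ _).trans (Finset.sum_le_sum fun i _ => ?_)
  rw [norm_smul, PiLp.norm_single, norm_one, mul_one, Real.norm_eq_abs, Matrix.mulVec,
    dotProduct]
  exact (Finset.abs_sum_le_sum_abs _ _).trans (by simp only [abs_mul]; exact le_rfl)

theorem norm_skewMap_le (m d : EuclideanSpace ℝ (Fin n)) (A : Matrix (Fin n) (Fin n) ℝ)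
    (z : Fin (n + 1) → ℝ) :
    ‖skewMap m d A z‖ ≤ (‖m‖ + ‖d‖ + ∑ i, ∑ j, |A i j|) * (1 + ∑ j, z j ^ 2) := by
  have hρ : (1 : ℝ) ≤ 1 + ∑ j, z j ^ 2 := le_add_of_nonneg_right (sum_sq_nonneg z)
  have hz := HasSecondMoment.abs_coord_le z
  calc ‖skewMap m d A z‖ ≤ ‖m‖ + ‖z 0 • d‖ + ‖WithLp.toLp 2 (A *ᵥ Fin.tail z)‖ := norm_add₃_le
    _ ≤ ‖m‖ * (1 + ∑ j, z j ^ 2) + ‖d‖ * (1 + ∑ j, z j ^ 2) +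
        ∑ i, ∑ j, |A i j| * (1 + ∑ j, z j ^ 2) := by
        gcongr
        · exact le_mul_of_one_le_right (norm_nonneg _) hρ
        · rw [norm_smul, mul_comm, Real.norm_eq_abs]
          gcongr
          exact hz 0
        · refine (norm_toLp_mulVec_le _ _).trans ?_
          gcongr with i _ j _
          exact hz j.succ
    _ = _ := by simp only [add_mul, Finset.sum_mul]

theorem HasSecondMoment.integrable_halfLaw_one_add (H : HasSecondMoment n g) :
    Integrable (fun z : Fin (n + 1) → ℝ => 1 + ∑ j, z j ^ 2) (halfLaw n g) := by
  rw [integrable_halfLaw_iff H.gen]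
  refine (H.integrable_of_le (C := 1) (by fun_prop) fun z => ?_).integrableOn
  rw [one_mul, abs_of_nonneg (add_nonneg zero_le_one (sum_sq_nonneg z))]

/-- `f` is Lipschitz and the displacement of `skewMap` is at most `O(|l - l₀|) (1 + ‖z‖²)`, which
second moments make integrable. A Lipschitz bound relative to the single parameter `l₀` suffices, so
`A` needs differentiability only there. -/
theorem hasDerivAt_integral_skewMap (H : HasSecondMoment n g) (hf : ContDiff ℝ 2 f)
    (h0 : ∀ x, ‖f x‖ ≤ C) (h1 : ∀ x, ‖fderiv ℝ f x‖ ≤ C)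
    {μ δ : ℝ → EuclideanSpace ℝ (Fin n)} {A : ℝ → Matrix (Fin n) (Fin n) ℝ}
    {m d : EuclideanSpace ℝ (Fin n)} {A' : Matrix (Fin n) (Fin n) ℝ} {l₀ : ℝ}
    (hμ : HasDerivAt μ m l₀) (hδ : HasDerivAt δ d l₀)
    (hA : ∀ i j, HasDerivAt (fun l => A l i j) (A' i j) l₀) :
    HasDerivAt (fun l => ∫ z, f (skewMap (μ l) (δ l) (A l) z) ∂(halfLaw n g))
      (∫ z, fderiv ℝ f (skewMap (μ l₀) (δ l₀) (A l₀) z) (skewMap m d A' z) ∂(halfLaw n g)) l₀ := by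
  have := isProbabilityMeasure_halfLaw H.gen
  have hC : 0 ≤ C := (norm_nonneg _).trans (h0 0)
  -- `N` measures the parameter displacement independently of `z`, so one neighbourhood of `l₀`
  -- works for all `z`.
  let N : ℝ → ℝ := fun l => ‖μ l - μ l₀‖ + ‖δ l - δ l₀‖ + ∑ i, ∑ j, |A l i j - A l₀ i j|
  have hN : N =O[𝓝 l₀] fun l => l - l₀ := by
    refine (hμ.isBigO_sub.norm_left.add hδ.isBigO_sub.norm_left).add ?_
    exact Asymptotics.IsBigO.fun_sum fun i _ => Asymptotics.IsBigO.fun_sum fun j _ =>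
      (hA i j).isBigO_sub.norm_left
  obtain ⟨K, hK⟩ := hN.bound
  have hN0 : ∀ l, 0 ≤ N l := fun l => by positivity
  have hdiff : Differentiable ℝ f := hf.differentiable (by norm_num)
  have hlip : ∀ x y, ‖f x - f y‖ ≤ C * ‖x - y‖ := fun x y =>
    Convex.norm_image_sub_le_of_norm_fderiv_le (s := univ) (fun x _ => hdiff x)
      (fun x _ => h1 x) convex_univ trivial trivial
  have hT : ∀ z, HasDerivAt (fun l => skewMap (μ l) (δ l) (A l) z) (skewMap m d A' z) l₀ := by
    intro z
    refine (hμ.add (hδ.const_smul (z 0))).add ?_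
    have he : ∀ B : Matrix (Fin n) (Fin n) ℝ, WithLp.toLp 2 (B *ᵥ Fin.tail z) =
        ∑ i, (∑ j, B i j * z j.succ) • EuclideanSpace.single i (1 : ℝ) := fun B =>
      euclidean_eq_sum_single _
    simp only [he]
    exact HasDerivAt.fun_sum fun i _ => HasDerivAt.smul_const
      (HasDerivAt.fun_sum fun j _ => (hA i j).mul_const _) _
  have hc : ∀ l, Continuous fun z => f (skewMap (μ l) (δ l) (A l) z) := fun l =>
    hf.continuous.comp (continuous_skewMap _ _ _)
  have hF' : Continuous fun z => fderiv ℝ f (skewMap (μ l₀) (δ l₀) (A l₀) z) (skewMap m d A' z) :=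
    ((hf.continuous_fderiv (by norm_num)).comp (continuous_skewMap _ _ _)).clm_apply
      (continuous_skewMap _ _ _)
  have key := hasFDerivAt_integral_of_dominated_loc_of_lip' (𝕜 := ℝ) (μ := halfLaw n g)
    (F := fun l z => f (skewMap (μ l) (δ l) (A l) z)) (x₀ := l₀)
    (F' := fun z => ContinuousLinearMap.toSpanSingleton ℝ
      (fderiv ℝ f (skewMap (μ l₀) (δ l₀) (A l₀) z) (skewMap m d A' z)))
    (bound := fun z => C * K * (1 + ∑ j, z j ^ 2)) hK
    (fun l _ => (hc l).aestronglyMeasurable)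
    (Integrable.of_bound (hc l₀).aestronglyMeasurable C (.of_forall fun z => h0 _))
    ((ContinuousLinearMap.toSpanSingletonCLE (𝕜 := ℝ) (E := ℝ)).continuous.comp
      hF').aestronglyMeasurable
    (.of_forall fun z l hl => ?_) (H.integrable_halfLaw_one_add.const_mul _)
    (.of_forall fun z => ?_)
  · have h := key.2.hasDerivAt
    rw [ContinuousLinearMap.integral_apply key.1] at h
    simpa only [ContinuousLinearMap.toSpanSingleton_apply, one_smul] using h
  · have hl' : N l ≤ K * ‖l - l₀‖ := by
      have : ‖N l‖ ≤ K * ‖l - l₀‖ := hl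
      rwa [Real.norm_of_nonneg (hN0 l)] at this
    have hρ : (0 : ℝ) ≤ 1 + ∑ j, z j ^ 2 := add_nonneg zero_le_one (sum_sq_nonneg z)
    calc ‖f (skewMap (μ l) (δ l) (A l) z) - f (skewMap (μ l₀) (δ l₀) (A l₀) z)‖
        ≤ C * ‖skewMap (μ l) (δ l) (A l) z - skewMap (μ l₀) (δ l₀) (A l₀) z‖ := hlip _ _
      _ ≤ C * (N l * (1 + ∑ j, z j ^ 2)) := by
          rw [skewMap_sub]
          gcongr
          exact norm_skewMap_le _ _ _ z
      _ ≤ C * (K * ‖l - l₀‖ * (1 + ∑ j, z j ^ 2)) := by gcongr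
      _ = C * K * (1 + ∑ j, z j ^ 2) * ‖l - l₀‖ := by ring
  · exact ((hdiff _).hasFDerivAt.comp_hasDerivAt l₀ (hT z)).hasFDerivAt

end Derivative

/-! ### Densities and uniform moment bounds along the path. -/

section Interpolation

variable {n : ℕ} {g : ℝ → ℝ} {μx μy δx δy : EuclideanSpace ℝ (Fin n)}
  {Ωx Ωy : Matrix (Fin n) (Fin n) ℝ}

theorem continuous_interp {V : Type*} [AddCommGroup V] [Module ℝ V] [TopologicalSpace V]
    [ContinuousAdd V] [ContinuousSMul ℝ V] (a b : V) : Continuous (interp a b) := by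
  unfold interp
  fun_prop

theorem interp_apply_apply (l : ℝ) (i j : Fin n) :
    interp Ωx Ωy l i j = interp (Ωx i j) (Ωy i j) l := by
  simp [interp]

theorem hasDerivAt_interp {V : Type*} [NormedAddCommGroup V] [NormedSpace ℝ V] (a b : V) (l : ℝ) :
    HasDerivAt (interp a b) (b - a) l := by
  have := ((hasDerivAt_id l).smul_const b).add (((hasDerivAt_id l).const_sub 1).smul_const a)
  simpa [sub_eq_add_neg] using! this

section JointMeasurability

variable (μx μy δx δy Ωx Ωy)

theorem measurable_interp_fst {Λ : Type*} [MeasurableSpace Λ] (a b : EuclideanSpace ℝ (Fin n)) :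
    Measurable fun p : ℝ × Λ => interp a b p.1 :=
  (continuous_interp a b).measurable.comp measurable_fst

theorem measurable_interp_matrix_fst {Λ : Type*} [MeasurableSpace Λ] (i j : Fin n) :
    Measurable fun p : ℝ × Λ => interp Ωx Ωy p.1 i j := by
  simp only [interp_apply_apply]
  exact (continuous_interp _ _).measurable.comp measurable_fst

theorem measurable_skewEllipticalPDF_interp {h : ℝ → ℝ} (hm : Measurable h) :
    Measurable fun p : ℝ × EuclideanSpace ℝ (Fin n) =>
      skewEllipticalPDF (interp μx μy p.1) (interp Ωx Ωy p.1)
        (slant (interp Ωx Ωy p.1) (interp δx δy p.1)) h p.2 := by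
  have hα : Measurable fun p : ℝ × EuclideanSpace ℝ (Fin n) =>
      slant (interp Ωx Ωy p.1) (interp δx δy p.1) :=
    measurable_slant (Ω := fun p : ℝ × EuclideanSpace ℝ (Fin n) => interp Ωx Ωy p.1)
      (measurable_interp_matrix_fst Ωx Ωy) (measurable_interp_fst δx δy)
  exact measurable_skewEllipticalPDF
    (Ω := fun p : ℝ × EuclideanSpace ℝ (Fin n) => interp Ωx Ωy p.1)
    (measurable_interp_fst μx μy) (measurable_interp_matrix_fst Ωx Ωy) hα measurable_snd hm

theorem measurable_phi (hm : Measurable g) :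
    Measurable fun p : ℝ × EuclideanSpace ℝ (Fin n) => phi g μx μy δx δy Ωx Ωy p.1 p.2 :=
  measurable_skewEllipticalPDF_interp μx μy δx δy Ωx Ωy hm

theorem measurable_phi₂ (hm : Measurable g) :
    Measurable fun p : ℝ × EuclideanSpace ℝ (Fin n) => phi₂ g μx μy δx δy Ωx Ωy p.1 p.2 :=
  measurable_skewEllipticalPDF_interp μx μy δx δy Ωx Ωy (hm.tailIntegral.const_mul _)

theorem measurable_phi₁ (hm : Measurable g) :
    Measurable fun p : ℝ × EuclideanSpace ℝ (Fin n) => phi₁ g μx μy δx δy Ωx Ωy p.1 p.2 := by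
  refine measurable_ellipticalPDF (Ω := fun p : ℝ × EuclideanSpace ℝ (Fin n) =>
    interp Ωx Ωy p.1 - Matrix.vecMulVec (interp δx δy p.1).ofLp (interp δx δy p.1).ofLp)
    (measurable_interp_fst μx μy) (fun i j => ?_) measurable_snd (hm.tailIntegral.div_const _)
  have h1 := measurable_interp_fst (Λ := EuclideanSpace ℝ (Fin n)) δx δy
  have h2 : ∀ k, Measurable fun p : ℝ × EuclideanSpace ℝ (Fin n) => (interp δx δy p.1).ofLp k :=
    fun k => by fun_prop
  exact (measurable_interp_matrix_fst Ωx Ωy i j).sub ((h2 i).mul (h2 j))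

end JointMeasurability

theorem integrable_mul_skewEllipticalPDF_iff {h : ℝ → ℝ} (H : IsDensityGenerator (n + 1) h)
    {Ω A : Matrix (Fin n) (Fin n) ℝ} {μ δ : EuclideanSpace ℝ (Fin n)} (hA : A.det ≠ 0)
    (hΩ : Ω - Matrix.vecMulVec δ.ofLp δ.ofLp = A * Aᵀ)
    {F : EuclideanSpace ℝ (Fin n) → ℝ} (hF : Measurable F) :
    Integrable (fun x => F x * skewEllipticalPDF μ Ω (slant Ω δ) h x) ↔
      Integrable (fun z => F (skewMap μ δ A z)) (halfLaw n h) := by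
  have hp := isProbDensity_skewEllipticalPDF H (μ := μ) hA hΩ
  rw [← Function.comp_def F, ← integrable_map_measure hF.aestronglyMeasurable
    (continuous_skewMap μ δ A).measurable.aemeasurable,
    ← withDensity_skewEllipticalPDF H hA hΩ, skewEllipticalLaw,
    integrable_withDensity_iff hp.measurable.ennreal_ofReal
      (.of_forall fun _ => ENNReal.ofReal_lt_top)]
  exact integrable_congr (.of_forall fun x => by
    dsimp only; rw [ENNReal.toReal_ofReal (hp.nonneg x)])

/-- The interpolated scale matrix `Ω_λ - δ_λ δ_λ'`. -/
noncomputable def interpScale (δx δy : EuclideanSpace ℝ (Fin n)) (Ωx Ωy : Matrix (Fin n) (Fin n) ℝ)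
    (l : ℝ) : Matrix (Fin n) (Fin n) ℝ :=
  interp Ωx Ωy l - Matrix.vecMulVec (interp δx δy l).ofLp (interp δx δy l).ofLp

/-- The `i`-th row of `A` has squared length `S i i`. The bound therefore holds for every factor of
`S`, and the factors chosen for different `λ` need not depend on `λ` in any regular way. -/
theorem abs_apply_le_of_mul_transpose {A S : Matrix (Fin n) (Fin n) ℝ} (hS : S = A * Aᵀ)
    (i j : Fin n) : |A i j| ≤ 1 + |S i i| := by
  have h1 : A i j ^ 2 ≤ S i i := by
    rw [hS, Matrix.mul_apply]
    simp only [Matrix.transpose_apply, ← sq]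
    exact Finset.single_le_sum (f := fun k => A i k ^ 2) (fun k _ => sq_nonneg _)
      (Finset.mem_univ j)
  have h2 := h1.trans (le_abs_self _)
  nlinarith [sq_abs (A i j), sq_nonneg (|A i j| - 1)]

theorem exists_bound_interp (μx μy δx δy : EuclideanSpace ℝ (Fin n))
    (Ωx Ωy : Matrix (Fin n) (Fin n) ℝ) :
    ∃ K : ℝ, 0 ≤ K ∧ ∀ l ∈ Icc (0 : ℝ) 1, ∀ A : Matrix (Fin n) (Fin n) ℝ,
      interpScale δx δy Ωx Ωy l = A * Aᵀ →
      ‖interp μx μy l‖ + ‖interp δx δy l‖ + ∑ i, ∑ j, |A i j| ≤ K := by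
  have hc : Continuous fun l : ℝ => ‖interp μx μy l‖ + ‖interp δx δy l‖ +
      ∑ i : Fin n, ∑ _j : Fin n, (1 + |interpScale δx δy Ωx Ωy l i i|) := by
    have h1 := continuous_interp μx μy
    have h2 := continuous_interp δx δy
    have h3 : ∀ i j, Continuous fun l => interpScale δx δy Ωx Ωy l i j := fun i j => by
      simp only [interpScale, Matrix.sub_apply, interp_apply_apply, Matrix.vecMulVec_apply]
      have := continuous_interp (Ωx i j) (Ωy i j)
      fun_prop
    fun_prop
  obtain ⟨K, hK⟩ := (isCompact_Icc (a := (0 : ℝ)) (b := 1)).exists_bound_of_continuousOn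
    hc.continuousOn
  refine ⟨K, (norm_nonneg _).trans (hK 0 (by simp)), fun l hl A hA => ?_⟩
  refine le_trans ?_ ((le_abs_self _).trans (hK l hl))
  gcongr with i _ j _
  exact abs_apply_le_of_mul_transpose hA i j

/-- Fubini's criterion: absolute integrals bounded uniformly over a parameter set of finite measure.
-/
theorem integrable_prod_of_integral_le {p : ℝ → EuclideanSpace ℝ (Fin n) → ℝ}
    (hp : Measurable fun q : ℝ × EuclideanSpace ℝ (Fin n) => p q.1 q.2)
    {F : EuclideanSpace ℝ (Fin n) → ℝ} (hF : Measurable F) {B : ℝ}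
    (hi : ∀ l ∈ Icc (0 : ℝ) 1, Integrable fun x => F x * p l x)
    (hB : ∀ l ∈ Icc (0 : ℝ) 1, ∫ x, |F x * p l x| ≤ B) :
    Integrable (fun q : ℝ × EuclideanSpace ℝ (Fin n) => F q.2 * p q.1 q.2)
      ((volume.restrict (Icc 0 1)).prod volume) := by
  have hm : Measurable fun q : ℝ × EuclideanSpace ℝ (Fin n) => F q.2 * p q.1 q.2 :=
    (hF.comp measurable_snd).mul hp
  rw [integrable_prod_iff hm.aestronglyMeasurable]
  refine ⟨(ae_restrict_mem measurableSet_Icc).mono hi, ?_⟩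
  refine Integrable.of_bound hm.norm.aestronglyMeasurable.integral_prod_right' B ?_
  filter_upwards [ae_restrict_mem measurableSet_Icc] with l hl
  rw [Real.norm_of_nonneg (integral_nonneg fun _ => norm_nonneg _)]
  exact hB l hl

variable (H : HasSecondMoment n g)
  (hx : (Ωx - Matrix.vecMulVec δx.ofLp δx.ofLp).PosDef)
  (hy : (Ωy - Matrix.vecMulVec δy.ofLp δy.ofLp).PosDef)

include hx hy

theorem exists_factor_interpScale {l : ℝ} (hl : l ∈ Icc (0 : ℝ) 1) :
    ∃ A : Matrix (Fin n) (Fin n) ℝ, A.det ≠ 0 ∧ interpScale δx δy Ωx Ωy l = A * Aᵀ := by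
  obtain ⟨A, hA, h⟩ := exists_factor_of_posDef (posDef_interp_sub hx hy hl)
  exact ⟨A, hA, h.symm⟩

include H

theorem isProbDensity_phi {l : ℝ} (hl : l ∈ Icc (0 : ℝ) 1) :
    IsProbDensity (phi g μx μy δx δy Ωx Ωy l) := by
  obtain ⟨A, hA, hS⟩ := exists_factor_interpScale hx hy hl
  exact isProbDensity_skewEllipticalPDF H.gen hA hS

theorem isProbDensity_phi₁ {l : ℝ} (hl : l ∈ Icc (0 : ℝ) 1) :
    IsProbDensity (phi₁ g μx μy δx δy Ωx Ωy l) := by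
  obtain ⟨A, hA, hS⟩ := exists_factor_interpScale hx hy hl
  exact isProbDensity_ellipticalPDF_tail H hA hS _

theorem isProbDensity_phi₂ (hn : 1 ≤ n) {l : ℝ} (hl : l ∈ Icc (0 : ℝ) 1) :
    IsProbDensity (phi₂ g μx μy δx δy Ωx Ωy l) := by
  obtain ⟨A, hA, hS⟩ := exists_factor_interpScale hx hy hl
  exact isProbDensity_skewEllipticalPDF (H.isDensityGenerator_tail hn) hA hS

theorem moment_phi {l : ℝ} (hl : l ∈ Icc (0 : ℝ) 1) {F : EuclideanSpace ℝ (Fin n) → ℝ}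
    (hF : Measurable F) {C K : ℝ} (hC : 0 ≤ C) (hFC : ∀ x, |F x| ≤ C * (1 + ‖x‖))
    (hK : ∀ A : Matrix (Fin n) (Fin n) ℝ, interpScale δx δy Ωx Ωy l = A * Aᵀ →
      ‖interp μx μy l‖ + ‖interp δx δy l‖ + ∑ i, ∑ j, |A i j| ≤ K) :
    Integrable (fun x => F x * phi g μx μy δx δy Ωx Ωy l x) ∧
    ∫ x, |F x * phi g μx μy δx δy Ωx Ωy l x| ≤
      ∫ z, C * (1 + K * (1 + ∑ j, z j ^ 2)) ∂(halfLaw n g) := by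
  obtain ⟨A, hA, hS⟩ := exists_factor_interpScale hx hy hl
  have := isProbabilityMeasure_halfLaw H.gen
  have hbi : Integrable (fun z : Fin (n + 1) → ℝ => C * (1 + K * (1 + ∑ j, z j ^ 2)))
      (halfLaw n g) :=
    ((integrable_const 1).add (H.integrable_halfLaw_one_add.const_mul K)).const_mul C
  have hb : ∀ z, |F (skewMap (interp μx μy l) (interp δx δy l) A z)| ≤
      C * (1 + K * (1 + ∑ j, z j ^ 2)) := fun z => by
    refine (hFC _).trans ?_
    have h1 := norm_skewMap_le (interp μx μy l) (interp δx δy l) A z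
    have h2 : (0 : ℝ) ≤ 1 + ∑ j, z j ^ 2 := add_nonneg zero_le_one (sum_sq_nonneg z)
    gcongr
    exact h1.trans (by gcongr; exact hK A hS)
  have hTm : Measurable fun z => F (skewMap (interp μx μy l) (interp δx δy l) A z) :=
    hF.comp (continuous_skewMap _ _ _).measurable
  have hTi : Integrable (fun z => F (skewMap (interp μx μy l) (interp δx δy l) A z))
      (halfLaw n g) := hbi.mono' hTm.aestronglyMeasurable (.of_forall hb)
  refine ⟨(integrable_mul_skewEllipticalPDF_iff H.gen hA hS hF).2 hTi, ?_⟩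
  have h3 : ∀ x, |F x * phi g μx μy δx δy Ωx Ωy l x| =
      |F x| * phi g μx μy δx δy Ωx Ωy l x := fun x => by
    rw [abs_mul, abs_of_nonneg ((isProbDensity_phi H hx hy hl).nonneg x)]
  simp only [h3]
  rw [phi, integral_mul_skewEllipticalPDF H.gen hA hS hF.abs]
  exact integral_mono hTi.abs hbi hb

theorem integrable_prod_phi {F : EuclideanSpace ℝ (Fin n) → ℝ}
    (hF : Measurable F) {C : ℝ} (hC : 0 ≤ C) (hFC : ∀ x, |F x| ≤ C * (1 + ‖x‖)) :
    Integrable (fun q : ℝ × EuclideanSpace ℝ (Fin n) =>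
      F q.2 * phi g μx μy δx δy Ωx Ωy q.1 q.2) ((volume.restrict (Icc 0 1)).prod volume) := by
  obtain ⟨K, -, hK⟩ := exists_bound_interp μx μy δx δy Ωx Ωy
  exact integrable_prod_of_integral_le (measurable_phi μx μy δx δy Ωx Ωy H.gen.measurable) hF
    (fun l hl => (moment_phi H hx hy hl hF hC hFC (hK l hl)).1)
    (fun l hl => (moment_phi H hx hy hl hF hC hFC (hK l hl)).2)

/-- Only bounded `F` are admitted: with just second moments for `g`, the density `φ_{2,λ}` may fail
to have a first moment. -/
theorem integrable_prod_phi₂ (hn : 1 ≤ n) {F : EuclideanSpace ℝ (Fin n) → ℝ}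
    (hF : Measurable F) {C : ℝ} (hFC : ∀ x, |F x| ≤ C) :
    Integrable (fun q : ℝ × EuclideanSpace ℝ (Fin n) =>
      F q.2 * phi₂ g μx μy δx δy Ωx Ωy q.1 q.2) ((volume.restrict (Icc 0 1)).prod volume) := by
  have hint : ∀ l ∈ Icc (0 : ℝ) 1, Integrable (phi₂ g μx μy δx δy Ωx Ωy l) := fun l hl => by
    by_contra hc
    have := (isProbDensity_phi₂ (μx := μx) (μy := μy) H hx hy hn hl).integral_eq_one
    rw [integral_undef hc] at this
    exact zero_ne_one this
  have hi : ∀ l ∈ Icc (0 : ℝ) 1, Integrable fun x => F x * phi₂ g μx μy δx δy Ωx Ωy l x :=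
    fun l hl => (hint l hl).bdd_mul hF.aestronglyMeasurable (.of_forall hFC)
  refine integrable_prod_of_integral_le (B := C)
    (measurable_phi₂ μx μy δx δy Ωx Ωy H.gen.measurable) hF hi fun l hl => ?_
  have hp := isProbDensity_phi₂ (μx := μx) (μy := μy) H hx hy hn hl
  calc ∫ x, |F x * phi₂ g μx μy δx δy Ωx Ωy l x|
      ≤ ∫ x, C * phi₂ g μx μy δx δy Ωx Ωy l x := by
        refine integral_mono (hi l hl).abs ((hint l hl).const_mul C) fun x => ?_
        simp only [abs_mul, abs_of_nonneg (hp.nonneg x)]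
        exact mul_le_mul_of_nonneg_right (hFC x) (hp.nonneg x)
    _ = C := by rw [integral_const_mul, hp.integral_eq_one, mul_one]

/-- Linear growth is allowed because a first moment of the tail on `ℝⁿ` is, by `integral_mul_tail`,
a mixed moment `|z 0| |z j|` of `g` on `ℝⁿ⁺¹`, which second moments control. -/
theorem integrable_prod_phi₁ {F : EuclideanSpace ℝ (Fin n) → ℝ}
    (hF : Measurable F) {C : ℝ} (hC : 0 ≤ C) (hFC : ∀ x, |F x| ≤ C * (1 + ‖x‖)) :
    Integrable (fun q : ℝ × EuclideanSpace ℝ (Fin n) =>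
      F q.2 * phi₁ g μx μy δx δy Ωx Ωy q.1 q.2) ((volume.restrict (Icc 0 1)).prod volume) := by
  obtain ⟨K, hK0, hK⟩ := exists_bound_interp μx μy δx δy Ωx Ωy
  have hmU := H.meanAbsU_pos
  -- A majorant of `|F (μ_λ + A y)|` valid for all `λ` and all factors `A` at once; it is linear in
  -- `|y|`, since a quadratic one would demand third moments.
  let w : (Fin n → ℝ) → ℝ := fun y => C * (1 + K * (1 + ∑ j, |y j|))
  have hwi : Integrable fun y : Fin n → ℝ => w y * (tailIntegral g (∑ j, y j ^ 2) / meanAbsU n g) := by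
    have h1 : Integrable fun z : Fin (n + 1) → ℝ => z 0 * w (Fin.tail z) * g (∑ j, z j ^ 2) := by
      refine H.integrable_of_le (C := C * (1 + K * (1 + n))) ?_ fun z => ?_
      · simp only [w, Fin.tail]
        fun_prop
      · have hρ := sum_sq_nonneg z
        have h0 := HasSecondMoment.abs_coord_le z 0
        have hprod : ∀ j : Fin n, |z 0| * |z j.succ| ≤ 1 + ∑ j, z j ^ 2 := fun j => by
          have ha : z 0 ^ 2 ≤ ∑ j, z j ^ 2 :=
            Finset.single_le_sum (f := fun j => z j ^ 2) (fun j _ => sq_nonneg _)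
              (Finset.mem_univ _)
          have hb : z j.succ ^ 2 ≤ ∑ j, z j ^ 2 :=
            Finset.single_le_sum (f := fun j => z j ^ 2) (fun j _ => sq_nonneg _)
              (Finset.mem_univ _)
          nlinarith [sq_nonneg (|z 0| - |z j.succ|), sq_abs (z 0), sq_abs (z j.succ)]
        have hs : |z 0| * ∑ j : Fin n, |z j.succ| ≤ n * (1 + ∑ j, z j ^ 2) := by
          rw [Finset.mul_sum]
          refine (Finset.sum_le_sum fun j _ => hprod j).trans ?_
          simp [mul_add]
        have hw0 : 0 ≤ w (Fin.tail z) := by positivity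
        rw [abs_mul, abs_of_nonneg hw0]
        simp only [w, Fin.tail]
        calc |z 0| * (C * (1 + K * (1 + ∑ j : Fin n, |z j.succ|)))
            = C * (|z 0| + K * (|z 0| + |z 0| * ∑ j : Fin n, |z j.succ|)) := by ring
          _ ≤ C * ((1 + ∑ j, z j ^ 2) + K * ((1 + ∑ j, z j ^ 2) + n * (1 + ∑ j, z j ^ 2))) := by
              gcongr
          _ = _ := by ring
    have := (integral_mul_tail (w := w) h1).1.div_const (meanAbsU n g)
    simpa only [mul_div_assoc] using this
  have hTn : ∀ y : Fin n → ℝ, 0 ≤ tailIntegral g (∑ j, y j ^ 2) / meanAbsU n g := fun y =>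
    div_nonneg (tailIntegral_nonneg H.gen.nonneg (sum_sq_nonneg y)) hmU.le
  have key : ∀ l ∈ Icc (0 : ℝ) 1, Integrable (fun x => F x * phi₁ g μx μy δx δy Ωx Ωy l x) ∧
      ∫ x, |F x * phi₁ g μx μy δx δy Ωx Ωy l x| ≤
        ∫ y, w y * (tailIntegral g (∑ j, y j ^ 2) / meanAbsU n g) := fun l hl => by
    obtain ⟨A, hA, hS⟩ := exists_factor_interpScale hx hy hl
    have hb : ∀ y : Fin n → ℝ, |F (interp μx μy l + WithLp.toLp 2 (A *ᵥ y))| ≤ w y := fun y => by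
      refine (hFC _).trans ?_
      have h3 := hK l hl A hS
      have h4 : 0 ≤ ∑ i, ∑ j, |A i j| := Finset.sum_nonneg fun i _ =>
        Finset.sum_nonneg fun j _ => abs_nonneg _
      have h5 : ‖interp μx μy l‖ ≤ K := by linarith [norm_nonneg (interp δx δy l)]
      have h6 : ∑ i, ∑ j, |A i j| ≤ K := by
        linarith [norm_nonneg (interp δx δy l), norm_nonneg (interp μx μy l)]
      have h7 : ∑ i, ∑ j, |A i j| * |y j| ≤ (∑ i, ∑ j, |A i j|) * ∑ j, |y j| := by
        simp only [Finset.sum_mul]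
        gcongr with i _ j hj
        exact Finset.single_le_sum (f := fun j => |y j|) (fun j _ => abs_nonneg _) hj
      have h8 : 0 ≤ ∑ j, |y j| := Finset.sum_nonneg fun j _ => abs_nonneg _
      simp only [w]
      gcongr
      calc ‖interp μx μy l + WithLp.toLp 2 (A *ᵥ y)‖
          ≤ ‖interp μx μy l‖ + ‖WithLp.toLp 2 (A *ᵥ y)‖ := norm_add_le _ _
        _ ≤ K + K * ∑ j, |y j| := by
            gcongr
            exact ((norm_toLp_mulVec_le A y).trans h7).trans (by gcongr)
        _ = K * (1 + ∑ j, |y j|) := by ring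
    have hTm : Measurable fun y : Fin n → ℝ => F (interp μx μy l + WithLp.toLp 2 (A *ᵥ y)) *
        (tailIntegral g (∑ j, y j ^ 2) / meanAbsU n g) :=
      (hF.comp (affineEquiv _ A hA).measurable).mul
        ((measurable_tailIntegral_sum_sq H.gen.measurable).div_const _)
    have hTb : ∀ y : Fin n → ℝ, |F (interp μx μy l + WithLp.toLp 2 (A *ᵥ y))| *
        (tailIntegral g (∑ j, y j ^ 2) / meanAbsU n g) ≤
        w y * (tailIntegral g (∑ j, y j ^ 2) / meanAbsU n g) := fun y =>
      mul_le_mul_of_nonneg_right (hb y) (hTn y)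
    have hTi : Integrable fun y : Fin n → ℝ => F (interp μx μy l + WithLp.toLp 2 (A *ᵥ y)) *
        (tailIntegral g (∑ j, y j ^ 2) / meanAbsU n g) := by
      refine hwi.mono' hTm.aestronglyMeasurable (.of_forall fun y => ?_)
      rw [norm_mul, Real.norm_of_nonneg (hTn y)]
      exact hTb y
    refine ⟨(integrable_mul_ellipticalPDF_iff hA hS _ F).2 hTi, ?_⟩
    have h3 : ∀ x, |F x * phi₁ g μx μy δx δy Ωx Ωy l x| =
        |F x| * phi₁ g μx μy δx δy Ωx Ωy l x := fun x => by
      rw [abs_mul, abs_of_nonneg ((isProbDensity_phi₁ H hx hy hl).nonneg x)]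
    simp only [h3]
    have h4 := integral_mul_ellipticalPDF (h := fun u => tailIntegral g u / meanAbsU n g)
      hA hS (interp μx μy l) fun x => |F x|
    refine h4.trans_le (integral_mono ?_ hwi hTb)
    refine hTi.abs.congr (.of_forall fun y => ?_)
    simp only [abs_mul, abs_of_nonneg (hTn y)]
  exact integrable_prod_of_integral_le (measurable_phi₁ μx μy δx δy Ωx Ωy H.gen.measurable) hF
    (fun l hl => (key l hl).1) (fun l hl => (key l hl).2)

end Interpolation

/-! ### The formula for bounded and for compactly supported `f`. -/

theorem exists_bound_fderiv_fderiv_of_hasCompactSupport {E : Type*} [NormedAddCommGroup E]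
    [NormedSpace ℝ E] {f : E → ℝ} (hf : ContDiff ℝ 2 f) (hs : HasCompactSupport f) :
    ∃ C, ∀ x, ‖fderiv ℝ (fderiv ℝ f) x‖ ≤ C :=
  ((hf.fderiv_right (m := 1) (by norm_num)).continuous_fderiv
    (by norm_num)).bounded_above_of_compact_support ((hs.fderiv (𝕜 := ℝ)).fderiv (𝕜 := ℝ))

section CompactSupport

open Filter Topology

variable {n : ℕ} {g : ℝ → ℝ} {μx μy δx δy : EuclideanSpace ℝ (Fin n)}
  {Ωx Ωy : Matrix (Fin n) (Fin n) ℝ} {f : EuclideanSpace ℝ (Fin n) → ℝ} {C : ℝ}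

theorem transpose_interpScale (hx : Ωxᵀ = Ωx) (hy : Ωyᵀ = Ωy) (l : ℝ) :
    (interpScale δx δy Ωx Ωy l)ᵀ = interpScale δx δy Ωx Ωy l := by
  rw [interpScale, Matrix.transpose_sub, Matrix.transpose_vecMulVec, interp,
    Matrix.transpose_add, Matrix.transpose_smul, Matrix.transpose_smul, hx, hy]

theorem hasDerivAt_interpScale (l : ℝ) (i j : Fin n) :
    HasDerivAt (fun l => interpScale δx δy Ωx Ωy l i j)
      (((Ωy - Ωx) - Matrix.vecMulVec (δy - δx).ofLp (interp δx δy l).ofLp -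
        Matrix.vecMulVec (interp δx δy l).ofLp (δy - δx).ofLp) i j) l := by
  have hd : ∀ k, HasDerivAt (fun l => (interp δx δy l).ofLp k) ((δy - δx).ofLp k) l := fun k =>
    (EuclideanSpace.proj (𝕜 := ℝ) k).hasFDerivAt.comp_hasDerivAt l (hasDerivAt_interp δx δy l)
  have := (hasDerivAt_interp (Ωx i j) (Ωy i j) l).sub ((hd i).mul (hd j))
  simp only [interpScale, Matrix.sub_apply, interp_apply_apply, Matrix.vecMulVec_apply]
  convert! this using 1
  ring

variable (H : HasSecondMoment n g)
  (hx : (Ωx - Matrix.vecMulVec δx.ofLp δx.ofLp).PosDef)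
  (hy : (Ωy - Matrix.vecMulVec δy.ofLp δy.ofLp).PosDef)

include H hx hy

/-- Near `l` the integral is an expectation over `halfLaw` with a differentiable factor `A`; it is
differentiated there and Stein's identity is applied. The three resulting integrals translate back
into `φ`, `φ₁` and `φ₂`. -/
theorem hasDerivAt_integral_phi (hn : 1 ≤ n) (hf : ContDiff ℝ 2 f) (h0 : ∀ x, ‖f x‖ ≤ C)
    (h1 : ∀ x, ‖fderiv ℝ f x‖ ≤ C) (h2 : ∀ x, ‖fderiv ℝ (fderiv ℝ f) x‖ ≤ C)
    {l : ℝ} (hl : l ∈ Icc (0 : ℝ) 1) :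
    HasDerivAt (fun l => ∫ x, f x * phi g μx μy δx δy Ωx Ωy l x)
      ((∫ x, inner ℝ (μy - μx) (gradient f x) * phi g μx μy δx δy Ωx Ωy l x)
      + meanAbsU n g * (∫ x, inner ℝ (δy - δx) (gradient f x) * phi₁ g μx μy δx δy Ωx Ωy l x)
      + meanSqR n g / (2 * n) * (∫ x, ((Ωy - Ωx) * hessianMatrix f x).trace *
          phi₂ g μx μy δx δy Ωx Ωy l x)) l := by
  obtain ⟨A₀, hA₀, hS₀⟩ := exists_factor_interpScale hx hy hl
  have hsym : ∀ {M : Matrix (Fin n) (Fin n) ℝ} {d : Fin n → ℝ},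
      (M - Matrix.vecMulVec d d).PosDef → Mᵀ = M := fun {M d} h => by
    have := (posDef_iff_quadForm.1 h).1
    rwa [Matrix.transpose_sub, Matrix.transpose_vecMulVec, sub_left_inj] at this
  obtain ⟨A, A', hAl, hA, hA', hev⟩ := exists_hasDerivAt_factor hA₀ hS₀
    (hasDerivAt_interpScale l) (transpose_interpScale (hsym hx) (hsym hy))
  have hder := hasDerivAt_integral_skewMap H hf h0 h1 (hasDerivAt_interp μx μy l)
    (hasDerivAt_interp δx δy l) hA
  have hdet : ∀ᶠ r in 𝓝 l, (A r).det ≠ 0 := by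
    have hc : ContinuousAt (fun r => (A r).det) l := by
      have := fun i j => (hA i j).continuousAt
      simp only [Matrix.det_apply']
      fun_prop
    exact hc.eventually_ne (hAl ▸ hA₀)
  -- The factorisation and its invertibility persist on a full neighbourhood of `l`, so the
  -- derivative is two-sided even at the end points `0` and `1`.
  have heq : (fun l => ∫ x, f x * phi g μx μy δx δy Ωx Ωy l x) =ᶠ[𝓝 l] fun r =>
      ∫ z, f (skewMap (interp μx μy r) (interp δx δy r) (A r) z) ∂(halfLaw n g) := by
    filter_upwards [hev, hdet] with r h3 h4
    exact integral_mul_skewEllipticalPDF H.gen h4 h3 hf.continuous.measurable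
  refine (hder.congr_of_eventuallyEq heq).congr_deriv ?_
  have hmU := H.meanAbsU_pos
  have hT := H.integral_tail_pos
  have hn' : (n : ℝ) ≠ 0 := by positivity
  rw [hAl, integral_fderiv_skewMap _ _ A₀ hf h1 h2 H (μy - μx) (δy - δx) A' hA']
  simp only [inner_gradient_eq]
  have hcg : ∀ w, Measurable fun x => fderiv ℝ f x w := fun w =>
    ((hf.continuous_fderiv (by norm_num)).clm_apply continuous_const).measurable
  congr 1
  · congr 1
    · exact (integral_mul_skewEllipticalPDF H.gen hA₀ hS₀ (hcg _)).symm
    · have h3 := integral_mul_ellipticalPDF (h := fun u => tailIntegral g u / meanAbsU n g)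
        hA₀ hS₀ (interp μx μy l) fun x => fderiv ℝ f x (δy - δx)
      have h4 : ∫ x, fderiv ℝ f x (δy - δx) * phi₁ g μx μy δx δy Ωx Ωy l x = _ := h3
      rw [h4, ← integral_const_mul]
      exact integral_congr_ae (.of_forall fun y => by field_simp)
  -- The constants match since `E(R²)/(2n) · n/(2E(R²)) = 1/4`, and the factor `2` in `halfLaw`
  -- makes this the `1/2` of Stein's identity.
  · have h3 := integral_mul_skewEllipticalPDF (H.isDensityGenerator_tail hn)
      (μ := interp μx μy l) hA₀ hS₀ (continuous_trace_mul_hessian hf (Ωy - Ωx)).measurable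
    have h4 : ∫ x, ((Ωy - Ωx) * hessianMatrix f x).trace * phi₂ g μx μy δx δy Ωx Ωy l x = _ := h3
    rw [h4, integral_halfLaw (H.isDensityGenerator_tail hn), ← integral_const_mul,
      ← integral_const_mul, ← integral_const_mul]
    refine integral_congr_ae (.of_forall fun z => ?_)
    have hR : meanSqR n g ≠ 0 := by
      rw [H.meanSqR_eq]
      positivity
    dsimp only
    field_simp

theorem integral_phi_sub_of_bounded (hn : 1 ≤ n) (hf : ContDiff ℝ 2 f) (h0 : ∀ x, ‖f x‖ ≤ C)
    (h1 : ∀ x, ‖fderiv ℝ f x‖ ≤ C) (h2 : ∀ x, ‖fderiv ℝ (fderiv ℝ f) x‖ ≤ C) {B : ℝ}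
    (hB : ∀ x, |((Ωy - Ωx) * hessianMatrix f x).trace| ≤ B) :
    (∫ x, f x * phi g μx μy δx δy Ωx Ωy 1 x) - ∫ x, f x * phi g μx μy δx δy Ωx Ωy 0 x =
      (∫ l in (0 : ℝ)..1, ∫ x, inner ℝ (μy - μx) (gradient f x) * phi g μx μy δx δy Ωx Ωy l x)
      + meanAbsU n g * (∫ l in (0 : ℝ)..1, ∫ x,
        inner ℝ (δy - δx) (gradient f x) * phi₁ g μx μy δx δy Ωx Ωy l x)
      + meanSqR n g / (2 * n) * (∫ l in (0 : ℝ)..1, ∫ x,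
        ((Ωy - Ωx) * hessianMatrix f x).trace * phi₂ g μx μy δx δy Ωx Ωy l x) := by
  have hC : 0 ≤ C := (norm_nonneg _).trans (h0 0)
  have hg : ∀ w : EuclideanSpace ℝ (Fin n), Measurable fun x => inner ℝ w (gradient f x) := by
    intro w
    simp only [inner_gradient_eq]
    exact ((hf.continuous_fderiv (by norm_num)).clm_apply continuous_const).measurable
  have hgb : ∀ w x : EuclideanSpace ℝ (Fin n),
      |inner ℝ w (gradient f x)| ≤ C * ‖w‖ * (1 + ‖x‖) := fun w x => by
    rw [inner_gradient_eq]
    refine (abs_fderiv_le h1 w x).trans (le_mul_of_one_le_right (by positivity) ?_)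
    linarith [norm_nonneg x]
  have i1 := integrable_prod_phi (μx := μx) (μy := μy) H hx hy (hg (μy - μx)) (by positivity)
    (hgb (μy - μx))
  have i2 := integrable_prod_phi₁ (μx := μx) (μy := μy) H hx hy (hg (δy - δx)) (by positivity)
    (hgb (δy - δx))
  have i3 := integrable_prod_phi₂ (μx := μx) (μy := μy) H hx hy hn
    (continuous_trace_mul_hessian hf (Ωy - Ωx)).measurable hB
  have toI : ∀ {F : ℝ → ℝ}, Integrable F (volume.restrict (Icc 0 1)) →
      IntervalIntegrable F volume 0 1 := fun {F} hF =>
    (intervalIntegrable_iff_integrableOn_Icc_of_le zero_le_one).2 hF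
  have j1 : IntervalIntegrable (fun l => ∫ x, inner ℝ (μy - μx) (gradient f x) *
      phi g μx μy δx δy Ωx Ωy l x) volume 0 1 := toI i1.integral_prod_left
  have j2 : IntervalIntegrable (fun l => meanAbsU n g * ∫ x, inner ℝ (δy - δx) (gradient f x) *
      phi₁ g μx μy δx δy Ωx Ωy l x) volume 0 1 :=
    (toI i2.integral_prod_left).const_mul (meanAbsU n g)
  have j3 : IntervalIntegrable (fun l => meanSqR n g / (2 * n) *
      ∫ x, ((Ωy - Ωx) * hessianMatrix f x).trace * phi₂ g μx μy δx δy Ωx Ωy l x) volume 0 1 :=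
    (toI i3.integral_prod_left).const_mul (meanSqR n g / (2 * n))
  rw [← intervalIntegral.integral_const_mul, ← intervalIntegral.integral_const_mul,
    ← intervalIntegral.integral_add j1 j2, ← intervalIntegral.integral_add (j1.add j2) j3]
  -- The fundamental theorem needs only an integrable derivative; its continuity in `l` is never
  -- examined.
  refine (intervalIntegral.integral_eq_sub_of_hasDerivAt
    (f := fun l => ∫ x, f x * phi g μx μy δx δy Ωx Ωy l x) (fun l hl => ?_)
    ((j1.add j2).add j3)).symm
  rw [uIcc_of_le zero_le_one] at hl
  exact hasDerivAt_integral_phi H hx hy hn hf h0 h1 h2 hl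

theorem integral_phi_sub_of_hasCompactSupport (hn : 1 ≤ n) (hf : ContDiff ℝ 2 f)
    (hs : HasCompactSupport f) :
    (∫ x, f x * phi g μx μy δx δy Ωx Ωy 1 x) - ∫ x, f x * phi g μx μy δx δy Ωx Ωy 0 x =
      (∫ l in (0 : ℝ)..1, ∫ x, inner ℝ (μy - μx) (gradient f x) * phi g μx μy δx δy Ωx Ωy l x)
      + meanAbsU n g * (∫ l in (0 : ℝ)..1, ∫ x,
        inner ℝ (δy - δx) (gradient f x) * phi₁ g μx μy δx δy Ωx Ωy l x)
      + meanSqR n g / (2 * n) * (∫ l in (0 : ℝ)..1, ∫ x,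
        ((Ωy - Ωx) * hessianMatrix f x).trace * phi₂ g μx μy δx δy Ωx Ωy l x) := by
  have hs1 : HasCompactSupport (fderiv ℝ f) := hs.fderiv (𝕜 := ℝ)
  have hs2 : HasCompactSupport (fderiv ℝ (fderiv ℝ f)) := hs1.fderiv (𝕜 := ℝ)
  have hc1 : Continuous (fderiv ℝ f) := hf.continuous_fderiv (by norm_num)
  obtain ⟨C₀, h0⟩ := hf.continuous.bounded_above_of_compact_support hs
  obtain ⟨C₁, h1⟩ := hc1.bounded_above_of_compact_support hs1
  obtain ⟨C₂, h2⟩ := exists_bound_fderiv_fderiv_of_hasCompactSupport hf hs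
  have hss : HasCompactSupport fun x => ((Ωy - Ωx) * hessianMatrix f x).trace := by
    refine hs2.mono fun x hx hx0 => hx ?_
    have h3 : hessianMatrix f x = 0 := by
      ext i j
      rw [hessianMatrix_apply hf, hx0]
      rfl
    simp [h3]
  have hct := continuous_trace_mul_hessian hf (Ωy - Ωx)
  obtain ⟨B, hB⟩ := hct.bounded_above_of_compact_support hss
  refine integral_phi_sub_of_bounded (C := max C₀ (max C₁ C₂)) H hx hy hn hf
    (fun x => (h0 x).trans (le_max_left _ _))
    (fun x => (h1 x).trans ((le_max_left _ _).trans (le_max_right _ _)))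
    (fun x => (h2 x).trans ((le_max_right _ _).trans (le_max_right _ _))) hB

end CompactSupport

/-! ### Linear growth and dilated cutoff functions. -/

section Cutoff

open Filter Topology

theorem Continuous.exists_norm_le_of_isBigO_cocompact {E F : Type*} [SeminormedAddCommGroup E]
    [SeminormedAddCommGroup F] {h : E → F} (hc : Continuous h) (hO : h =O[cocompact E] fun x => ‖x‖) :
    ∃ C : ℝ, 0 ≤ C ∧ ∀ x, ‖h x‖ ≤ C * (1 + ‖x‖) := by
  obtain ⟨c, hc0, hb⟩ := hO.exists_nonneg
  obtain ⟨t, ht, hts⟩ := mem_cocompact.1 hb.bound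
  obtain ⟨B, hB⟩ := ht.exists_bound_of_continuousOn hc.continuousOn
  refine ⟨max c B, hc0.trans (le_max_left _ _), fun x => ?_⟩
  have hm : 0 ≤ max c B := hc0.trans (le_max_left _ _)
  by_cases hx : x ∈ t
  · exact (hB x hx).trans ((le_max_right _ _).trans
      (le_mul_of_one_le_right hm (by linarith [norm_nonneg x])))
  · have h1 : ‖h x‖ ≤ c * ‖‖x‖‖ := hts hx
    rw [norm_norm] at h1
    exact h1.trans (mul_le_mul (le_max_left _ _) (by linarith) (norm_nonneg x) hm)

theorem HasCompactSupport.exists_norm_mul_one_add_le {E F : Type*} [SeminormedAddCommGroup E]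
    [SeminormedAddCommGroup F] {h : E → F} (hs : HasCompactSupport h) (hc : Continuous h) :
    ∃ C : ℝ, ∀ x, ‖h x‖ * (1 + ‖x‖) ≤ C := by
  have hm : Continuous fun x => ‖h x‖ * (1 + ‖x‖) := by fun_prop
  have hsm : HasCompactSupport fun x => ‖h x‖ * (1 + ‖x‖) :=
    hs.mono fun x hx h0 => hx (by simp [h0])
  obtain ⟨C, hC⟩ := hm.bounded_above_of_compact_support hsm
  exact ⟨C, fun x => (le_abs_self _).trans (hC x)⟩

variable {E : Type*} [NormedAddCommGroup E] [NormedSpace ℝ E]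

theorem HasCompactSupport.exists_fderiv_mul_one_add_le {F : Type*} [NormedAddCommGroup F]
    [NormedSpace ℝ F] {k : E → F} (hk : ContDiff ℝ 1 k) (hs : HasCompactSupport k) :
    ∃ C : ℝ, ∀ x, ‖fderiv ℝ k x‖ * (1 + ‖x‖) ≤ C :=
  (hs.fderiv (𝕜 := ℝ)).exists_norm_mul_one_add_le (hk.continuous_fderiv (by norm_num))

theorem norm_fderiv_smul_comp_smul {F : Type*} [NormedAddCommGroup F] [NormedSpace ℝ F] (k : E → F)
    (r : ℝ) (x : E) :
    ‖fderiv ℝ (fun y => r • k (r • y)) x‖ = r * r * ‖fderiv ℝ k (r • x)‖ := by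
  change ‖fderiv ℝ (r • fun y => k (r • y)) x‖ = _
  rw [fderiv_const_smul_field, Pi.smul_apply, fderiv_comp_smul, smul_smul, norm_smul,
    Real.norm_of_nonneg (mul_self_nonneg r)]

theorem norm_fderiv_fderiv_comp_smul (f : E → ℝ) (r : ℝ) (x : E) :
    ‖fderiv ℝ (fderiv ℝ fun y => f (r • y)) x‖ =
      r * r * ‖fderiv ℝ (fderiv ℝ f) (r • x)‖ := by
  have h : (fderiv ℝ fun y => f (r • y)) = fun y => r • fderiv ℝ f (r • y) := by
    ext1 y
    exact fderiv_comp_smul r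
  rw [h]
  exact norm_fderiv_smul_comp_smul (fderiv ℝ f) r x

/-- The functions are `b (x / (N + 1))` for one bump `b`. Each derivative yields a factor `r = 1 /
(N + 1)`, and `r (1 + ‖x‖) ≤ 1 + ‖r x‖` reduces the weighted bounds to those for `b`. -/
theorem exists_cutoff [FiniteDimensional ℝ E] :
    ∃ (χ : ℕ → E → ℝ) (K : ℝ), 0 ≤ K ∧ (∀ N, ContDiff ℝ 2 (χ N)) ∧
      (∀ N, HasCompactSupport (χ N)) ∧ (∀ N x, |χ N x| ≤ 1) ∧
      (∀ N x, ‖fderiv ℝ (χ N) x‖ * (1 + ‖x‖) ≤ K) ∧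
      (∀ N x, ‖fderiv ℝ (fderiv ℝ (χ N)) x‖ * (1 + ‖x‖) ≤ K) ∧
      ∀ x, ∀ᶠ N in atTop, χ N =ᶠ[𝓝 x] 1 := by
  let b : ContDiffBump (0 : E) := ⟨1, 2, one_pos, one_lt_two⟩
  have hb : ContDiff ℝ 2 b := b.contDiff
  have hs1 : HasCompactSupport (fderiv ℝ b) := b.hasCompactSupport.fderiv (𝕜 := ℝ)
  have hb1 : ContDiff ℝ 1 (fderiv ℝ b) := hb.fderiv_right (by norm_num)
  obtain ⟨K₁, h1⟩ := b.hasCompactSupport.exists_fderiv_mul_one_add_le b.contDiff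
  obtain ⟨K₂, h2⟩ := hs1.exists_fderiv_mul_one_add_le hb1
  let r : ℕ → ℝ := fun N => 1 / ((N : ℝ) + 1)
  have hr0 : ∀ N, 0 < r N := fun N => Nat.one_div_pos_of_nat
  have hr1 : ∀ N, r N ≤ 1 := fun N => by
    rw [div_le_one (by positivity)]
    linarith [(Nat.cast_nonneg N : (0 : ℝ) ≤ N)]
  have hsm : ∀ N (x : E), r N * (1 + ‖x‖) ≤ 1 + ‖r N • x‖ := fun N x => by
    rw [norm_smul, Real.norm_of_nonneg (hr0 N).le]
    linarith [hr1 N]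
  refine ⟨fun N x => b (r N • x), max K₁ K₂,
    (by positivity : (0 : ℝ) ≤ _).trans (h1 0) |>.trans (le_max_left _ _),
    fun N => hb.comp (contDiff_const_smul _), fun N => ?_, fun N x => ?_, fun N x => ?_,
    fun N x => ?_, fun x => ?_⟩
  · exact b.hasCompactSupport.comp_homeomorph (Homeomorph.smulOfNeZero (r N) (hr0 N).ne')
  · rw [abs_of_nonneg b.nonneg]
    exact b.le_one
  · rw [fderiv_comp_smul, norm_smul, Real.norm_of_nonneg (hr0 N).le, mul_comm (r N), mul_assoc]
    refine (mul_le_mul_of_nonneg_left (hsm N x) (norm_nonneg _)).trans ?_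
    exact (h1 _).trans (le_max_left _ _)
  · rw [norm_fderiv_fderiv_comp_smul]
    calc r N * r N * ‖fderiv ℝ (fderiv ℝ b) (r N • x)‖ * (1 + ‖x‖)
        = r N * (‖fderiv ℝ (fderiv ℝ b) (r N • x)‖ * (r N * (1 + ‖x‖))) := by ring
      -- One of the two factors `r` absorbs the weight; the other is only needed to be at most `1`.
      _ ≤ 1 * (‖fderiv ℝ (fderiv ℝ b) (r N • x)‖ * (1 + ‖r N • x‖)) := by
          have := hr0 N
          gcongr
          exacts [hr1 N, hsm N x]
      _ ≤ max K₁ K₂ := by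
          rw [one_mul]
          exact (h2 _).trans (le_max_right _ _)
  · have hlim : Tendsto (fun N => r N • x) atTop (𝓝 0) := by
      simpa only [zero_smul] using (tendsto_one_div_add_atTop_nhds_zero_nat (𝕜 := ℝ)).smul_const x
    filter_upwards [hlim.eventually b.eventuallyEq_one.eventually_nhds] with N hN
    have hcont : Tendsto (fun y => r N • y) (𝓝 x) (𝓝 (r N • x)) :=
      (continuous_const_smul (r N)).tendsto x
    exact hcont.eventually hN

theorem fderiv_mul_apply {χ f : E → ℝ} (hχ : ContDiff ℝ 2 χ) (hf : ContDiff ℝ 2 f) (x : E) :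
    fderiv ℝ (fun y => χ y * f y) x = χ x • fderiv ℝ f x + f x • fderiv ℝ χ x :=
  fderiv_fun_mul (hχ.differentiable (by norm_num) x) (hf.differentiable (by norm_num) x)

theorem fderiv_fderiv_mul_apply {χ f : E → ℝ} (hχ : ContDiff ℝ 2 χ) (hf : ContDiff ℝ 2 f)
    (x v w : E) : fderiv ℝ (fderiv ℝ fun y => χ y * f y) x v w =
      χ x * fderiv ℝ (fderiv ℝ f) x v w + (fderiv ℝ χ x v * fderiv ℝ f x w +
        (fderiv ℝ f x v * fderiv ℝ χ x w + f x * fderiv ℝ (fderiv ℝ χ) x v w)) := by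
  have h : (fderiv ℝ fun y => χ y * f y) =
      fun y => χ y • fderiv ℝ f y + f y • fderiv ℝ χ y :=
    funext fun y => fderiv_mul_apply hχ hf y
  have d1 : ∀ {k : E → ℝ}, ContDiff ℝ 2 k → HasFDerivAt k (fderiv ℝ k x) x := fun hk =>
    (hk.differentiable (by norm_num) x).hasFDerivAt
  have d2 : ∀ {k : E → ℝ}, ContDiff ℝ 2 k →
      HasFDerivAt (fderiv ℝ k) (fderiv ℝ (fderiv ℝ k) x) x := fun hk =>
    ((hk.fderiv_right (m := 1) (by norm_num)).differentiable (by norm_num) x).hasFDerivAt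
  have := ((d1 hχ).smul (d2 hf)).add ((d1 hf).smul (d2 hχ))
  rw [h]
  refine (congrArg (fun L => L v w) this.fderiv).trans ?_
  simp
  ring

end Cutoff

/-! ### Removing the cutoff by dominated convergence. -/

section Truncation

open Filter Topology

variable {n : ℕ}

theorem norm_gradient_eq (f : EuclideanSpace ℝ (Fin n) → ℝ) (x : EuclideanSpace ℝ (Fin n)) :
    ‖gradient f x‖ = ‖fderiv ℝ f x‖ := by
  rw [gradient, LinearIsometryEquiv.norm_map]

theorem measurable_inner_gradient {f : EuclideanSpace ℝ (Fin n) → ℝ} (hf : ContDiff ℝ 2 f)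
    (w : EuclideanSpace ℝ (Fin n)) : Measurable fun x => inner ℝ w (gradient f x) := by
  simp only [inner_gradient_eq]
  exact ((hf.continuous_fderiv (by norm_num)).clm_apply continuous_const).measurable

theorem abs_inner_gradient_le {f : EuclideanSpace ℝ (Fin n) → ℝ} {C : ℝ}
    (h1 : ∀ x, ‖fderiv ℝ f x‖ ≤ C * (1 + ‖x‖)) (w x : EuclideanSpace ℝ (Fin n)) :
    |inner ℝ w (gradient f x)| ≤ ‖w‖ * C * (1 + ‖x‖) := by
  refine (abs_real_inner_le_norm _ _).trans ?_
  rw [norm_gradient_eq, mul_assoc]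
  exact mul_le_mul_of_nonneg_left (h1 x) (norm_nonneg _)

theorem norm_fderiv_mul_le {χ f : EuclideanSpace ℝ (Fin n) → ℝ} (hχ : ContDiff ℝ 2 χ)
    (hf : ContDiff ℝ 2 f) {C K : ℝ} (hC : 0 ≤ C) (x : EuclideanSpace ℝ (Fin n))
    (hχ0 : |χ x| ≤ 1) (hχ1 : ‖fderiv ℝ χ x‖ * (1 + ‖x‖) ≤ K)
    (h0 : |f x| ≤ C * (1 + ‖x‖)) (h1 : ‖fderiv ℝ f x‖ ≤ C * (1 + ‖x‖)) :
    ‖fderiv ℝ (fun y => χ y * f y) x‖ ≤ (C + C * K) * (1 + ‖x‖) := by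
  rw [fderiv_mul_apply hχ hf]
  refine (norm_add_le _ _).trans ?_
  rw [norm_smul, norm_smul, Real.norm_eq_abs, Real.norm_eq_abs]
  have hx := norm_nonneg x
  have e1 : |χ x| * ‖fderiv ℝ f x‖ ≤ 1 * (C * (1 + ‖x‖)) := by gcongr
  have e2 : |f x| * ‖fderiv ℝ χ x‖ ≤ C * K := by
    calc |f x| * ‖fderiv ℝ χ x‖ ≤ C * (1 + ‖x‖) * ‖fderiv ℝ χ x‖ := by gcongr
      _ = C * (‖fderiv ℝ χ x‖ * (1 + ‖x‖)) := by ring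
      _ ≤ C * K := by gcongr
  have hK : 0 ≤ K := (by positivity : (0 : ℝ) ≤ ‖fderiv ℝ χ x‖ * (1 + ‖x‖)).trans hχ1
  nlinarith [mul_nonneg (mul_nonneg hC hK) hx]

/-- The difference consists of three terms in which at least one derivative falls on `χ`. Its decay
`K / (1 + ‖x‖)` cancels the linear growth of `f` or `∇f`, so each term is at most `C K`. -/
theorem abs_hessianMatrix_mul_sub_le {χ f : EuclideanSpace ℝ (Fin n) → ℝ} (hχ : ContDiff ℝ 2 χ)
    (hf : ContDiff ℝ 2 f) {C K : ℝ} (hC : 0 ≤ C) (x : EuclideanSpace ℝ (Fin n))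
    (hχ1 : ‖fderiv ℝ χ x‖ * (1 + ‖x‖) ≤ K)
    (hχ2 : ‖fderiv ℝ (fderiv ℝ χ) x‖ * (1 + ‖x‖) ≤ K)
    (h0 : |f x| ≤ C * (1 + ‖x‖)) (h1 : ‖fderiv ℝ f x‖ ≤ C * (1 + ‖x‖)) (i j : Fin n) :
    |hessianMatrix (fun y => χ y * f y) x i j - χ x * hessianMatrix f x i j| ≤ 3 * (C * K) := by
  rw [hessianMatrix_apply (hχ.mul hf), hessianMatrix_apply hf, fderiv_fderiv_mul_apply hχ hf,
    add_sub_cancel_left]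
  have he : ∀ k : Fin n, ‖EuclideanSpace.single k (1 : ℝ)‖ = 1 := fun k => by simp
  have ap : ∀ (L : EuclideanSpace ℝ (Fin n) →L[ℝ] ℝ) (k : Fin n),
      |L (EuclideanSpace.single k 1)| ≤ ‖L‖ := fun L k => by
    simpa [he] using L.le_opNorm (EuclideanSpace.single k 1)
  have ap2 : |fderiv ℝ (fderiv ℝ χ) x (EuclideanSpace.single i 1) (EuclideanSpace.single j 1)| ≤
      ‖fderiv ℝ (fderiv ℝ χ) x‖ := by
    refine (ap _ j).trans ?_
    simpa [he] using (fderiv ℝ (fderiv ℝ χ) x).le_opNorm (EuclideanSpace.single i 1)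
  have key : ∀ a b p : ℝ, |a| ≤ p → |b| ≤ C * (1 + ‖x‖) → p * (1 + ‖x‖) ≤ K →
      |a * b| ≤ C * K := fun a b p ha hb hpK => by
    have hp := (abs_nonneg a).trans ha
    rw [abs_mul]
    calc |a| * |b| ≤ p * (C * (1 + ‖x‖)) := by gcongr
      _ = C * (p * (1 + ‖x‖)) := by ring
      _ ≤ C * K := by gcongr
  have e1 := key _ _ _ (ap (fderiv ℝ χ x) i) ((ap (fderiv ℝ f x) j).trans h1) hχ1
  have e2 := key _ _ _ (ap (fderiv ℝ χ x) j) ((ap (fderiv ℝ f x) i).trans h1) hχ1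
  have e3 := key _ _ _ ap2 h0 hχ2
  rw [mul_comm] at e2 e3
  refine (abs_add_le _ _).trans ?_
  have := abs_add_le (fderiv ℝ f x (EuclideanSpace.single i 1) *
    fderiv ℝ χ x (EuclideanSpace.single j 1))
    (f x * fderiv ℝ (fderiv ℝ χ) x (EuclideanSpace.single i 1) (EuclideanSpace.single j 1))
  linarith

theorem abs_trace_mul_hessian_mul_le {χ f : EuclideanSpace ℝ (Fin n) → ℝ} (hχ : ContDiff ℝ 2 χ)
    (hf : ContDiff ℝ 2 f) {C K : ℝ} (hC : 0 ≤ C) (x : EuclideanSpace ℝ (Fin n))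
    (hχ0 : |χ x| ≤ 1) (hχ1 : ‖fderiv ℝ χ x‖ * (1 + ‖x‖) ≤ K)
    (hχ2 : ‖fderiv ℝ (fderiv ℝ χ) x‖ * (1 + ‖x‖) ≤ K)
    (h0 : |f x| ≤ C * (1 + ‖x‖)) (h1 : ‖fderiv ℝ f x‖ ≤ C * (1 + ‖x‖))
    (M : Matrix (Fin n) (Fin n) ℝ) :
    |(M * hessianMatrix (fun y => χ y * f y) x).trace| ≤
      |(M * hessianMatrix f x).trace| + ∑ i, ∑ j, |M i j| * (3 * (C * K)) := by
  have hdec : (M * hessianMatrix (fun y => χ y * f y) x).trace =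
      χ x * (M * hessianMatrix f x).trace + ∑ i, ∑ j, M i j *
        (hessianMatrix (fun y => χ y * f y) x j i - χ x * hessianMatrix f x j i) := by
    simp only [Matrix.trace, Matrix.diag, Matrix.mul_apply, Finset.mul_sum,
      ← Finset.sum_add_distrib]
    exact Finset.sum_congr rfl fun i _ => Finset.sum_congr rfl fun j _ => by ring
  rw [hdec]
  refine (abs_add_le _ _).trans (add_le_add ?_ ?_)
  · rw [abs_mul]
    exact mul_le_of_le_one_left (abs_nonneg _) hχ0
  · refine (Finset.abs_sum_le_sum_abs _ _).trans (Finset.sum_le_sum fun i _ => ?_)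
    refine (Finset.abs_sum_le_sum_abs _ _).trans (Finset.sum_le_sum fun j _ => ?_)
    rw [abs_mul]
    exact mul_le_mul_of_nonneg_left
      (abs_hessianMatrix_mul_sub_le hχ hf hC x hχ1 hχ2 h0 h1 j i) (abs_nonneg _)

theorem hessianMatrix_congr {f k : EuclideanSpace ℝ (Fin n) → ℝ} {x : EuclideanSpace ℝ (Fin n)}
    (h : f =ᶠ[𝓝 x] k) : hessianMatrix f x = hessianMatrix k x := by
  ext i j
  simp only [hessianMatrix, Matrix.of_apply]
  refine congrArg (fun L : EuclideanSpace ℝ (Fin n) →L[ℝ] ℝ => L (EuclideanSpace.single i 1))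
    (Filter.EventuallyEq.fderiv_eq ?_)
  filter_upwards [h.fderiv (𝕜 := ℝ)] with y hy
  rw [hy]

theorem gradient_congr {f k : EuclideanSpace ℝ (Fin n) → ℝ} {x : EuclideanSpace ℝ (Fin n)}
    (h : f =ᶠ[𝓝 x] k) : gradient f x = gradient k x := by
  rw [gradient, gradient, h.fderiv_eq]

/-- Dominated convergence is applied once on the product of `[0, 1]` and space, so no bound uniform
in `λ` on the inner integrals is required. -/
theorem tendsto_intervalIntegral_integral_mul {p : ℝ → EuclideanSpace ℝ (Fin n) → ℝ}
    (hp : Measurable fun q : ℝ × EuclideanSpace ℝ (Fin n) => p q.1 q.2)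
    {a : ℕ → EuclideanSpace ℝ (Fin n) → ℝ} {a' b : EuclideanSpace ℝ (Fin n) → ℝ}
    (ha : ∀ N, Measurable (a N)) (hab : ∀ N x, |a N x| ≤ b x)
    (hlim : ∀ x, Tendsto (fun N => a N x) atTop (𝓝 (a' x)))
    (hb : Integrable (fun q : ℝ × EuclideanSpace ℝ (Fin n) => b q.2 * |p q.1 q.2|)
      ((volume.restrict (Icc 0 1)).prod volume)) :
    Tendsto (fun N => ∫ l in (0 : ℝ)..1, ∫ x, a N x * p l x) atTop
      (𝓝 (∫ l in (0 : ℝ)..1, ∫ x, a' x * p l x)) := by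
  have hm : ∀ {F : EuclideanSpace ℝ (Fin n) → ℝ}, Measurable F → Measurable
      fun q : ℝ × EuclideanSpace ℝ (Fin n) => F q.2 * p q.1 q.2 := fun hF =>
    (hF.comp measurable_snd).mul hp
  have hle : ∀ {F : EuclideanSpace ℝ (Fin n) → ℝ}, (∀ x, |F x| ≤ b x) →
      ∀ q : ℝ × EuclideanSpace ℝ (Fin n), ‖F q.2 * p q.1 q.2‖ ≤ b q.2 * |p q.1 q.2| :=
    fun hF q => by
      rw [Real.norm_eq_abs, abs_mul]
      exact mul_le_mul_of_nonneg_right (hF _) (abs_nonneg _)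
  have hit : ∀ {F : EuclideanSpace ℝ (Fin n) → ℝ}, Measurable F → (∀ x, |F x| ≤ b x) →
      ∫ l in (0 : ℝ)..1, ∫ x, F x * p l x = ∫ q : ℝ × EuclideanSpace ℝ (Fin n),
        F q.2 * p q.1 q.2 ∂((volume.restrict (Icc 0 1)).prod volume) := fun {F} hF hFb => by
    rw [intervalIntegral.integral_of_le zero_le_one, ← integral_Icc_eq_integral_Ioc]
    exact (integral_prod (fun q : ℝ × EuclideanSpace ℝ (Fin n) => F q.2 * p q.1 q.2)
      (hb.mono' (hm hF).aestronglyMeasurable (.of_forall (hle hFb)))).symm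
  have ha' : Measurable a' := measurable_of_tendsto_metrizable ha (tendsto_pi_nhds.2 hlim)
  have hab' : ∀ x, |a' x| ≤ b x := fun x =>
    le_of_tendsto (hlim x).abs (.of_forall fun N => hab N x)
  rw [hit ha' hab']
  simp only [fun N => hit (ha N) (hab N)]
  exact tendsto_integral_of_dominated_convergence _ (fun N => (hm (ha N)).aestronglyMeasurable)
    hb (fun N => .of_forall (hle (hab N)))
    (.of_forall fun q => (hlim q.2).mul_const _)

variable {g : ℝ → ℝ} {μx μy δx δy : EuclideanSpace ℝ (Fin n)}
  {Ωx Ωy : Matrix (Fin n) (Fin n) ℝ} {f : EuclideanSpace ℝ (Fin n) → ℝ} {C : ℝ}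

theorem integral_phi_sub (H : HasSecondMoment n g)
    (hx : (Ωx - Matrix.vecMulVec δx.ofLp δx.ofLp).PosDef)
    (hy : (Ωy - Matrix.vecMulVec δy.ofLp δy.ofLp).PosDef) (hn : 1 ≤ n) (hf : ContDiff ℝ 2 f)
    (hC : 0 ≤ C) (h0 : ∀ x, |f x| ≤ C * (1 + ‖x‖)) (h1 : ∀ x, ‖fderiv ℝ f x‖ ≤ C * (1 + ‖x‖))
    (hH : Integrable (fun p : ℝ × EuclideanSpace ℝ (Fin n) =>
        ((Ωy - Ωx) * hessianMatrix f p.2).trace * phi₂ g μx μy δx δy Ωx Ωy p.1 p.2)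
      ((volume.restrict (Icc 0 1)).prod volume)) :
    (∫ x, f x * phi g μx μy δx δy Ωx Ωy 1 x) - ∫ x, f x * phi g μx μy δx δy Ωx Ωy 0 x =
      (∫ l in (0 : ℝ)..1, ∫ x, inner ℝ (μy - μx) (gradient f x) * phi g μx μy δx δy Ωx Ωy l x)
      + meanAbsU n g * (∫ l in (0 : ℝ)..1, ∫ x,
        inner ℝ (δy - δx) (gradient f x) * phi₁ g μx μy δx δy Ωx Ωy l x)
      + meanSqR n g / (2 * n) * (∫ l in (0 : ℝ)..1, ∫ x,
        ((Ωy - Ωx) * hessianMatrix f x).trace * phi₂ g μx μy δx δy Ωx Ωy l x) := by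
  obtain ⟨χ, K, hK, hχ, hχs, hχ0, hχ1, hχ2, hχe⟩ := exists_cutoff (E := EuclideanSpace ℝ (Fin n))
  let F : ℕ → EuclideanSpace ℝ (Fin n) → ℝ := fun N x => χ N x * f x
  have hF : ∀ N, ContDiff ℝ 2 (F N) := fun N => (hχ N).mul hf
  have hFe : ∀ x, ∀ᶠ N in atTop, F N =ᶠ[𝓝 x] f := fun x => (hχe x).mono fun N hN => by
    filter_upwards [hN] with y hy'
    simp [F, hy']
  have hF0 : ∀ N x, |F N x| ≤ C * (1 + ‖x‖) := fun N x => by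
    rw [abs_mul]
    exact (mul_le_of_le_one_left (abs_nonneg _) (hχ0 N x)).trans (h0 x)
  have hF1 : ∀ N x, ‖fderiv ℝ (F N) x‖ ≤ (C + C * K) * (1 + ‖x‖) := fun N x =>
    norm_fderiv_mul_le (hχ N) hf hC x (hχ0 N x) (hχ1 N x) (h0 x) (h1 x)
  have hb : ∀ {c : ℝ}, 0 ≤ c → ∀ x : EuclideanSpace ℝ (Fin n), |c * (1 + ‖x‖)| ≤ c * (1 + ‖x‖) :=
    fun hc x => (abs_of_nonneg (by positivity)).le
  have hbm : ∀ c : ℝ, Measurable fun x : EuclideanSpace ℝ (Fin n) => c * (1 + ‖x‖) :=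
    fun c => by fun_prop
  have hD : 0 ≤ C + C * K := by positivity
  have hend : ∀ l ∈ Icc (0 : ℝ) 1, Tendsto (fun N => ∫ x, F N x * phi g μx μy δx δy Ωx Ωy l x)
      atTop (𝓝 (∫ x, f x * phi g μx μy δx δy Ωx Ωy l x)) := fun l hl => by
    obtain ⟨K', -, hK'⟩ := exists_bound_interp μx μy δx δy Ωx Ωy
    have hpl := isProbDensity_phi (μx := μx) (μy := μy) H hx hy hl
    refine tendsto_integral_of_dominated_convergence _
      (fun N => ((hF N).continuous.measurable.mul hpl.measurable).aestronglyMeasurable)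
      (moment_phi H hx hy hl (hbm C) hC (hb hC) (hK' l hl)).1
      (fun N => .of_forall fun x => ?_) (.of_forall fun x => ?_)
    · rw [norm_mul, Real.norm_of_nonneg (hpl.nonneg x)]
      exact mul_le_mul_of_nonneg_right (hF0 N x) (hpl.nonneg x)
    · exact (tendsto_const_nhds.congr' ((hFe x).mono fun N hN => hN.eq_of_nhds.symm)).mul_const _
  have habs : ∀ {c : ℝ} {p : ℝ → EuclideanSpace ℝ (Fin n) → ℝ}, 0 ≤ c →
      Integrable (fun q : ℝ × EuclideanSpace ℝ (Fin n) => c * (1 + ‖q.2‖) * p q.1 q.2)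
        ((volume.restrict (Icc 0 1)).prod volume) →
      Integrable (fun q : ℝ × EuclideanSpace ℝ (Fin n) => c * (1 + ‖q.2‖) * |p q.1 q.2|)
        ((volume.restrict (Icc 0 1)).prod volume) := fun hc hp =>
    hp.abs.congr (.of_forall fun q => by
      dsimp only
      rw [abs_mul, abs_of_nonneg (by positivity)])
  have hgrad : ∀ w x : EuclideanSpace ℝ (Fin n), Tendsto (fun N => inner ℝ w (gradient (F N) x))
      atTop (𝓝 (inner ℝ w (gradient f x))) := fun w x =>
    tendsto_const_nhds.congr' ((hFe x).mono fun N hN => by dsimp only; rw [gradient_congr hN])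
  have t1 := tendsto_intervalIntegral_integral_mul
    (measurable_phi μx μy δx δy Ωx Ωy H.gen.measurable)
    (fun N => measurable_inner_gradient (hF N) (μy - μx))
    (fun N => abs_inner_gradient_le (hF1 N) (μy - μx)) (hgrad (μy - μx))
    (habs (by positivity) (integrable_prod_phi H hx hy (hbm _) (by positivity)
      (hb (by positivity))))
  have t2 := tendsto_intervalIntegral_integral_mul
    (measurable_phi₁ μx μy δx δy Ωx Ωy H.gen.measurable)
    (fun N => measurable_inner_gradient (hF N) (δy - δx))
    (fun N => abs_inner_gradient_le (hF1 N) (δy - δx)) (hgrad (δy - δx))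
    (habs (by positivity) (integrable_prod_phi₁ H hx hy (hbm _) (by positivity)
      (hb (by positivity))))
  let D : ℝ := ∑ i, ∑ j, |(Ωy - Ωx) i j| * (3 * (C * K))
  have t3 := tendsto_intervalIntegral_integral_mul
    (a := fun N x => ((Ωy - Ωx) * hessianMatrix (F N) x).trace)
    (a' := fun x => ((Ωy - Ωx) * hessianMatrix f x).trace)
    (b := fun x => |((Ωy - Ωx) * hessianMatrix f x).trace| + D)
    (measurable_phi₂ μx μy δx δy Ωx Ωy H.gen.measurable)
    (fun N => (continuous_trace_mul_hessian (hF N) (Ωy - Ωx)).measurable)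
    (fun N x => abs_trace_mul_hessian_mul_le (hχ N) hf hC x (hχ0 N x) (hχ1 N x) (hχ2 N x)
      (h0 x) (h1 x) (Ωy - Ωx))
    (fun x => tendsto_const_nhds.congr' ((hFe x).mono fun N hN => by dsimp only; rw [hessianMatrix_congr hN]))
    -- The majorant is integrable by the assumption on the Hessian term plus a constant integrated
    -- against the probability densities `φ₂`. This is why the cutoff errors had to be bounded and
    -- not merely of linear growth.
    (by
      have i1 := integrable_prod_phi₂ (μx := μx) (μy := μy) H hx hy hn
        (F := fun _ => D) measurable_const (C := |D|) fun _ => le_rfl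
      have hD0 : 0 ≤ D := Finset.sum_nonneg fun i _ => Finset.sum_nonneg fun j _ => by positivity
      refine (hH.abs.add i1.abs).congr (.of_forall fun q => ?_)
      simp only [Pi.add_apply, abs_mul, abs_of_nonneg hD0]
      ring)
  have hlim := (hend 1 (by simp)).sub (hend 0 (by simp))
  refine tendsto_nhds_unique hlim (((t1.add (t2.const_mul (meanAbsU n g))).add
    (t3.const_mul (meanSqR n g / (2 * n)))).congr fun N => ?_)
  exact (integral_phi_sub_of_hasCompactSupport H hx hy hn (hF N) (hχs N).mul_right).symm

end Truncation

/-! ### End points of the path and the final theorem. -/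

theorem interp_zero {V : Type*} [AddCommGroup V] [Module ℝ V] (a b : V) : interp a b 0 = a := by
  simp [interp]

theorem interp_one {V : Type*} [AddCommGroup V] [Module ℝ V] (a b : V) : interp a b 1 = b := by
  simp [interp]

theorem integrable_and_integral_comp_of_hasLaw {n : ℕ} {S : Type*} [MeasurableSpace S]
    {P : Measure S} {X : S → EuclideanSpace ℝ (Fin n)} {μ α : EuclideanSpace ℝ (Fin n)}
    {Ω : Matrix (Fin n) (Fin n) ℝ} {g : ℝ → ℝ} (hX : HasLaw X (skewEllipticalLaw μ Ω α g) P)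
    (hp : IsProbDensity (skewEllipticalPDF μ Ω α g)) {f : EuclideanSpace ℝ (Fin n) → ℝ}
    (hf : Measurable f) (hi : Integrable fun x => f x * skewEllipticalPDF μ Ω α g x) :
    Integrable (fun s => f (X s)) P ∧
      ∫ s, f (X s) ∂P = ∫ x, f x * skewEllipticalPDF μ Ω α g x := by
  have hfm : AEStronglyMeasurable f (P.map X) := hf.aestronglyMeasurable
  constructor
  · rw [← Function.comp_def f, ← integrable_map_measure hfm hX.aemeasurable, hX.map_eq,
      skewEllipticalLaw, integrable_withDensity_iff hp.measurable.ennreal_ofReal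
        (.of_forall fun _ => ENNReal.ofReal_lt_top)]
    exact hi.congr (.of_forall fun x => by
      dsimp only; rw [ENNReal.toReal_ofReal (hp.nonneg x)])
  · rw [← integral_map hX.aemeasurable hfm, hX.map_eq, skewEllipticalLaw,
      integral_withDensity_eq_integral_toReal_smul hp.measurable.ennreal_ofReal
        (.of_forall fun _ => ENNReal.ofReal_lt_top)]
    exact integral_congr_ae (.of_forall fun x => by
      dsimp only; rw [ENNReal.toReal_ofReal (hp.nonneg x), smul_eq_mul, mul_comm])

theorem lemma2p2 {n : ℕ} (hn : 1 ≤ n)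
    {S T : Type*} [MeasurableSpace S] [MeasurableSpace T]
    (P : Measure S) [IsProbabilityMeasure P] (Q : Measure T) [IsProbabilityMeasure Q]
    (X : S → EuclideanSpace ℝ (Fin n)) (Y : T → EuclideanSpace ℝ (Fin n))
    (g : ℝ → ℝ) (hg : IsDensityGenerator (n + 1) g)
    -- the generator has finite second moments, so that `E(R²)` and `E|U₀|` exist
    (hg2 : Integrable (fun z : EuclideanSpace ℝ (Fin (n + 1)) => ‖z‖ ^ 2) (sphericalLaw (n + 1) g))
    (μx μy αx αy δx δy : EuclideanSpace ℝ (Fin n))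
    (Ωx Ωy : Matrix (Fin n) (Fin n) ℝ) (hΩx : Ωx.PosDef) (hΩy : Ωy.PosDef)
    (hX : HasLaw X (skewEllipticalLaw μx Ωx αx g) P)
    (hY : HasLaw Y (skewEllipticalLaw μy Ωy αy g) Q)
    (hδx : δx = skewness Ωx αx) (hδy : δy = skewness Ωy αy)
    (f : EuclideanSpace ℝ (Fin n) → ℝ) (hf : ContDiff ℝ 2 f)
    (hfO : f =O[Filter.cocompact (EuclideanSpace ℝ (Fin n))] fun x => ‖x‖)
    (hfO' : gradient f =O[Filter.cocompact (EuclideanSpace ℝ (Fin n))] fun x => ‖x‖)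
    -- the integral of the Hessian term exists
    (hH : Integrable (fun p : ℝ × EuclideanSpace ℝ (Fin n) =>
        ((Ωy - Ωx) * hessianMatrix f p.2).trace * phi₂ g μx μy δx δy Ωx Ωy p.1 p.2)
      ((volume.restrict (Icc 0 1)).prod volume)) :
    -- the three functions are probability densities
    (∀ l ∈ Icc (0 : ℝ) 1,
      IsProbDensity (phi g μx μy δx δy Ωx Ωy l) ∧
      IsProbDensity (phi₁ g μx μy δx δy Ωx Ωy l) ∧
      IsProbDensity (phi₂ g μx μy δx δy Ωx Ωy l)) ∧
    -- the remaining expectations and integrals exist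
    Integrable (fun s => f (X s)) P ∧ Integrable (fun t => f (Y t)) Q ∧
    Integrable (fun p : ℝ × EuclideanSpace ℝ (Fin n) =>
        inner ℝ (μy - μx) (gradient f p.2) * phi g μx μy δx δy Ωx Ωy p.1 p.2)
      ((volume.restrict (Icc 0 1)).prod volume) ∧
    Integrable (fun p : ℝ × EuclideanSpace ℝ (Fin n) =>
        inner ℝ (δy - δx) (gradient f p.2) * phi₁ g μx μy δx δy Ωx Ωy p.1 p.2)
      ((volume.restrict (Icc 0 1)).prod volume) ∧
    -- the identity
    (∫ t, f (Y t) ∂Q) - (∫ s, f (X s) ∂P) =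
      (∫ l in (0 : ℝ)..1, ∫ x : EuclideanSpace ℝ (Fin n),
        inner ℝ (μy - μx) (gradient f x) * phi g μx μy δx δy Ωx Ωy l x)
      + meanAbsU n g * (∫ l in (0 : ℝ)..1, ∫ x : EuclideanSpace ℝ (Fin n),
        inner ℝ (δy - δx) (gradient f x) * phi₁ g μx μy δx δy Ωx Ωy l x)
      + meanSqR n g / (2 * n) * (∫ l in (0 : ℝ)..1, ∫ x : EuclideanSpace ℝ (Fin n),
        ((Ωy - Ωx) * hessianMatrix f x).trace * phi₂ g μx μy δx δy Ωx Ωy l x) := by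
  have H := hasSecondMoment_of_sphericalLaw hg hg2
  have hx : (Ωx - Matrix.vecMulVec δx.ofLp δx.ofLp).PosDef := hδx ▸ posDef_sub_skewness hΩx αx
  have hy : (Ωy - Matrix.vecMulVec δy.ofLp δy.ofLp).PosDef := hδy ▸ posDef_sub_skewness hΩy αy
  have m0 : (0 : ℝ) ∈ Icc (0 : ℝ) 1 := by simp
  have m1 : (1 : ℝ) ∈ Icc (0 : ℝ) 1 := by simp
  -- At the end points the path returns the given laws, because `slant` recovers `α` from the
  -- skewness vector.
  have hphi0 : phi g μx μy δx δy Ωx Ωy 0 = skewEllipticalPDF μx Ωx αx g := by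
    simp only [phi, interp_zero]
    rw [hδx, slant_skewness hΩx]
  have hphi1 : phi g μx μy δx δy Ωx Ωy 1 = skewEllipticalPDF μy Ωy αy g := by
    simp only [phi, interp_one]
    rw [hδy, slant_skewness hΩy]
  -- Growth at infinity together with continuity gives the global bound `C (1 + ‖x‖)` used
  -- throughout.
  obtain ⟨C₀, hC₀, h0⟩ := hf.continuous.exists_norm_le_of_isBigO_cocompact hfO
  have hgc : Continuous fun x => ‖gradient f x‖ := by
    simp only [norm_gradient_eq]
    exact (hf.continuous_fderiv (by norm_num)).norm
  obtain ⟨C₁, hC₁, h1⟩ := hgc.exists_norm_le_of_isBigO_cocompact hfO'.norm_left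
  have h0' : ∀ x, |f x| ≤ max C₀ C₁ * (1 + ‖x‖) := fun x =>
    (h0 x).trans (mul_le_mul_of_nonneg_right (le_max_left _ _) (by positivity))
  have h1' : ∀ x, ‖fderiv ℝ f x‖ ≤ max C₀ C₁ * (1 + ‖x‖) := fun x => by
    have h2 := h1 x
    rw [norm_norm, norm_gradient_eq] at h2
    exact h2.trans (mul_le_mul_of_nonneg_right (le_max_right _ _) (by positivity))
  have hC : 0 ≤ max C₀ C₁ := hC₀.trans (le_max_left _ _)
  have hfm := hf.continuous.measurable
  obtain ⟨K, -, hK⟩ := exists_bound_interp μx μy δx δy Ωx Ωy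
  have i0 := (moment_phi H hx hy m0 hfm hC h0' (hK 0 m0)).1
  have i1 := (moment_phi H hx hy m1 hfm hC h0' (hK 1 m1)).1
  have p0 := isProbDensity_phi (μx := μx) (μy := μy) H hx hy m0
  have p1 := isProbDensity_phi (μx := μx) (μy := μy) H hx hy m1
  have hmain := integral_phi_sub H hx hy hn hf hC h0' h1' hH
  rw [hphi0] at i0 p0 hmain
  rw [hphi1] at i1 p1 hmain
  have hXf := integrable_and_integral_comp_of_hasLaw hX p0 hfm i0
  have hYf := integrable_and_integral_comp_of_hasLaw hY p1 hfm i1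
  refine ⟨fun l hl => ⟨isProbDensity_phi H hx hy hl, isProbDensity_phi₁ H hx hy hl,
    isProbDensity_phi₂ H hx hy hn hl⟩, hXf.1, hYf.1, ?_, ?_, ?_⟩
  · exact integrable_prod_phi H hx hy (measurable_inner_gradient hf _)
      (mul_nonneg (norm_nonneg _) hC) (abs_inner_gradient_le h1' _)
  · exact integrable_prod_phi₁ H hx hy (measurable_inner_gradient hf _)
      (mul_nonneg (norm_nonneg _) hC) (abs_inner_gradient_le h1' _)
  · rw [hXf.2, hYf.2]
    exact hmain
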